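/- **Theorem 1.** All functions are real-valued. For a $2\pi$-periodic summable $f$ put $a_k(f)=\frac1\pi\int_0^{2\pi}f(t)\cos kt\,dt$, $b_k(f)=\frac1\pi\int_0^{2\pi}f(t)\sin kt\,dt$, and $\|f\|_p=\big(\int_0^{2\pi}|f|^p\big)^{1/p}$; $\|f\|_C=\max_t|f(t)|$ for continuous $f$. *Notation.* $\mathfrak M$ is the set of positive, continuous, convex functions $g$ on $[1,\infty)$ with $g(t)\to0$ as $t\to\infty$. Put $\alpha(g;t)=\dfrac{g(t)}{t\,|g'(t+0)|}$, and let $\mathfrak M_0$ be the set of $g\in\mathfrak M$ for which there is $K>0$ with $\alpha(g;t)\ge K$ for all $t\ge1$. A non-negative sequence $(a_k)_{k\ge1}$ is in $GM^+$ if there is $A\ge1$ such that $a_{n_1}+\sum_{k=n_1}^{m-1}|a_k-a_{k+1}|\le A\,a_m$ for all $1\le n_1\le m$; it is in $GA^+$ if for some $\varepsilon>0$ and some constant $K$ one has $a_{n_1}n_1^{-\varepsilon}\le K\,a_{n_2}n_2^{-\varepsilon}$ for all $1\le n_1\le n_2$. For a function $\psi$ on $[1,\infty)$ and $\delta>0$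 put $g_\delta(t)=\psi(t)t^\delta$. For $\beta\in\mathbb R$, $1\le p<\infty$, the class $C^\psi_{\beta,p}$ consists of the continuous $2\pi$-periodic functions $f$ for which the series $$\sum_{k=1}^\infty\frac1{\psi(k)}\Big(a_k(f)\cos\big(kx+\tfrac{\beta\pi}2\big)+b_k(f)\sin\big(kx+\tfrac{\beta\pi}2\big)\Big)$$ is the Fourier series of a $2\pi$-periodic function $\varphi$ with $\|\varphi\|_p\le1$. For $s>0$ and $n\in\mathbb N$, $n\ge1$, put $$Z^s_{n-1}(f;t)=\frac{a_0(f)}2+\sum_{k=1}^{n-1}\Big(1-\big(\tfrac kn\big)^s\Big)\big(a_k(f)\cos kt+b_k(f)\sin kt\big),$$ $$\mathcal E(C^\psi_{\beta,p};Z^s_{n-1})_C=\sup_{f\in C^\psi_{\beta,p}}\|f-Z^s_{n-1}(f;\cdot)\|_C,\qquad E_n(C^\psi_{\beta,p})_C=\sup_{f\in C^\psi_{\beta,p}}\inf_{t_{n-1}}\|f-t_{n-1}\|_C,$$ where $t_{n-1}$ ranges over the trigonometric polynomials of order at most $n-1$ with real coefficients. $A(n)\asymp B(n)$ means that there are constants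 $K_1,K_2>0$, independent of $n$, with $A(n)\le K_1B(n)$ and $B(n)\le K_2A(n)$ for all $n\ge1$. *Statement.* Let $s>0$, $1\le p<\infty$, $\beta\in\mathbb R$, let $g_{1/p}\in\mathfrak M_0$, and let the sequence $\big(\psi(k)k^{s+1/p}\big)_{k\ge1}$ be in $GM^+\cap GA^+$. (i) If $1<p<\infty$, $\frac1p+\frac1{p'}=1$, $\sum_{k=1}^\infty\psi^{p'}(k)k^{p'-2}<\infty$ and $\inf_{t\ge1}\alpha(g_{1/p};t)>\frac{p'}2$, then $$E_n(C^\psi_{\beta,p})_C\asymp\mathcal E(C^\psi_{\beta,p};Z^s_{n-1})_C\asymp\Big(\sum_{k=n}^\infty\psi^{p'}(k)k^{p'-2}\Big)^{1/p'}.$$ (ii) If $p=1$, $\sum_{k=1}^\infty\psi(k)<\infty$ and $\inf_{t\ge1}\alpha(g_1;t)>1$, then $$E_n(C^\psi_{\beta,1})_C\asymp\mathcal E(C^\psi_{\beta,1};Z^s_{n-1})_C\asymp\begin{cases}\sum\limits_{k=n}^\infty\psi(k),&\cos\frac{\beta\pi}2\ne0,\\[1ex]\psi(n)\,n,&\cos\frac{\beta\pi}2=0.\end{cases}$$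 -/

import Mathlib

open scoped ENNReal

noncomputable section

namespace ZygmundApprox

/-! ### Functions of a real argument `t ≥ 1` -/

/-- The class `𝔐`: positive continuous convex functions on `[1, ∞)` that tend to zero at infinity.
Only the values on `[1, ∞)` matter. -/
structure IsM (g : ℝ → ℝ) : Prop where
  pos : ∀ t, 1 ≤ t → 0 < g t
  continuousOn : ContinuousOn g (Set.Ici 1)
  convexOn : ConvexOn ℝ (Set.Ici 1) g
  tendsto : Filter.Tendsto g Filter.atTop (nhds 0)

/-- The characteristic `α(g; t) = g(t) / (t |g'(t+0)|)`. For `g` in `𝔐` the right derivative is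
negative at every `t > 1`; at `t = 1` it may also be `-∞`, and then the quotient is `0`, which is
the value of the expression below too. -/
def alpha (g : ℝ → ℝ) (t : ℝ) : ℝ :=
  g t / (t * |derivWithin g (Set.Ioi t) t|)

/-- The class `𝔐₀`: members of `𝔐` with `α(g; ·)` bounded away from zero on `[1, ∞)`. -/
def IsM0 (g : ℝ → ℝ) : Prop :=
  IsM g ∧ ∃ K : ℝ, 0 < K ∧ ∀ t, 1 ≤ t → K ≤ alpha g t

/-- `inf_{t ≥ 1} α(g; t)`. -/
def infAlpha (g : ℝ → ℝ) : ℝ := ⨅ t : Set.Ici (1 : ℝ), alpha g t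

/-- `g_δ(t) = ψ(t) t^δ`. -/
def gFun (ψ : ℝ → ℝ) (δ : ℝ) (t : ℝ) : ℝ := ψ t * t ^ δ

/-! ### Sequences indexed by `k ≥ 1` (the value at `k = 0` is ignored) -/

/-- Generally monotonically increasing sequences, `GM⁺`. -/
def IsGMPlus (a : ℕ → ℝ) : Prop :=
  (∀ k, 1 ≤ k → 0 ≤ a k) ∧
  ∃ A : ℝ, 1 ≤ A ∧ ∀ n₁ m : ℕ, 1 ≤ n₁ → n₁ ≤ m →
    a n₁ + ∑ k ∈ Finset.Ico n₁ m, |a k - a (k + 1)| ≤ A * a m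

/-- Almost increasing sequences (in the sense of Bernstein). -/
def AlmostIncreasing (a : ℕ → ℝ) : Prop :=
  (∀ k, 1 ≤ k → 0 ≤ a k) ∧
  ∃ K : ℝ, ∀ n₁ n₂ : ℕ, 1 ≤ n₁ → n₁ ≤ n₂ → a n₁ ≤ K * a n₂

/-- The class `GA⁺`: `a_k k^{-ε}` almost increases for some `ε > 0`. -/
def IsGAPlus (a : ℕ → ℝ) : Prop :=
  ∃ ε : ℝ, 0 < ε ∧ AlmostIncreasing fun k => a k * (k : ℝ) ^ (-ε)

/-! ### Fourier series of `2π`-periodic functions -/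

/-- `a_k(f) = (1/π) ∫_0^{2π} f(t) cos kt dt`. -/
def fourierA (f : ℝ → ℝ) (k : ℕ) : ℝ :=
  (1 / Real.pi) * ∫ t in (0 : ℝ)..(2 * Real.pi), f t * Real.cos (k * t)

/-- `b_k(f) = (1/π) ∫_0^{2π} f(t) sin kt dt`. -/
def fourierB (f : ℝ → ℝ) (k : ℕ) : ℝ :=
  (1 / Real.pi) * ∫ t in (0 : ℝ)..(2 * Real.pi), f t * Real.sin (k * t)

/-- The unit ball `U_p` of the space `L_p` of `2π`-periodic functions, with the norm
`(∫_0^{2π} |φ|^p)^{1/p}`. -/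
def unitBall (p : ℝ) : Set (ℝ → ℝ) :=
  {φ | Function.Periodic φ (2 * Real.pi) ∧
    MeasureTheory.MemLp φ (ENNReal.ofReal p)
      (MeasureTheory.volume.restrict (Set.Ioc 0 (2 * Real.pi))) ∧
    MeasureTheory.eLpNorm φ (ENNReal.ofReal p)
      (MeasureTheory.volume.restrict (Set.Ioc 0 (2 * Real.pi))) ≤ 1}

/-- The summable function `φ` is a `(ψ, β)`-derivative of `f`: its Fourier series is
`∑_{k ≥ 1} (1/ψ(k)) (a_k(f) cos(kx + βπ/2) + b_k(f) sin(kx + βπ/2))`.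
The summands are expanded in `cos kx` and `sin kx`, and coefficients are compared. -/
def IsPsiBetaDeriv (ψ : ℝ → ℝ) (β : ℝ) (f φ : ℝ → ℝ) : Prop :=
  fourierA φ 0 = 0 ∧
  ∀ k : ℕ, 1 ≤ k →
    fourierA φ k = (1 / ψ k) * (fourierA f k * Real.cos (β * Real.pi / 2)
      + fourierB f k * Real.sin (β * Real.pi / 2)) ∧
    fourierB φ k = (1 / ψ k) * (fourierB f k * Real.cos (β * Real.pi / 2)
      - fourierA f k * Real.sin (β * Real.pi / 2))

/-- The class `C^ψ_{β,p}`: continuous `2π`-periodic functions that have a `(ψ, β)`-derivative in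
the unit ball of `L_p`. -/
def classC (ψ : ℝ → ℝ) (β p : ℝ) : Set (ℝ → ℝ) :=
  {f | Continuous f ∧ Function.Periodic f (2 * Real.pi) ∧
    ∃ φ ∈ unitBall p, IsPsiBetaDeriv ψ β f φ}

/-- The uniform norm, with values in `[0, ∞]`. -/
def uniformNorm (f : ℝ → ℝ) : ℝ≥0∞ := ⨆ x : ℝ, ENNReal.ofReal |f x|

/-- Trigonometric polynomials of order `n - 1` with real coefficients (for `n ≥ 1`). -/
def trigPoly (n : ℕ) : Set (ℝ → ℝ) :=
  {T | ∃ a b : ℕ → ℝ, ∀ x, T x = a 0 / 2 +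
    ∑ k ∈ Finset.Ico 1 n, (a k * Real.cos (k * x) + b k * Real.sin (k * x))}

/-- The Zygmund sum `Z^s_{n-1}(f; x)` (for `n ≥ 1`). -/
def zygmundSum (s : ℝ) (n : ℕ) (f : ℝ → ℝ) (x : ℝ) : ℝ :=
  fourierA f 0 / 2 + ∑ k ∈ Finset.Ico 1 n, (1 - ((k : ℝ) / n) ^ s) *
    (fourierA f k * Real.cos (k * x) + fourierB f k * Real.sin (k * x))

/-- The best uniform approximation `E_n(C^ψ_{β,p})_C` of the class by trigonometric polynomials
of order `n - 1`. -/
def bestApprox (ψ : ℝ → ℝ) (β p : ℝ) (n : ℕ) : ℝ≥0∞ :=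
  ⨆ f ∈ classC ψ β p, ⨅ T ∈ trigPoly n, uniformNorm fun x => f x - T x

/-- The uniform deviation `𝓔(C^ψ_{β,p}; Z^s_{n-1})_C` of the Zygmund sums on the class. -/
def zygmundError (ψ : ℝ → ℝ) (β p s : ℝ) (n : ℕ) : ℝ≥0∞ :=
  ⨆ f ∈ classC ψ β p, uniformNorm fun x => f x - zygmundSum s n f x

/-- `A(n) = O(B(n))`, with a constant that serves all `n ≥ 1`. -/
def OrderLE (A B : ℕ → ℝ≥0∞) : Prop :=
  ∃ K : ℝ, 0 < K ∧ ∀ n : ℕ, 1 ≤ n → A n ≤ ENNReal.ofReal K * B n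

/-- `A(n) ≍ B(n)`. -/
def OrderEq (A B : ℕ → ℝ≥0∞) : Prop := OrderLE A B ∧ OrderLE B A

end ZygmundApprox

end

open ZygmundApprox

noncomputable section

namespace ZygmundApprox

/-! ### Sums of powers and summation by parts -/

/-! Write q for p'. If φ is the (ψ, β)-derivative of f, the k-th harmonic of f is ψ(k) times that of
φ, rotated by βπ/2. So f minus its Zygmund sum splits into a high part, the harmonics k ≥ n with
weights ψ(k), and a low part, the harmonics k < n with weights (k/n)^s ψ(k).

High part. Fejér's theorem replaces the possibly divergent tail by finite sums with weights (1 -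
k/N) ψ(k), still decreasing. For p > 1, Hölder's inequality leaves the L_q norm of a cosine sum with
decreasing coefficients, which the Hardy–Littlewood bound `exists_integral_abs_sum_rpow_le` controls
by the tail of ∑ ψ(k)^q k^{q-2}. For p = 1 the sup norm of the kernel is needed: the sum of the
coefficients in general, and only ψ(n) n when the kernel is a pure sine sum (`abs_sum_mul_sin_le`).

Low part. Partial sums of j harmonics of φ are O(j^{1/p}). Abel summation
(`RegularWeight.exists_low_le`) together with the almost increase of ψ(k) k^{s+1/p-ε} gives O(ψ(n)
n^{1/p}), which is absorbed by the main term because ψ(k) k^{1/p} decreases and has the doubling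
property; both facts come from membership in 𝔐₀.

Lower bound. The deviation of Zygmund sums dominates the best approximation, so it suffices to bound
the latter from below. De la Vallée Poussin means show that a polynomial with frequencies at least
2n is at most 4 times its distance to the polynomials of order n - 1
(`abs_trigSum_le_of_abs_sub_le`). One test polynomial per n is then enough. For p > 1 its derivative
has coefficients ψ(k)^{q-1} k^{q-2}, the equality case of Hölder, with norm bounded again by
Hardy–Littlewood. For p = 1 it is a difference of de la Vallée Poussin kernels, and the polynomial
is evaluated at 0, or at a point of order 1/n when only sines survive. -/

lemma rpow_sub_one_le_mul_sub {η : ℝ} (hη : 0 < η) {k : ℕ} (hk : 1 ≤ k) :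
    (k : ℝ) ^ (η - 1) ≤ max 1 (1 / η) * ((k : ℝ) ^ η - ((k - 1 : ℕ) : ℝ) ^ η) := by
  have hk0 : (0 : ℝ) < k := by exact_mod_cast hk
  have hk1 : (1 : ℝ) ≤ k := by exact_mod_cast hk
  have hinv : (k : ℝ)⁻¹ ≤ 1 := inv_le_one_of_one_le₀ hk1
  have hcast : ((k - 1 : ℕ) : ℝ) = k * (1 + -(k : ℝ)⁻¹) := by
    rw [Nat.cast_sub hk]; field_simp; push_cast; ring
  have hpow : (k : ℝ) ^ (η - 1) = (k : ℝ) ^ η * (k : ℝ)⁻¹ := by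
    rw [Real.rpow_sub_one hk0.ne', div_eq_mul_inv]
  have hP : 0 < (k : ℝ) ^ η := Real.rpow_pos_of_pos hk0 η
  have hi0 : 0 < (k : ℝ)⁻¹ := inv_pos.2 hk0
  rw [hcast, Real.mul_rpow hk0.le (by linarith), hpow]
  rw [← mul_one_sub, mul_left_comm]
  refine mul_le_mul_of_nonneg_left ?_ hP.le
  -- With k - 1 = k(1 - 1/k) the claim is 1/k ≤ max(1, 1/η)(1 - (1 - 1/k)^η). For η ≤ 1 this is
  -- Bernoulli's inequality; for η ≥ 1 a power of a number in [0, 1] does not exceed the number.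
  rcases le_total η 1 with h | h
  · have hb := rpow_one_add_le_one_add_mul_self (s := -(k : ℝ)⁻¹) (by linarith) hη.le h
    calc (k : ℝ)⁻¹ = 1 / η * (η * (k : ℝ)⁻¹) := by field_simp
      _ ≤ max 1 (1 / η) * (1 - (1 + -(k : ℝ)⁻¹) ^ η) := by
        refine mul_le_mul (le_max_right _ _) (by linarith) (by positivity) (by positivity)
  · have hb : (1 + -(k : ℝ)⁻¹) ^ η ≤ 1 + -(k : ℝ)⁻¹ := by
      simpa using Real.rpow_le_rpow_of_exponent_ge' (x := 1 + -(k : ℝ)⁻¹) (by linarith)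
        (by linarith) zero_le_one h
    calc (k : ℝ)⁻¹ = 1 * (k : ℝ)⁻¹ := by ring
      _ ≤ max 1 (1 / η) * (1 - (1 + -(k : ℝ)⁻¹) ^ η) := by
        refine mul_le_mul (le_max_left _ _) (by linarith) (by positivity) (by positivity)

/-- The preceding bound telescopes. It serves the Abel sum in the low part, the Dirichlet kernels
and the Hardy step. -/
lemma sum_rpow_sub_one_le {η : ℝ} (hη : 0 < η) (m : ℕ) :
    ∑ k ∈ Finset.Ico 1 (m + 1), (k : ℝ) ^ (η - 1) ≤ max 1 (1 / η) * (m : ℝ) ^ η := by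
  induction m with
  | zero => simp [Real.zero_rpow hη.ne']
  | succ m ih =>
    rw [Finset.sum_Ico_succ_top (by omega)]
    have h := rpow_sub_one_le_mul_sub hη (k := m + 1) (by omega)
    rw [Nat.add_sub_cancel] at h
    linarith

/-- Abel's inequality. -/
lemma abs_sum_mul_le_of_antitone {b e : ℕ → ℝ} {M N : ℕ} {B : ℝ} (hMN : M < N)
    (hb : ∀ k, M ≤ k → k < N → 0 ≤ b k)
    (hanti : ∀ k, M ≤ k → k + 1 < N → b (k + 1) ≤ b k)
    (hB : ∀ j, |∑ k ∈ Finset.Ico M j, e k| ≤ B) :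
    |∑ k ∈ Finset.Ico M N, b k * e k| ≤ b M * B := by
  -- The induction runs on the defect between the weighted sum and b_j times the plain sum: one step
  -- changes it only by (b_j - b_{j+1}) times a plain sum, so the bounds telescope.
  have key : ∀ j, M ≤ j → j < N →
      |∑ k ∈ Finset.Ico M (j + 1), b k * e k - b j * ∑ k ∈ Finset.Ico M (j + 1), e k|
        ≤ (b M - b j) * B := by
    intro j hj
    induction j, hj using Nat.le_induction with
    | base => intro _; simp
    | succ j hj ih =>
      intro hjN
      have h1 := ih (by omega)
      have h2 := hanti j hj hjN
      rw [Finset.sum_Ico_succ_top (by omega), Finset.sum_Ico_succ_top (b := j + 1) (by omega)]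
      have h3 := hB (j + 1)
      set S := ∑ k ∈ Finset.Ico M (j + 1), b k * e k
      set E := ∑ k ∈ Finset.Ico M (j + 1), e k
      have : S + b (j + 1) * e (j + 1) - b (j + 1) * (E + e (j + 1))
          = (S - b j * E) + (b j - b (j + 1)) * E := by ring
      rw [this]
      calc |(S - b j * E) + (b j - b (j + 1)) * E|
          ≤ |S - b j * E| + |(b j - b (j + 1)) * E| := abs_add_le _ _
        _ ≤ (b M - b j) * B + (b j - b (j + 1)) * B := by
          rw [abs_mul, abs_of_nonneg (sub_nonneg.2 h2)]
          gcongr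
        _ = _ := by ring
  obtain ⟨j, rfl⟩ : ∃ j, N = j + 1 := ⟨N - 1, by omega⟩
  have h1 := key j (by omega) (by omega)
  have h2 := hB (j + 1)
  have h3 := hb j (by omega) (by omega)
  set S := ∑ k ∈ Finset.Ico M (j + 1), b k * e k
  set E := ∑ k ∈ Finset.Ico M (j + 1), e k
  calc |S| = |(S - b j * E) + b j * E| := by ring_nf
    _ ≤ |S - b j * E| + |b j * E| := abs_add_le _ _
    _ ≤ (b M - b j) * B + b j * B := by
      rw [abs_mul, abs_of_nonneg h3]; gcongr
    _ = b M * B := by ring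

/-- Abel summation without monotonicity, for the multipliers (k/n)^s ψ(k), which need not be
monotone. -/
lemma sum_mul_eq_sub_sum_diff (c e : ℕ → ℝ) {n : ℕ} (hn : 1 ≤ n) :
    ∑ k ∈ Finset.Ico 1 n, c k * e k
      = c n * ∑ k ∈ Finset.Ico 1 n, e k
        - ∑ j ∈ Finset.Ico 1 n, (c (j + 1) - c j) * ∑ k ∈ Finset.Ico 1 (j + 1), e k := by
  induction n, hn using Nat.le_induction with
  | base => simp
  | succ n hn ih =>
    rw [Finset.sum_Ico_succ_top hn, ih, Finset.sum_Ico_succ_top hn, Finset.sum_Ico_succ_top hn,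
      Finset.sum_Ico_succ_top hn]
    ring

/-- An antitone positive sequence with the doubling property is controlled by its dyadic blocks. -/
lemma mul_le_sum_Ico_of_doubling {h : ℕ → ℝ} {D : ℝ}
    (hanti : ∀ i j, 1 ≤ i → i ≤ j → h j ≤ h i) (hD : 0 ≤ D)
    (hdoub : ∀ n, 1 ≤ n → h n ≤ D * h (2 * n)) {n : ℕ} (hn : 1 ≤ n) :
    n * h n ≤ D * ∑ k ∈ Finset.Ico n (2 * n), h k := by
  have h1 : (n : ℝ) * h (2 * n) ≤ ∑ k ∈ Finset.Ico n (2 * n), h k := by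
    have := Finset.card_nsmul_le_sum (Finset.Ico n (2 * n)) h (h (2 * n)) (by
      intro k hk
      rw [Finset.mem_Ico] at hk
      exact hanti _ _ (by omega) (by omega))
    rw [Nat.card_Ico, nsmul_eq_mul, show 2 * n - n = n by omega] at this
    exact this
  calc (n : ℝ) * h n ≤ n * (D * h (2 * n)) := by gcongr; exact hdoub n hn
    _ = D * (n * h (2 * n)) := by ring
    _ ≤ _ := by gcongr

lemma sum_Ico_le_mul_of_antitone {h : ℕ → ℝ} (hanti : ∀ i j, 1 ≤ i → i ≤ j → h j ≤ h i)
    {n : ℕ} (hn : 1 ≤ n) : ∑ k ∈ Finset.Ico n (2 * n), h k ≤ n * h n := by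
  have := Finset.sum_le_card_nsmul (Finset.Ico n (2 * n)) h (h n) (by
      intro k hk
      rw [Finset.mem_Ico] at hk
      exact hanti _ _ (by omega) (by omega))
  rw [Nat.card_Ico, nsmul_eq_mul, show 2 * n - n = n by omega] at this
  exact this

/-! ### Trigonometric sums and Fejér means -/

/-- The trigonometric sum `a₀ / 2 + ∑_{1 ≤ k < n} (a_k cos kx + b_k sin kx)`. -/
def trigSum (a b : ℕ → ℝ) (n : ℕ) (x : ℝ) : ℝ :=
  a 0 / 2 + ∑ k ∈ Finset.Ico 1 n, (a k * Real.cos (k * x) + b k * Real.sin (k * x))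

lemma continuous_trigSum (a b : ℕ → ℝ) (n : ℕ) : Continuous (trigSum a b n) := by
  unfold trigSum; fun_prop

lemma cos_natCast_mul_add_two_pi (k : ℕ) (x : ℝ) :
    Real.cos (k * (x + 2 * Real.pi)) = Real.cos (k * x) := by
  rw [mul_add, Real.cos_add_nat_mul_two_pi]

lemma sin_natCast_mul_add_two_pi (k : ℕ) (x : ℝ) :
    Real.sin (k * (x + 2 * Real.pi)) = Real.sin (k * x) := by
  rw [mul_add, Real.sin_add_nat_mul_two_pi]

lemma periodic_trigSum (a b : ℕ → ℝ) (n : ℕ) :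
    Function.Periodic (trigSum a b n) (2 * Real.pi) := by
  intro x
  simp only [trigSum, cos_natCast_mul_add_two_pi, sin_natCast_mul_add_two_pi]

lemma integral_cos_int_mul (m : ℤ) :
    ∫ t in (0 : ℝ)..(2 * Real.pi), Real.cos (m * t) = if m = 0 then 2 * Real.pi else 0 := by
  split_ifs with h
  · simp [h]
  · have hm : (m : ℝ) ≠ 0 := by exact_mod_cast h
    rw [intervalIntegral.integral_comp_mul_left _ hm, integral_cos]
    have : Real.sin (m * (2 * Real.pi)) = 0 := by
      have := Real.sin_int_mul_pi (2 * m)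
      push_cast at this
      rw [← this]; ring_nf
    simp [this]

lemma integral_sin_int_mul (m : ℤ) :
    ∫ t in (0 : ℝ)..(2 * Real.pi), Real.sin (m * t) = 0 := by
  by_cases h : m = 0
  · simp [h]
  · have hm : (m : ℝ) ≠ 0 := by exact_mod_cast h
    rw [intervalIntegral.integral_comp_mul_left _ hm, integral_sin]
    have : Real.cos (m * (2 * Real.pi)) = 1 := Real.cos_int_mul_two_pi m
    simp [this]

lemma integral_cos_mul_cos {k : ℕ} (hk : 1 ≤ k) (j : ℕ) :
    ∫ t in (0 : ℝ)..(2 * Real.pi), Real.cos (k * t) * Real.cos (j * t)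
      = if j = k then Real.pi else 0 := by
  have h : ∀ t : ℝ, Real.cos (k * t) * Real.cos (j * t)
      = (1 / 2) * Real.cos (((k - j : ℤ) : ℝ) * t)
        + (1 / 2) * Real.cos (((k + j : ℤ) : ℝ) * t) := by
    intro t
    push_cast
    rw [sub_mul, add_mul, Real.cos_sub, Real.cos_add]; ring
  simp_rw [h]
  rw [intervalIntegral.integral_add (by apply Continuous.intervalIntegrable; fun_prop)
    (by apply Continuous.intervalIntegrable; fun_prop), intervalIntegral.integral_const_mul,
    intervalIntegral.integral_const_mul, integral_cos_int_mul, integral_cos_int_mul]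
  rw [if_neg (by omega : ¬ ((k : ℤ) + j = 0))]
  by_cases hjk : j = k
  · simp [hjk]
  · rw [if_neg hjk, if_neg (by omega)]; simp

lemma integral_sin_mul_sin {k : ℕ} (hk : 1 ≤ k) (j : ℕ) :
    ∫ t in (0 : ℝ)..(2 * Real.pi), Real.sin (k * t) * Real.sin (j * t)
      = if j = k then Real.pi else 0 := by
  have h : ∀ t : ℝ, Real.sin (k * t) * Real.sin (j * t)
      = (1 / 2) * Real.cos (((k - j : ℤ) : ℝ) * t)
        - (1 / 2) * Real.cos (((k + j : ℤ) : ℝ) * t) := by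
    intro t
    push_cast
    rw [sub_mul, add_mul, Real.cos_sub, Real.cos_add]; ring
  simp_rw [h]
  rw [intervalIntegral.integral_sub (by apply Continuous.intervalIntegrable; fun_prop)
    (by apply Continuous.intervalIntegrable; fun_prop), intervalIntegral.integral_const_mul,
    intervalIntegral.integral_const_mul, integral_cos_int_mul, integral_cos_int_mul]
  rw [if_neg (by omega : ¬ ((k : ℤ) + j = 0))]
  by_cases hjk : j = k
  · simp [hjk]
  · rw [if_neg hjk, if_neg (by omega)]; simp

lemma integral_sin_mul_cos (k j : ℕ) :
    ∫ t in (0 : ℝ)..(2 * Real.pi), Real.sin (k * t) * Real.cos (j * t) = 0 := by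
  have h : ∀ t : ℝ, Real.sin (k * t) * Real.cos (j * t)
      = (1 / 2) * Real.sin (((k - j : ℤ) : ℝ) * t)
        + (1 / 2) * Real.sin (((k + j : ℤ) : ℝ) * t) := by
    intro t
    push_cast
    rw [sub_mul, add_mul, Real.sin_sub, Real.sin_add]; ring
  simp_rw [h]
  rw [intervalIntegral.integral_add (by apply Continuous.intervalIntegrable; fun_prop)
    (by apply Continuous.intervalIntegrable; fun_prop), intervalIntegral.integral_const_mul,
    intervalIntegral.integral_const_mul, integral_sin_int_mul, integral_sin_int_mul]
  simp

lemma fourierA_trigSum (a b : ℕ → ℝ) {n : ℕ} (hn : 1 ≤ n) (j : ℕ) :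
    fourierA (trigSum a b n) j = if j < n then a j else 0 := by
  have h : ∀ t : ℝ, trigSum a b n t * Real.cos (j * t) = a 0 / 2 * Real.cos ((j : ℤ) * t)
      + ∑ k ∈ Finset.Ico 1 n, (a k * (Real.cos (k * t) * Real.cos (j * t))
        + b k * (Real.sin (k * t) * Real.cos (j * t))) := by
    intro t
    rw [trigSum, add_mul, Finset.sum_mul]
    congr 1
    exact Finset.sum_congr rfl fun k _ => by ring
  have hI : ∀ k ∈ Finset.Ico 1 n, ∫ t in (0 : ℝ)..(2 * Real.pi),
      (a k * (Real.cos (k * t) * Real.cos (j * t)) + b k * (Real.sin (k * t) * Real.cos (j * t)))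
        = if j = k then a k * Real.pi else 0 := by
    intro k hk
    rw [intervalIntegral.integral_add (by apply Continuous.intervalIntegrable; fun_prop)
      (by apply Continuous.intervalIntegrable; fun_prop), intervalIntegral.integral_const_mul,
      intervalIntegral.integral_const_mul, integral_sin_mul_cos,
      integral_cos_mul_cos (Finset.mem_Ico.1 hk).1]
    simp
  unfold fourierA
  simp_rw [h]
  rw [intervalIntegral.integral_add (by apply Continuous.intervalIntegrable; fun_prop)
    (by apply Continuous.intervalIntegrable; fun_prop), intervalIntegral.integral_const_mul,
    integral_cos_int_mul, intervalIntegral.integral_finsetSum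
      (fun k _ => by apply Continuous.intervalIntegrable; fun_prop), Finset.sum_congr rfl hI,
    Finset.sum_ite_eq]
  have := Real.pi_ne_zero
  rcases Nat.eq_zero_or_pos j with rfl | hj
  · rw [if_pos (by simp), if_neg (by simp), if_pos (by omega)]
    field_simp; ring
  · rw [if_neg (by exact_mod_cast hj.ne')]
    by_cases hjn : j < n
    · rw [if_pos (by simp; omega), if_pos hjn]; field_simp; ring
    · rw [if_neg (by simp; omega), if_neg hjn]; simp

/-- Frequency 0 is excluded because `b 0` does not enter `trigSum`, while the sine coefficient of
order 0 vanishes. -/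
lemma fourierB_trigSum (a b : ℕ → ℝ) {n j : ℕ} (hj : 1 ≤ j) :
    fourierB (trigSum a b n) j = if j < n then b j else 0 := by
  have h : ∀ t : ℝ, trigSum a b n t * Real.sin (j * t) = a 0 / 2 * Real.sin ((j : ℤ) * t)
      + ∑ k ∈ Finset.Ico 1 n, (a k * (Real.sin (j * t) * Real.cos (k * t))
        + b k * (Real.sin (k * t) * Real.sin (j * t))) := by
    intro t
    rw [trigSum, add_mul, Finset.sum_mul]
    congr 1
    exact Finset.sum_congr rfl fun k _ => by ring
  have hI : ∀ k ∈ Finset.Ico 1 n, ∫ t in (0 : ℝ)..(2 * Real.pi),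
      (a k * (Real.sin (j * t) * Real.cos (k * t)) + b k * (Real.sin (k * t) * Real.sin (j * t)))
        = if j = k then b k * Real.pi else 0 := by
    intro k hk
    rw [intervalIntegral.integral_add (by apply Continuous.intervalIntegrable; fun_prop)
      (by apply Continuous.intervalIntegrable; fun_prop), intervalIntegral.integral_const_mul,
      intervalIntegral.integral_const_mul, integral_sin_mul_cos,
      integral_sin_mul_sin (Finset.mem_Ico.1 hk).1]
    simp
  unfold fourierB
  simp_rw [h]
  rw [intervalIntegral.integral_add (by apply Continuous.intervalIntegrable; fun_prop)
    (by apply Continuous.intervalIntegrable; fun_prop), intervalIntegral.integral_const_mul,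
    integral_sin_int_mul, intervalIntegral.integral_finsetSum
      (fun k _ => by apply Continuous.intervalIntegrable; fun_prop), Finset.sum_congr rfl hI,
    Finset.sum_ite_eq]
  have := Real.pi_ne_zero
  by_cases hjn : j < n
  · rw [if_pos (by simp; omega), if_pos hjn]; field_simp; ring
  · rw [if_neg (by simp; omega), if_neg hjn]; simp

/-- The Fejér kernel of order `N`. -/
def fejerKernel (N : ℕ) : ℝ → ℝ := trigSum (fun k => 1 - k / N) 0 N

/-- The Fejér mean of order `N`. -/
def fejerMean (f : ℝ → ℝ) (N : ℕ) : ℝ → ℝ :=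
  trigSum (fun k => (1 - k / N) * fourierA f k) (fun k => (1 - k / N) * fourierB f k) N

/-- The left side is |∑ e^{iju}|², in which each frequency difference ±k occurs N - k times. This
makes the Fejér kernel nonnegative. -/
lemma sq_sum_cos_add_sq_sum_sin (N : ℕ) (u : ℝ) :
    (∑ j ∈ Finset.range N, Real.cos (j * u)) ^ 2 + (∑ j ∈ Finset.range N, Real.sin (j * u)) ^ 2
      = N + 2 * ∑ k ∈ Finset.Ico 1 N, ((N : ℝ) - k) * Real.cos (k * u) := by
  induction N with
  | zero => simp
  | succ N ih =>
    have h1 : ∑ k ∈ Finset.Ico 1 (N + 1), (((N + 1 : ℕ) : ℝ) - k) * Real.cos (k * u)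
        = ∑ k ∈ Finset.Ico 1 N, ((N : ℝ) - k) * Real.cos (k * u)
          + ∑ k ∈ Finset.Ico 1 (N + 1), Real.cos (k * u) := by
      rcases Nat.eq_zero_or_pos N with rfl | hN
      · simp
      · rw [Finset.sum_Ico_succ_top hN, Finset.sum_Ico_succ_top hN, ← add_assoc,
          ← Finset.sum_add_distrib]
        congr 1
        · exact Finset.sum_congr rfl fun k _ => by push_cast; ring
        · push_cast; ring
    -- These are the cross terms created by the new summand e^{iNu}; substitute k = N - j and expand
    -- cos((N - j)u).
    have h2 : ∑ k ∈ Finset.Ico 1 (N + 1), Real.cos (k * u)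
        = (∑ j ∈ Finset.range N, Real.cos (j * u)) * Real.cos (N * u)
          + (∑ j ∈ Finset.range N, Real.sin (j * u)) * Real.sin (N * u) := by
      rw [Finset.sum_mul, Finset.sum_mul, ← Finset.sum_add_distrib, Finset.sum_Ico_eq_sum_range,
        Nat.add_sub_cancel, ← Finset.sum_range_reflect]
      refine Finset.sum_congr rfl fun j hj => ?_
      rw [Finset.mem_range] at hj
      have : ((1 + (N - 1 - j) : ℕ) : ℝ) = N - j := by
        rw [show 1 + (N - 1 - j) = N - j by omega, Nat.cast_sub hj.le]
      rw [this, sub_mul, Real.cos_sub]; ring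
    rw [Finset.sum_range_succ, Finset.sum_range_succ, h1, h2]
    have h3 := Real.sin_sq_add_cos_sq (N * u)
    push_cast
    linear_combination ih + h3

lemma fejerKernel_nonneg {N : ℕ} (hN : 1 ≤ N) (u : ℝ) : 0 ≤ fejerKernel N u := by
  have hN' : (0 : ℝ) < N := by exact_mod_cast hN
  have h := sq_sum_cos_add_sq_sum_sin N u
  have : fejerKernel N u = 1 / (2 * N) *
      (N + 2 * ∑ k ∈ Finset.Ico 1 N, ((N : ℝ) - k) * Real.cos (k * u)) := by
    rw [fejerKernel, trigSum, mul_add, ← mul_assoc, Finset.mul_sum]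
    congr 1
    · simp; field_simp
    · exact Finset.sum_congr rfl fun k _ => by simp; field_simp
  rw [this, ← h]
  positivity

lemma integral_fejerKernel {N : ℕ} (hN : 1 ≤ N) :
    ∫ t in (0 : ℝ)..(2 * Real.pi), fejerKernel N t = Real.pi := by
  have h := fourierA_trigSum (fun k => 1 - k / N) 0 hN 0
  rw [if_pos (by omega), fourierA] at h
  have hpi := Real.pi_ne_zero
  have h2 : ∀ t : ℝ, trigSum (fun k => 1 - k / N) 0 N t * Real.cos ((0 : ℕ) * t)
      = fejerKernel N t := by intro t; simp [fejerKernel]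
  simp_rw [h2] at h
  have h3 : (1 : ℝ) - ((0 : ℕ) : ℝ) / N = 1 := by simp
  rw [h3] at h
  field_simp at h
  rw [mul_comm Real.pi 2] at h
  exact h

/-- The harmonic of order `k` of `φ`, rotated by the phase `θ`, as a convolution. -/
lemma integral_mul_cos_sub {φ : ℝ → ℝ}
    (hφ : IntervalIntegrable φ MeasureTheory.volume 0 (2 * Real.pi)) (k : ℕ) (θ x : ℝ) :
    (1 / Real.pi) * ∫ t in (0 : ℝ)..(2 * Real.pi), φ t * Real.cos (k * (x - t) - θ)
      = Real.cos θ * (fourierA φ k * Real.cos (k * x) + fourierB φ k * Real.sin (k * x))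
        + Real.sin θ * (fourierA φ k * Real.sin (k * x) - fourierB φ k * Real.cos (k * x)) := by
  have h : ∀ t : ℝ, φ t * Real.cos (k * (x - t) - θ)
      = Real.cos (k * x - θ) * (φ t * Real.cos (k * t))
        + Real.sin (k * x - θ) * (φ t * Real.sin (k * t)) := by
    intro t
    rw [show k * (x - t) - θ = (k * x - θ) - k * t by ring, Real.cos_sub]; ring
  have hc : IntervalIntegrable (fun t => φ t * Real.cos (k * t)) MeasureTheory.volume 0
      (2 * Real.pi) := hφ.mul_continuousOn (by fun_prop)
  have hs : IntervalIntegrable (fun t => φ t * Real.sin (k * t)) MeasureTheory.volume 0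
      (2 * Real.pi) := hφ.mul_continuousOn (by fun_prop)
  simp_rw [h]
  rw [intervalIntegral.integral_add (hc.const_mul _) (hs.const_mul _),
    intervalIntegral.integral_const_mul, intervalIntegral.integral_const_mul, fourierA, fourierB,
    Real.cos_sub, Real.sin_sub]
  ring

/-- Convolution with a nonnegative kernel: the source of the positivity, linearity and contraction
properties of Fejér means. -/
lemma fejerMean_eq_integral {f : ℝ → ℝ} (hf : Continuous f) (N : ℕ) (x : ℝ) :
    fejerMean f N x
      = (1 / Real.pi) * ∫ t in (0 : ℝ)..(2 * Real.pi), f t * fejerKernel N (x - t) := by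
  have h : ∀ t : ℝ, f t * fejerKernel N (x - t) = 1 / 2 * (f t * Real.cos ((0 : ℕ) * t))
      + ∑ k ∈ Finset.Ico 1 N, (1 - k / N : ℝ) * (f t * Real.cos (k * (x - t) - 0)) := by
    intro t
    rw [fejerKernel, trigSum, mul_add, Finset.mul_sum]
    congr 1
    · simp; ring
    · exact Finset.sum_congr rfl fun k _ => by simp; ring
  simp_rw [h]
  rw [intervalIntegral.integral_add (by apply Continuous.intervalIntegrable; fun_prop)
    (by apply Continuous.intervalIntegrable; fun_prop), intervalIntegral.integral_const_mul,
    intervalIntegral.integral_finsetSum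
      (fun k _ => by apply Continuous.intervalIntegrable; fun_prop), mul_add, Finset.mul_sum,
    fejerMean, trigSum]
  congr 1
  · simp only [fourierA]; simp; ring
  · refine Finset.sum_congr rfl fun k _ => ?_
    rw [intervalIntegral.integral_const_mul, mul_left_comm,
      integral_mul_cos_sub (hf.intervalIntegrable _ _)]
    simp; ring

lemma fejerMean_nonneg {f : ℝ → ℝ} (hf : Continuous f) (h0 : ∀ t, 0 ≤ f t) {N : ℕ} (hN : 1 ≤ N)
    (x : ℝ) : 0 ≤ fejerMean f N x := by
  rw [fejerMean_eq_integral hf]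
  have := Real.pi_pos
  refine mul_nonneg (by positivity) (intervalIntegral.integral_nonneg (by positivity) ?_)
  intro t _
  exact mul_nonneg (h0 t) (fejerKernel_nonneg hN _)

lemma fejerMean_sub {f g : ℝ → ℝ} (hf : Continuous f) (hg : Continuous g) (N : ℕ) (x : ℝ) :
    fejerMean (f - g) N x = fejerMean f N x - fejerMean g N x := by
  have hk : Continuous (fejerKernel N) := continuous_trigSum _ _ _
  have hfg : Continuous (f - g) := hf.sub hg
  rw [fejerMean_eq_integral hf, fejerMean_eq_integral hg, fejerMean_eq_integral hfg,
    ← mul_sub, ← intervalIntegral.integral_sub (by apply Continuous.intervalIntegrable; fun_prop)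
      (by apply Continuous.intervalIntegrable; fun_prop)]
  simp_rw [Pi.sub_apply, sub_mul]

lemma fejerMean_mono {f g : ℝ → ℝ} (hf : Continuous f) (hg : Continuous g)
    (h : ∀ t, f t ≤ g t) {N : ℕ} (hN : 1 ≤ N) (x : ℝ) :
    fejerMean f N x ≤ fejerMean g N x := by
  have := fejerMean_nonneg (hg.sub hf) (fun t => sub_nonneg.2 (h t)) hN x
  have h2 := fejerMean_sub hg hf N x
  linarith

lemma fejerMean_trigSum (a b : ℕ → ℝ) {n : ℕ} (hn : 1 ≤ n) (N : ℕ) (x : ℝ) :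
    fejerMean (trigSum a b n) N x
      = a 0 / 2 + ∑ k ∈ Finset.Ico 1 N, if k < n then
          (1 - k / N : ℝ) * (a k * Real.cos (k * x) + b k * Real.sin (k * x)) else 0 := by
  rw [fejerMean, trigSum, fourierA_trigSum a b hn, if_pos (by omega)]
  congr 1
  · simp
  · refine Finset.sum_congr rfl fun k hk => ?_
    rw [fourierA_trigSum a b hn, fourierB_trigSum a b (Finset.mem_Ico.1 hk).1]
    split_ifs
    · ring
    · simp

lemma fejerMean_const (c : ℝ) (N : ℕ) (x : ℝ) : fejerMean (fun _ => c) N x = c := by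
  have h : (fun _ : ℝ => c) = trigSum (fun _ => 2 * c) 0 1 := by
    funext t; simp [trigSum]
  rw [h, fejerMean_trigSum _ _ le_rfl]
  rw [Finset.sum_eq_zero]
  · simp
  · intro k hk
    rw [Finset.mem_Ico] at hk
    rw [if_neg (by omega)]

lemma abs_fejerMean_le {f : ℝ → ℝ} (hf : Continuous f) {δ : ℝ} (h : ∀ t, |f t| ≤ δ) {N : ℕ}
    (hN : 1 ≤ N) (x : ℝ) : |fejerMean f N x| ≤ δ := by
  rw [abs_le]
  constructor
  · have := fejerMean_mono continuous_const hf (fun t => (abs_le.1 (h t)).1) hN x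
    rwa [fejerMean_const] at this
  · have := fejerMean_mono hf continuous_const (fun t => (abs_le.1 (h t)).2) hN x
    rwa [fejerMean_const] at this

/-- A continuous periodic function is controlled near `x` by the function `1 - cos (t - x)`. -/
lemma exists_abs_sub_le_add_mul_one_sub_cos {f : ℝ → ℝ} (hf : Continuous f)
    (hper : Function.Periodic f (2 * Real.pi)) (x : ℝ) {ε : ℝ} (hε : 0 < ε) :
    ∃ M : ℝ, 0 ≤ M ∧ ∀ t, |f t - f x| ≤ ε + M * (1 - Real.cos (t - x)) := by
  have hpi := Real.pi_pos
  obtain ⟨δ, hδ, hδf⟩ := Metric.continuous_iff.1 hf x ε hε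
  obtain ⟨B, hB⟩ := (isCompact_Icc (a := x - Real.pi) (b := x + Real.pi)).exists_bound_of_continuousOn
    (f := fun t => f t - f x) (by fun_prop)
  -- At distance at least η from x, within one period, 1 - cos(t - x) ≥ 1 - cos η > 0, so a suitable
  -- multiple of it dominates the global bound `B`; closer to x, continuity gives ε.
  set η := min δ Real.pi
  have hη : 0 < η := lt_min hδ hpi
  have hηpi : η ≤ Real.pi := min_le_right _ _
  have hc : 0 < 1 - Real.cos η := by
    have := Real.cos_lt_cos_of_nonneg_of_le_pi le_rfl hηpi hη
    rw [Real.cos_zero] at this; linarith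
  have hB0 : 0 ≤ B := le_trans (norm_nonneg _) (hB x ⟨by linarith, by linarith⟩)
  have hF : Function.Periodic (fun t => |f t - f x| - (B / (1 - Real.cos η)) *
      (1 - Real.cos (t - x))) (2 * Real.pi) := by
    intro t
    simp only [hper t]
    rw [show t + 2 * Real.pi - x = (t - x) + 2 * Real.pi by ring, Real.cos_add_two_pi]
  refine ⟨B / (1 - Real.cos η), by positivity, fun t => ?_⟩
  obtain ⟨y, hy, hyt⟩ := hF.exists_mem_Ioc (by positivity) t (x - Real.pi)
  have hy1 : |y - x| ≤ Real.pi := by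
    rw [abs_le]; constructor <;> linarith [hy.1, hy.2]
  suffices h : |f y - f x| ≤ ε + (B / (1 - Real.cos η)) * (1 - Real.cos (y - x)) by
    linarith
  rcases lt_or_ge |y - x| η with h | h
  · have h1 := hδf y (by rw [Real.dist_eq]; exact h.trans_le (min_le_left _ _))
    rw [Real.dist_eq] at h1
    have h2 := Real.cos_le_one (y - x)
    have : 0 ≤ B / (1 - Real.cos η) * (1 - Real.cos (y - x)) := by
      have : 0 ≤ 1 - Real.cos (y - x) := by linarith
      positivity
    linarith
  · have h1 := hB y ⟨by linarith [hy.1], by linarith [hy.2]⟩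
    rw [Real.norm_eq_abs] at h1
    have h2 : Real.cos (y - x) ≤ Real.cos η := by
      rw [← Real.cos_abs (y - x)]
      exact Real.cos_le_cos_of_nonneg_of_le_pi hη.le hy1 h
    have h3 : B = B / (1 - Real.cos η) * (1 - Real.cos η) := by field_simp
    have h4 : B / (1 - Real.cos η) * (1 - Real.cos η)
        ≤ B / (1 - Real.cos η) * (1 - Real.cos (y - x)) := by
      have : 0 ≤ B / (1 - Real.cos η) := by positivity
      gcongr
    linarith

/-- The mean multiplies the first harmonic by 1 - 1/N, so of 1 - cos(t - x) at t = x only 1/N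
remains. For N = 1 that harmonic would be missing from the sum. -/
lemma fejerMean_one_sub_cos {N : ℕ} (hN : 2 ≤ N) (M ε x : ℝ) :
    fejerMean (fun t => ε + M * (1 - Real.cos (t - x))) N x = ε + M / N := by
  have hN' : (0 : ℝ) < N := by exact_mod_cast (by omega : 0 < N)
  have h : (fun t => ε + M * (1 - Real.cos (t - x)))
      = trigSum (fun k => if k = 0 then 2 * (ε + M) else -M * Real.cos x)
          (fun _ => -M * Real.sin x) 2 := by
    funext t
    simp [trigSum, Real.cos_sub]
    ring
  rw [h, fejerMean_trigSum _ _ (by norm_num), Finset.sum_eq_single_of_mem 1 (by simp; omega)]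
  · have := Real.sin_sq_add_cos_sq x
    simp
    field_simp
    linear_combination (-M * N + M) * this
  · intro k hk h1
    rw [Finset.mem_Ico] at hk
    rw [if_neg (by omega)]

/-- **Fejér's theorem**, pointwise. -/
lemma tendsto_fejerMean {f : ℝ → ℝ} (hf : Continuous f)
    (hper : Function.Periodic f (2 * Real.pi)) (x : ℝ) :
    Filter.Tendsto (fun N => fejerMean f N x) Filter.atTop (nhds (f x)) := by
  rw [Metric.tendsto_atTop]
  intro ε hε
  obtain ⟨M, hM, h⟩ := exists_abs_sub_le_add_mul_one_sub_cos hf hper x (half_pos hε)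
  obtain ⟨N₀, hN₀⟩ := exists_nat_gt (M / (ε / 2))
  refine ⟨max N₀ 2, fun N hN => ?_⟩
  have hN2 : 2 ≤ N := le_trans (le_max_right _ _) hN
  have hN0 : (N₀ : ℝ) ≤ N := by exact_mod_cast le_trans (le_max_left _ _) hN
  have hNpos : (0 : ℝ) < N := by exact_mod_cast (by omega : 0 < N)
  have hMN : M / N < ε / 2 := by
    rw [div_lt_iff₀ (half_pos hε)] at hN₀
    rw [div_lt_iff₀ hNpos]
    nlinarith
  have hcont : Continuous fun t => ε / 2 + M * (1 - Real.cos (t - x)) := by fun_prop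
  -- Korovkin's argument: a positive operator preserves the two-sided majorant of f - f(x), and its
  -- value at x on the majorant is ε/2 + M/N.
  have h1 := fejerMean_mono (hf.sub continuous_const) hcont
    (fun t => (abs_le.1 (h t)).2) (by omega : 1 ≤ N) x
  have h2 := fejerMean_mono (continuous_const.sub hf) hcont
    (fun t => by have := (abs_le.1 (h t)).1; linarith : ∀ t, f x - f t ≤ _) (by omega : 1 ≤ N) x
  rw [fejerMean_one_sub_cos hN2] at h1 h2
  have h3 := fejerMean_sub hf (continuous_const (y := f x)) N x
  have h4 := fejerMean_sub (continuous_const (y := f x)) hf N x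
  rw [fejerMean_const] at h3 h4
  rw [Real.dist_eq, abs_lt]
  constructor <;> linarith

/-- The de la Vallée Poussin means `2 σ_{2n} - σ_n` reproduce polynomials of order `n - 1`, so they
bound a polynomial with frequencies at least `2n` by its distance to those polynomials. -/
lemma abs_trigSum_le_of_abs_sub_le {a b c d : ℕ → ℝ} {n N : ℕ} (hn : 1 ≤ n) (hN : 1 ≤ N)
    (ha : ∀ k, k < 2 * n → a k = 0) (hb : ∀ k, k < 2 * n → b k = 0) {δ : ℝ}
    (h : ∀ t, |trigSum a b N t - trigSum c d n t| ≤ δ) (x : ℝ) :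
    |trigSum a b N x| ≤ 4 * δ := by
  have hn' : (0 : ℝ) < n := by exact_mod_cast hn
  have hca := continuous_trigSum a b N
  have hcc := continuous_trigSum c d n
  have hcont : Continuous (trigSum a b N - trigSum c d n) := hca.sub hcc
  have h1 := abs_fejerMean_le hcont h (by omega : 1 ≤ 2 * n) x
  have h2 := abs_fejerMean_le hcont h hn x
  rw [fejerMean_sub hca hcc] at h1 h2
  -- Means of order at most 2n do not see the high polynomial at all.
  have hz : ∀ m, m ≤ 2 * n → fejerMean (trigSum a b N) m x = 0 := by
    intro m hm
    rw [fejerMean_trigSum a b hN, ha 0 (by omega), Finset.sum_eq_zero]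
    · simp
    · intro k hk
      rw [Finset.mem_Ico] at hk
      rw [ha k (by omega), hb k (by omega)]; simp
  -- The multiplier is 2(1 - k/2n) - (1 - k/n) = 1 for k < n. Hence the low polynomial is at most 2δ
  -- + δ, and the last δ of the constant 4 is the distance itself.
  have hv : 2 * fejerMean (trigSum c d n) (2 * n) x - fejerMean (trigSum c d n) n x
      = trigSum c d n x := by
    rw [fejerMean_trigSum c d hn, fejerMean_trigSum c d hn, trigSum,
      ← Finset.sum_subset (Finset.Ico_subset_Ico_right (by omega : n ≤ 2 * n)), mul_add,
      Finset.mul_sum, add_sub_add_comm, ← Finset.sum_sub_distrib]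
    · congr 1
      · ring
      · refine Finset.sum_congr rfl fun k hk => ?_
        rw [if_pos (Finset.mem_Ico.1 hk).2, if_pos (Finset.mem_Ico.1 hk).2]
        push_cast
        field_simp
        ring
    · intro k hk hk2
      rw [Finset.mem_Ico] at hk hk2
      rw [if_neg (by omega)]
  rw [hz _ le_rfl] at h1
  rw [hz _ (by omega)] at h2
  have h0 := h x
  rw [abs_le] at *
  constructor <;> linarith

/-! ### Trigonometric series with monotone coefficients -/

lemma two_mul_sin_mul_sum_cos (u θ : ℝ) {M j : ℕ} (hMj : M ≤ j) :
    2 * Real.sin (u / 2) * ∑ k ∈ Finset.Ico M j, Real.cos (k * u - θ)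
      = Real.sin (j * u - θ - u / 2) - Real.sin (M * u - θ - u / 2) := by
  induction j, hMj using Nat.le_induction with
  | base => simp
  | succ j hj ih =>
    rw [Finset.sum_Ico_succ_top hj, mul_add, ih]
    have : ((j + 1 : ℕ) : ℝ) * u - θ - u / 2 = (j * u - θ) + u / 2 := by push_cast; ring
    rw [this, Real.sin_add, Real.sin_sub (j * u - θ) (u / 2)]
    ring

/-- Telescoping after multiplication by 2 sin(u/2), and Jordan's inequality sin(u/2) ≥ u/π. -/
lemma abs_sum_cos_le {u : ℝ} (hu : 0 < u) (hupi : u ≤ Real.pi) (θ : ℝ) (M j : ℕ) :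
    |∑ k ∈ Finset.Ico M j, Real.cos (k * u - θ)| ≤ Real.pi / u := by
  have hpi := Real.pi_pos
  rcases le_total j M with h | h
  · rw [Finset.Ico_eq_empty_of_le h]
    simp; positivity
  · have h1 := two_mul_sin_mul_sum_cos u θ h
    have h2 : u / Real.pi ≤ Real.sin (u / 2) := by
      refine le_trans (le_of_eq ?_) (Real.mul_le_sin (by linarith) (by linarith))
      field_simp
    have h3 : 0 < u / Real.pi := by positivity
    have h4 : 2 * Real.sin (u / 2) * |∑ k ∈ Finset.Ico M j, Real.cos (k * u - θ)| ≤ 2 := by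
      rw [← abs_of_pos (show 0 < 2 * Real.sin (u / 2) by linarith), ← abs_mul, h1, abs_le]
      constructor <;> linarith [Real.sin_le_one (j * u - θ - u / 2),
        Real.neg_one_le_sin (j * u - θ - u / 2), Real.sin_le_one (M * u - θ - u / 2),
        Real.neg_one_le_sin (M * u - θ - u / 2)]
    rw [le_div_iff₀ hu]
    have h5 : u / Real.pi * |∑ k ∈ Finset.Ico M j, Real.cos (k * u - θ)| ≤ 1 := by
      have := mul_le_mul_of_nonneg_right h2
        (abs_nonneg (∑ k ∈ Finset.Ico M j, Real.cos (k * u - θ)))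
      linarith
    rw [div_mul_eq_mul_div, div_le_one hpi] at h5
    linarith

lemma abs_sum_mul_cos_le {b : ℕ → ℝ} {M N : ℕ} (hMN : M < N)
    (hb : ∀ k, M ≤ k → k < N → 0 ≤ b k)
    (hanti : ∀ i j, M ≤ i → i ≤ j → j < N → b j ≤ b i)
    {u : ℝ} (hu : 0 < u) (hupi : u ≤ Real.pi) (θ : ℝ) :
    |∑ k ∈ Finset.Ico M N, b k * Real.cos (k * u - θ)| ≤ b M * (Real.pi / u) :=
  abs_sum_mul_le_of_antitone hMN hb (fun k h1 h2 => hanti k (k + 1) h1 (by omega) h2)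
    fun j => abs_sum_cos_le hu hupi θ M j

/-- The frequency at which a trigonometric series is split at the point `u`. -/
lemma exists_split (u : ℝ) {n N : ℕ} (hnN : n < N) :
    ∃ M, n ≤ M ∧ M ≤ N ∧ (∀ k, n ≤ k → k < M → k * u ≤ Real.pi) ∧ (M < N → Real.pi < M * u) := by
  classical
  have hex : ∃ M : ℕ, n ≤ M ∧ (M = N ∨ Real.pi < M * u) := ⟨N, hnN.le, Or.inl rfl⟩
  refine ⟨Nat.find hex, (Nat.find_spec hex).1, Nat.find_min' hex ⟨hnN.le, Or.inl rfl⟩, ?_, ?_⟩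
  · intro k h1 h2
    have := Nat.find_min hex h2
    push Not at this
    exact (this h1).2
  · intro h
    rcases (Nat.find_spec hex).2 with h1 | h1
    · omega
    · exact h1

/-- A sine series for which `k b_k` is bounded by its first value. -/
lemma abs_sum_mul_sin_le {b : ℕ → ℝ} {n N : ℕ} (hn : 1 ≤ n) (hnN : n < N)
    (hb : ∀ k, n ≤ k → k < N → 0 ≤ b k)
    (hanti : ∀ i j, n ≤ i → i ≤ j → j < N → b j ≤ b i)
    (hkb : ∀ k, n ≤ k → k < N → k * b k ≤ n * b n) (u : ℝ) :
    |∑ k ∈ Finset.Ico n N, b k * Real.sin (k * u)| ≤ (Real.pi + 1) * (n * b n) := by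
  have hpi := Real.pi_pos
  have hbn : 0 ≤ n * b n := mul_nonneg (Nat.cast_nonneg _) (hb n le_rfl hnN)
  have hpos : ∀ v : ℝ, 0 < v → v ≤ Real.pi →
      |∑ k ∈ Finset.Ico n N, b k * Real.sin (k * v)| ≤ (Real.pi + 1) * (n * b n) := by
    intro v hv hvpi
    -- Below `M` use |sin kv| ≤ kv and k b_k ≤ n b_n; the M - n terms contribute at most π n b_n
    -- because (M - 1)v ≤ π. From `M` on, Abel's inequality gives b_M π/v ≤ M b_M ≤ n b_n.
    obtain ⟨M, hnM, hMN, hlow, hhigh⟩ := exists_split v hnN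
    rw [← Finset.sum_Ico_consecutive _ hnM hMN, add_mul, one_mul]
    refine (abs_add_le _ _).trans (add_le_add ?_ ?_)
    · calc |∑ k ∈ Finset.Ico n M, b k * Real.sin (k * v)|
          ≤ ∑ k ∈ Finset.Ico n M, |b k * Real.sin (k * v)| := Finset.abs_sum_le_sum_abs _ _
        _ ≤ ∑ k ∈ Finset.Ico n M, n * b n * v := by
          refine Finset.sum_le_sum fun k hk => ?_
          rw [Finset.mem_Ico] at hk
          have h0 := hb k hk.1 (by omega)
          have h1 := hkb k hk.1 (by omega)
          rw [abs_mul, abs_of_nonneg h0]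
          have h2 : |Real.sin (k * v)| ≤ k * v := by
            have := Real.abs_sin_le_abs (x := k * v)
            rwa [abs_of_nonneg (by positivity : 0 ≤ (k : ℝ) * v)] at this
          calc b k * |Real.sin (k * v)| ≤ b k * (k * v) := by gcongr
            _ = k * b k * v := by ring
            _ ≤ _ := by gcongr
        _ = (M - n : ℕ) * v * (n * b n) := by
          rw [Finset.sum_const, Nat.card_Ico, nsmul_eq_mul]; ring
        _ ≤ Real.pi * (n * b n) := by
          gcongr
          rcases hnM.eq_or_lt with h | h
          · simp [h, hpi.le]
          · refine le_trans ?_ (hlow (M - 1) (by omega) (by omega))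
            gcongr
    · rcases hMN.eq_or_lt with h | h
      · simp [h, hbn]
      · have h1 := abs_sum_mul_cos_le h (fun k h1 h2 => hb k (by omega) h2)
          (fun i j h1 h2 h3 => hanti i j (by omega) h2 h3) hv hvpi (Real.pi / 2)
        simp_rw [Real.cos_sub_pi_div_two] at h1
        refine h1.trans ((?_ : _ ≤ _).trans (hkb M hnM h))
        have h2 := (div_lt_iff₀ hv).2 (hhigh h)
        have h3 := hb M hnM h
        rw [mul_comm]
        gcongr
  have hper : Function.Periodic (fun v => ∑ k ∈ Finset.Ico n N, b k * Real.sin (k * v))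
      (2 * Real.pi) := fun v => by simp only [sin_natCast_mul_add_two_pi]
  obtain ⟨y, hy, hyu⟩ := hper.exists_mem_Ioc (by positivity) u (-Real.pi)
  rw [show ∑ k ∈ Finset.Ico n N, b k * Real.sin (k * u)
    = ∑ k ∈ Finset.Ico n N, b k * Real.sin (k * y) from hyu]
  rcases lt_trichotomy y 0 with h | h | h
  · have := hpos (-y) (by linarith) (by linarith [hy.1])
    simp_rw [mul_neg, Real.sin_neg, mul_neg, Finset.sum_neg_distrib, abs_neg] at this
    exact this
  · simp only [h, mul_zero, Real.sin_zero, Finset.sum_const_zero, abs_zero]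
    positivity
  · exact hpos y h (by linarith [hy.2])

/-- Frequencies up to π/u are summed trivially. The rest is at most b_{m+1} π/u ≤ (m + 1) b_{m+1};
by monotonicity m + 1 - n of these copies are covered by the low sum and n of them by n b_n. The
condition nu ≤ π keeps the low block nonempty. -/
lemma abs_sum_mul_cos_le_of_mul_le {b : ℕ → ℝ} {n N : ℕ} (hnN : n < N)
    (hb : ∀ k, n ≤ k → k < N → 0 ≤ b k)
    (hanti : ∀ i j, n ≤ i → i ≤ j → j < N → b j ≤ b i)
    {u : ℝ} (hu : 0 < u) (hupi : u ≤ Real.pi) (hnu : n * u ≤ Real.pi) (θ : ℝ) :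
    ∃ m : ℕ, n ≤ m ∧ m + 1 ≤ N ∧ m * u ≤ Real.pi ∧
      |∑ k ∈ Finset.Ico n N, b k * Real.cos (k * u - θ)|
        ≤ 2 * ∑ k ∈ Finset.Ico n (m + 1), b k + n * b n := by
  obtain ⟨M, hnM, hMN, hlow, hhigh⟩ := exists_split u hnN
  have hnM' : n < M := by
    rcases hnM.eq_or_lt with h | h
    · exact absurd (hhigh (by omega)) (by rw [← h]; linarith)
    · exact h
  obtain ⟨m, rfl⟩ : ∃ m, M = m + 1 := ⟨M - 1, by omega⟩
  refine ⟨m, by omega, hMN, hlow m (by omega) (by omega), ?_⟩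
  have hS : |∑ k ∈ Finset.Ico n (m + 1), b k * Real.cos (k * u - θ)|
      ≤ ∑ k ∈ Finset.Ico n (m + 1), b k := by
    refine (Finset.abs_sum_le_sum_abs _ _).trans (Finset.sum_le_sum fun k hk => ?_)
    rw [Finset.mem_Ico] at hk
    have h0 := hb k hk.1 (by omega)
    rw [abs_mul, abs_of_nonneg h0]
    exact mul_le_of_le_one_right h0 (Real.abs_cos_le_one _)
  have hT : |∑ k ∈ Finset.Ico (m + 1) N, b k * Real.cos (k * u - θ)|
      ≤ ∑ k ∈ Finset.Ico n (m + 1), b k + n * b n := by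
    have hbn : 0 ≤ n * b n := mul_nonneg (Nat.cast_nonneg _) (hb n le_rfl hnN)
    rcases hMN.eq_or_lt with h | h
    · have : 0 ≤ ∑ k ∈ Finset.Ico n (m + 1), b k := le_trans (abs_nonneg _) hS
      rw [h, Finset.Ico_self, Finset.sum_empty, abs_zero, ← h]
      linarith
    · have h1 := abs_sum_mul_cos_le h (fun k h1 h2 => hb k (by omega) h2)
        (fun i j h1 h2 h3 => hanti i j (by omega) h2 h3) hu hupi θ
      have h2 := (div_lt_iff₀ hu).2 (hhigh h)
      have h3 := hb (m + 1) (by omega) h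
      have h4 : ((m + 1 - n : ℕ) : ℝ) * b (m + 1) ≤ ∑ k ∈ Finset.Ico n (m + 1), b k := by
        have := Finset.card_nsmul_le_sum (Finset.Ico n (m + 1)) b (b (m + 1)) (by
          intro k hk
          rw [Finset.mem_Ico] at hk
          exact hanti _ _ hk.1 (by omega) h)
        rwa [Nat.card_Ico, nsmul_eq_mul] at this
      have h5 : (n : ℝ) * b (m + 1) ≤ n * b n := by
        gcongr
        exact hanti n (m + 1) le_rfl (by omega) h
      rw [Nat.cast_sub (by omega)] at h4
      have h6 : b (m + 1) * (Real.pi / u) ≤ b (m + 1) * ((m + 1 : ℕ) : ℝ) := by gcongr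
      nlinarith
  rw [← Finset.sum_Ico_consecutive _ hnM hMN]
  refine (abs_add_le _ _).trans ?_
  linarith

/-! ### The Hardy–Littlewood inequality for decreasing coefficients -/

lemma add_rpow_le_two_rpow_mul {x y q : ℝ} (hx : 0 ≤ x) (hy : 0 ≤ y) (hq : 0 ≤ q) :
    (x + y) ^ q ≤ 2 ^ q * (x ^ q + y ^ q) := by
  have hxq := Real.rpow_nonneg hx q
  have hyq := Real.rpow_nonneg hy q
  rcases le_total x y with h | h
  · calc (x + y) ^ q ≤ (2 * y) ^ q := Real.rpow_le_rpow (by positivity) (by linarith) hq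
      _ = 2 ^ q * y ^ q := Real.mul_rpow (by norm_num) hy
      _ ≤ _ := by gcongr; linarith
  · calc (x + y) ^ q ≤ (2 * x) ^ q := Real.rpow_le_rpow (by positivity) (by linarith) hq
      _ = 2 ^ q * x ^ q := Real.mul_rpow (by norm_num) hx
      _ ≤ _ := by gcongr; linarith

/-- A weighted Hölder inequality for partial sums, the key step of Hardy's inequality. -/
lemma exists_sum_rpow_le {q : ℝ} (hq : 1 < q) :
    ∃ C : ℝ, 0 < C ∧ ∀ (b : ℕ → ℝ) (n m : ℕ), 1 ≤ n → (∀ k, n ≤ k → k ≤ m → 0 ≤ b k) →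
      (∑ k ∈ Finset.Ico n (m + 1), b k) ^ q
        ≤ C * (m : ℝ) ^ (1 / 2 : ℝ)
          * ∑ k ∈ Finset.Ico n (m + 1), b k ^ q * (k : ℝ) ^ (q - 3 / 2) := by
  have hq0 : 0 < q := by linarith
  have hq1 : 0 < q - 1 := by linarith
  set η : ℝ := 1 / (2 * (q - 1)) with hη
  have hηpos : 0 < η := by positivity
  set C₀ : ℝ := max 1 (1 / η)
  have hC₀ : 0 < C₀ := by positivity
  have hconj : q.HolderConjugate (q / (q - 1)) := Real.HolderConjugate.conjExponent hq
  refine ⟨C₀ ^ (q - 1), by positivity, fun b n m hn hb => ?_⟩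
  -- Hölder is applied to b_k k^γ and k^{-γ}. Then γq = q - 3/2, and the conjugate power of k^{-γ}
  -- is k^{η-1}, whose sum is O(m^η) with η(q - 1) = 1/2. The exponent 1/2 is spare room: it leaves
  -- u^{-1/2}, integrable at 0, when m is compared with π/u.
  set γ : ℝ := 1 - 3 / (2 * q) with hγ
  have hnonneg : 0 ≤ ∑ k ∈ Finset.Ico n (m + 1), b k := Finset.sum_nonneg fun k hk => by
    rw [Finset.mem_Ico] at hk; exact hb k hk.1 (by omega)
  have hbk : ∀ k ∈ Finset.Ico n (m + 1), 0 ≤ b k := fun k hk => by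
    rw [Finset.mem_Ico] at hk; exact hb k hk.1 (by omega)
  have hkpos : ∀ k ∈ Finset.Ico n (m + 1), (0 : ℝ) < k := fun k hk => by
    rw [Finset.mem_Ico] at hk; exact_mod_cast (by omega : 0 < k)
  have hH := Real.inner_le_Lp_mul_Lq_of_nonneg (Finset.Ico n (m + 1)) hconj
    (f := fun k => b k * (k : ℝ) ^ γ) (g := fun k => (k : ℝ) ^ (-γ))
    (fun k hk => mul_nonneg (hbk k hk) (by positivity)) (fun k hk => by positivity)
  have e1 : ∑ k ∈ Finset.Ico n (m + 1), b k * (k : ℝ) ^ γ * (k : ℝ) ^ (-γ)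
      = ∑ k ∈ Finset.Ico n (m + 1), b k := Finset.sum_congr rfl fun k hk => by
    rw [mul_assoc, ← Real.rpow_add (hkpos k hk), add_neg_cancel, Real.rpow_zero, mul_one]
  have e2 : ∑ k ∈ Finset.Ico n (m + 1), (b k * (k : ℝ) ^ γ) ^ q
      = ∑ k ∈ Finset.Ico n (m + 1), b k ^ q * (k : ℝ) ^ (q - 3 / 2) :=
    Finset.sum_congr rfl fun k hk => by
      rw [Real.mul_rpow (hbk k hk) (by positivity), ← Real.rpow_mul (hkpos k hk).le]
      congr 2
      rw [hγ]; field_simp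
  have e3 : ∑ k ∈ Finset.Ico n (m + 1), ((k : ℝ) ^ (-γ)) ^ (q / (q - 1))
      = ∑ k ∈ Finset.Ico n (m + 1), (k : ℝ) ^ (η - 1) :=
    Finset.sum_congr rfl fun k hk => by
      rw [← Real.rpow_mul (hkpos k hk).le]
      congr 1
      rw [hγ, hη]; field_simp; ring
  have e4 : ∑ k ∈ Finset.Ico n (m + 1), (k : ℝ) ^ (η - 1) ≤ C₀ * (m : ℝ) ^ η :=
    le_trans (Finset.sum_le_sum_of_subset_of_nonneg (Finset.Ico_subset_Ico_left hn)
      fun k _ _ => by positivity) (sum_rpow_sub_one_le hηpos m)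
  rw [e1, e2, e3] at hH
  set A := ∑ k ∈ Finset.Ico n (m + 1), b k ^ q * (k : ℝ) ^ (q - 3 / 2)
  set B := ∑ k ∈ Finset.Ico n (m + 1), (k : ℝ) ^ (η - 1)
  have hA : 0 ≤ A := Finset.sum_nonneg fun k hk =>
    mul_nonneg (Real.rpow_nonneg (hbk k hk) _) (by positivity)
  have hB : 0 ≤ B := Finset.sum_nonneg fun k _ => by positivity
  calc (∑ k ∈ Finset.Ico n (m + 1), b k) ^ q
      ≤ (A ^ (1 / q) * B ^ (1 / (q / (q - 1)))) ^ q := Real.rpow_le_rpow hnonneg hH hq0.le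
    _ = A * B ^ (q - 1) := by
      rw [Real.mul_rpow (by positivity) (by positivity), ← Real.rpow_mul hA, ← Real.rpow_mul hB]
      congr 1
      · rw [one_div_mul_cancel hq0.ne', Real.rpow_one]
      · congr 1; field_simp
    _ ≤ A * (C₀ * (m : ℝ) ^ η) ^ (q - 1) := by gcongr
    _ = _ := by
      rw [Real.mul_rpow hC₀.le (by positivity), ← Real.rpow_mul (by positivity)]
      have : η * (q - 1) = 1 / 2 := by rw [hη]; field_simp
      rw [this]; ring

lemma integral_indicator_Iic_rpow {a c r : ℝ} (ha : 0 < a) (hac : a ≤ c) (hr : -1 < r) :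
    MeasureTheory.IntegrableOn (Set.indicator (Set.Iic a) fun u => u ^ r) (Set.Ioc 0 c) ∧
      ∫ u in Set.Ioc 0 c, Set.indicator (Set.Iic a) (fun u => u ^ r) u
        = a ^ (r + 1) / (r + 1) := by
  have hset : Set.Ioc 0 c ∩ Set.Iic a = Set.Ioc 0 a := by
    ext u; simp only [Set.mem_inter_iff, Set.mem_Ioc, Set.mem_Iic]
    constructor
    · rintro ⟨⟨h1, _⟩, h3⟩; exact ⟨h1, h3⟩
    · rintro ⟨h1, h2⟩; exact ⟨⟨h1, h2.trans hac⟩, h2⟩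
  constructor
  · rw [MeasureTheory.IntegrableOn, MeasureTheory.integrable_indicator_iff measurableSet_Iic,
      MeasureTheory.IntegrableOn, MeasureTheory.Measure.restrict_restrict measurableSet_Iic,
      Set.inter_comm, hset]
    exact (intervalIntegral.intervalIntegrable_rpow' hr (a := 0) (b := a)).1
  · rw [MeasureTheory.setIntegral_indicator measurableSet_Iic, hset,
      ← intervalIntegral.integral_of_le ha.le, integral_rpow (Or.inl hr),
      Real.zero_rpow (by linarith), sub_zero]

lemma integral_indicator_Ioi_rpow {a c q : ℝ} (ha : 0 < a) (hac : a ≤ c) (hq : 1 < q) :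
    MeasureTheory.IntegrableOn (Set.indicator (Set.Ioi a) fun u => u ^ (-q)) (Set.Ioc 0 c) ∧
      ∫ u in Set.Ioc 0 c, Set.indicator (Set.Ioi a) (fun u => u ^ (-q)) u
        ≤ a ^ (1 - q) / (q - 1) := by
  have hset : Set.Ioc 0 c ∩ Set.Ioi a = Set.Ioc a c := by
    ext u; simp only [Set.mem_inter_iff, Set.mem_Ioc, Set.mem_Ioi]
    constructor
    · rintro ⟨⟨_, h2⟩, h3⟩; exact ⟨h3, h2⟩
    · rintro ⟨h1, h2⟩; exact ⟨⟨ha.trans h1, h2⟩, h1⟩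
  have h0 : (0 : ℝ) ∉ Set.uIcc a c := by
    rw [Set.uIcc_of_le hac]; exact fun h => absurd h.1 (by linarith)
  constructor
  · rw [MeasureTheory.IntegrableOn, MeasureTheory.integrable_indicator_iff measurableSet_Ioi,
      MeasureTheory.IntegrableOn, MeasureTheory.Measure.restrict_restrict measurableSet_Ioi,
      Set.inter_comm, hset]
    exact (intervalIntegral.intervalIntegrable_rpow (Or.inr h0)).1
  · rw [MeasureTheory.setIntegral_indicator measurableSet_Ioi, hset,
      ← intervalIntegral.integral_of_le hac, integral_rpow (Or.inr ⟨by linarith, h0⟩)]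
    have h1 : 0 ≤ c ^ (1 - q) := Real.rpow_nonneg (ha.le.trans hac) _
    have h2 : -q + 1 = 1 - q := by ring
    rw [h2, ← neg_div_neg_eq, neg_sub, neg_sub]
    gcongr
    · linarith

/-- For u ≤ π/n the sum is at most 2 ∑_{k ≤ m} b_k + n b_n with m ≤ π/u. The weighted Hölder step
bounds the q-th power of this partial sum by u^{-1/2} ∑_{k ≤ π/u} b_k^q k^{q-3/2}, up to a constant,
and integrating u^{-1/2} over u ≤ π/k restores k^{q-2}. For u > π/n Abel's bound b_n π/u has an
integrable q-th power, contributing b_n^q n^{q-1}. -/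
lemma exists_integral_Ioc_abs_sum_rpow_le {q : ℝ} (hq : 1 < q) :
    ∃ C : ℝ, 0 < C ∧ ∀ (b : ℕ → ℝ) (n N : ℕ) (θ : ℝ), 1 ≤ n → n < N →
      (∀ k, n ≤ k → k < N → 0 ≤ b k) → (∀ i j, n ≤ i → i ≤ j → j < N → b j ≤ b i) →
      ∫ u in Set.Ioc 0 Real.pi, |∑ k ∈ Finset.Ico n N, b k * Real.cos (k * u - θ)| ^ q
        ≤ C * (∑ k ∈ Finset.Ico n N, b k ^ q * (k : ℝ) ^ (q - 2)
          + b n ^ q * (n : ℝ) ^ (q - 1)) := by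
  have hpi := Real.pi_pos
  have hq0 : 0 < q := by linarith
  have hq1 : 0 < q - 1 := by linarith
  obtain ⟨C₀, hC₀, hH⟩ := exists_sum_rpow_le hq
  set C₁ : ℝ := 2 ^ q * (2 ^ q * (C₀ * Real.pi ^ (1 / 2 : ℝ))) with hC₁
  have hC₁pos : 0 < C₁ := by positivity
  refine ⟨2 * C₁ * Real.pi ^ (1 / 2 : ℝ) + (2 ^ q * Real.pi + Real.pi / (q - 1)), by positivity, ?_⟩
  intro b n N θ hn hnN hb hanti
  have hn' : (0 : ℝ) < n := by exact_mod_cast hn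
  have hbn : 0 ≤ b n := hb n le_rfl hnN
  have hkpos : ∀ k ∈ Finset.Ico n N, (0 : ℝ) < k := fun k hk => by
    rw [Finset.mem_Ico] at hk; exact_mod_cast (by omega : 0 < k)
  have hbk : ∀ k ∈ Finset.Ico n N, 0 ≤ b k := fun k hk => by
    rw [Finset.mem_Ico] at hk; exact hb k hk.1 hk.2
  have hdiv : ∀ k : ℕ, 1 ≤ k → Real.pi / k ≤ Real.pi := fun k hk =>
    div_le_self hpi.le (by exact_mod_cast hk)
  -- The condition k ≤ π/u is encoded as u ≤ π/k, so that the majorant `F` is a finite sum and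
  -- integrates term by term. `I₂` carries the power 0 to share the integral lemma of `I₁`.
  set I₁ : ℕ → ℝ → ℝ := fun k => Set.indicator (Set.Iic (Real.pi / k)) fun u => u ^ (-(1 / 2) : ℝ)
    with hI₁
  set I₂ : ℝ → ℝ := Set.indicator (Set.Iic (Real.pi / n)) fun u => u ^ (0 : ℝ) with hI₂
  set I₃ : ℝ → ℝ := Set.indicator (Set.Ioi (Real.pi / n)) fun u => u ^ (-q) with hI₃
  set F : ℝ → ℝ := fun u => C₁ * ∑ k ∈ Finset.Ico n N, b k ^ q * (k : ℝ) ^ (q - 3 / 2) * I₁ k u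
    + (2 ^ q * (n * b n) ^ q * I₂ u + (b n * Real.pi) ^ q * I₃ u) with hF
  have i₁ : ∀ k ∈ Finset.Ico n N, _ := fun k hk => integral_indicator_Iic_rpow
    (r := (-(1 / 2) : ℝ)) (div_pos hpi (hkpos k hk))
    (hdiv k (by rw [Finset.mem_Ico] at hk; omega)) (by norm_num)
  have i₂ := integral_indicator_Iic_rpow (r := 0) (div_pos hpi hn') (hdiv n hn) (by norm_num)
  have i₃ := integral_indicator_Ioi_rpow (div_pos hpi hn') (hdiv n hn) hq
  have hsumint : MeasureTheory.IntegrableOn (fun u => ∑ k ∈ Finset.Ico n N,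
      b k ^ q * (k : ℝ) ^ (q - 3 / 2) * I₁ k u) (Set.Ioc 0 Real.pi) :=
    MeasureTheory.integrable_finsetSum _ fun k hk => (i₁ k hk).1.const_mul _
  have hFint : MeasureTheory.IntegrableOn F (Set.Ioc 0 Real.pi) :=
    (hsumint.const_mul _).add ((i₂.1.const_mul _).add (i₃.1.const_mul _))
  have hI₁nonneg : ∀ k u, 0 < u → 0 ≤ I₁ k u := fun k u hu =>
    Set.indicator_apply_nonneg fun _ => by positivity
  have hpoint : ∀ u ∈ Set.Ioc 0 Real.pi,
      |∑ k ∈ Finset.Ico n N, b k * Real.cos (k * u - θ)| ^ q ≤ F u := by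
    rintro u ⟨hu, hupi⟩
    have hsum0 : 0 ≤ ∑ k ∈ Finset.Ico n N, b k ^ q * (k : ℝ) ^ (q - 3 / 2) * I₁ k u :=
      Finset.sum_nonneg fun k hk => mul_nonneg
        (mul_nonneg (Real.rpow_nonneg (hbk k hk) _) (by positivity)) (hI₁nonneg k u hu)
    rcases le_or_gt (n * u) Real.pi with hnu | hnu
    · obtain ⟨m, hnm, hmN, hmu, hle⟩ := abs_sum_mul_cos_le_of_mul_le hnN hb hanti hu hupi hnu θ
      have hu2 : u ∈ Set.Iic (Real.pi / n) := by
        rw [Set.mem_Iic, le_div_iff₀ hn']; linarith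
      have hu3 : u ∉ Set.Ioi (Real.pi / n) := by simpa using hu2
      set S := ∑ k ∈ Finset.Ico n (m + 1), b k with hS
      have hS0 : 0 ≤ S := Finset.sum_nonneg fun k hk => by
        rw [Finset.mem_Ico] at hk; exact hb k hk.1 (by omega)
      have hSq : S ^ q ≤ C₀ * Real.pi ^ (1 / 2 : ℝ) *
          ∑ k ∈ Finset.Ico n N, b k ^ q * (k : ℝ) ^ (q - 3 / 2) * I₁ k u := by
        have hm2 : (m : ℝ) ^ (1 / 2 : ℝ) ≤ Real.pi ^ (1 / 2 : ℝ) * u ^ (-(1 / 2) : ℝ) := by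
          rw [Real.rpow_neg hu.le, ← div_eq_mul_inv, ← Real.div_rpow hpi.le hu.le]
          refine Real.rpow_le_rpow (by positivity) ?_ (by norm_num)
          rwa [le_div_iff₀ hu]
        have hsub : ∑ k ∈ Finset.Ico n (m + 1), b k ^ q * (k : ℝ) ^ (q - 3 / 2) * u ^ (-(1 / 2) : ℝ)
            ≤ ∑ k ∈ Finset.Ico n N, b k ^ q * (k : ℝ) ^ (q - 3 / 2) * I₁ k u := by
          refine le_trans (le_of_eq ?_) (Finset.sum_le_sum_of_subset_of_nonneg
            (Finset.Ico_subset_Ico_right hmN) fun k hk _ => mul_nonneg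
            (mul_nonneg (Real.rpow_nonneg (hbk k hk) _) (by positivity)) (hI₁nonneg k u hu))
          refine Finset.sum_congr rfl fun k hk => ?_
          rw [Finset.mem_Ico] at hk
          have hk0 : (0 : ℝ) < k := by exact_mod_cast (by omega : 0 < k)
          have hkm : (k : ℝ) ≤ m := by exact_mod_cast (by omega : k ≤ m)
          have : u ∈ Set.Iic (Real.pi / k) := by
            rw [Set.mem_Iic, le_div_iff₀ hk0]
            nlinarith
          rw [hI₁]
          simp only [Set.indicator_of_mem this]
        refine (hH b n m hn fun k h1 h2 => hb k h1 (by omega)).trans ?_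
        have hA : 0 ≤ ∑ k ∈ Finset.Ico n (m + 1), b k ^ q * (k : ℝ) ^ (q - 3 / 2) :=
          Finset.sum_nonneg fun k hk => by
            rw [Finset.mem_Ico] at hk
            exact mul_nonneg (Real.rpow_nonneg (hb k hk.1 (by omega)) _) (by positivity)
        calc C₀ * (m : ℝ) ^ (1 / 2 : ℝ)
              * ∑ k ∈ Finset.Ico n (m + 1), b k ^ q * (k : ℝ) ^ (q - 3 / 2)
            ≤ C₀ * (Real.pi ^ (1 / 2 : ℝ) * u ^ (-(1 / 2) : ℝ))
              * ∑ k ∈ Finset.Ico n (m + 1), b k ^ q * (k : ℝ) ^ (q - 3 / 2) := by gcongr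
          _ = C₀ * Real.pi ^ (1 / 2 : ℝ) * ∑ k ∈ Finset.Ico n (m + 1),
              b k ^ q * (k : ℝ) ^ (q - 3 / 2) * u ^ (-(1 / 2) : ℝ) := by
            rw [← Finset.sum_mul]; ring
          _ ≤ _ := by gcongr
      have hF' : F u = C₁ * ∑ k ∈ Finset.Ico n N, b k ^ q * (k : ℝ) ^ (q - 3 / 2) * I₁ k u
          + 2 ^ q * (n * b n) ^ q := by
        rw [hF]
        simp only [hI₂, hI₃, Set.indicator_of_mem hu2, Set.indicator_of_notMem hu3, Real.rpow_zero,
          mul_one, mul_zero, add_zero]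
      rw [hF']
      calc |∑ k ∈ Finset.Ico n N, b k * Real.cos (k * u - θ)| ^ q
          ≤ (2 * S + n * b n) ^ q := Real.rpow_le_rpow (abs_nonneg _) hle hq0.le
        _ ≤ 2 ^ q * ((2 * S) ^ q + (n * b n) ^ q) :=
          add_rpow_le_two_rpow_mul (by positivity) (by positivity) hq0.le
        _ = 2 ^ q * (2 ^ q * S ^ q) + 2 ^ q * (n * b n) ^ q := by
          rw [Real.mul_rpow (by norm_num) hS0]; ring
        _ ≤ 2 ^ q * (2 ^ q * (C₀ * Real.pi ^ (1 / 2 : ℝ) *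
          ∑ k ∈ Finset.Ico n N, b k ^ q * (k : ℝ) ^ (q - 3 / 2) * I₁ k u))
            + 2 ^ q * (n * b n) ^ q := by gcongr
        _ = _ := by rw [hC₁]; ring
    · have hu3 : u ∈ Set.Ioi (Real.pi / n) := by
        rw [Set.mem_Ioi, div_lt_iff₀ hn']; linarith
      have hu2 : u ∉ Set.Iic (Real.pi / n) := by simpa using hu3
      have h1 := abs_sum_mul_cos_le hnN hb hanti hu hupi θ
      have h2 : |∑ k ∈ Finset.Ico n N, b k * Real.cos (k * u - θ)| ^ q
          ≤ (b n * Real.pi) ^ q * u ^ (-q) := by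
        rw [Real.rpow_neg hu.le, ← div_eq_mul_inv, ← Real.div_rpow (by positivity) hu.le]
        refine Real.rpow_le_rpow (abs_nonneg _) ?_ hq0.le
        rwa [mul_div_assoc]
      have hF' : F u = C₁ * ∑ k ∈ Finset.Ico n N, b k ^ q * (k : ℝ) ^ (q - 3 / 2) * I₁ k u
          + (b n * Real.pi) ^ q * u ^ (-q) := by
        rw [hF]
        simp only [hI₂, hI₃, Set.indicator_of_mem hu3, Set.indicator_of_notMem hu2, mul_zero,
          zero_add]
      rw [hF']
      have : 0 ≤ C₁ * ∑ k ∈ Finset.Ico n N, b k ^ q * (k : ℝ) ^ (q - 3 / 2) * I₁ k u := by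
        positivity
      linarith
  have hcont : Continuous fun u : ℝ =>
      |∑ k ∈ Finset.Ico n N, b k * Real.cos (k * u - θ)| ^ q := by
    refine Continuous.rpow_const (by fun_prop) fun _ => Or.inr hq0.le
  have hmono := MeasureTheory.setIntegral_mono_on
    (hcont.integrableOn_Ioc (a := 0) (b := Real.pi)) hFint measurableSet_Ioc hpoint
  refine hmono.trans ?_
  have hFval : ∫ u in Set.Ioc 0 Real.pi, F u
      = C₁ * ∑ k ∈ Finset.Ico n N, b k ^ q * (k : ℝ) ^ (q - 3 / 2)
          * (∫ u in Set.Ioc 0 Real.pi, I₁ k u)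
        + (2 ^ q * (n * b n) ^ q * (∫ u in Set.Ioc 0 Real.pi, I₂ u)
          + (b n * Real.pi) ^ q * ∫ u in Set.Ioc 0 Real.pi, I₃ u) := by
    have hJ : MeasureTheory.IntegrableOn (fun u => 2 ^ q * (n * b n) ^ q * I₂ u
        + (b n * Real.pi) ^ q * I₃ u) (Set.Ioc 0 Real.pi) :=
      (i₂.1.const_mul _).add (i₃.1.const_mul _)
    simp only [hF]
    rw [MeasureTheory.integral_add (hsumint.const_mul _) hJ, MeasureTheory.integral_const_mul,
      MeasureTheory.integral_finsetSum _ fun k hk => (i₁ k hk).1.const_mul _,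
      MeasureTheory.integral_add (i₂.1.const_mul _) (i₃.1.const_mul _),
      MeasureTheory.integral_const_mul, MeasureTheory.integral_const_mul]
    simp_rw [MeasureTheory.integral_const_mul]
    rfl
  have s₁ : ∑ k ∈ Finset.Ico n N, b k ^ q * (k : ℝ) ^ (q - 3 / 2)
      * ∫ u in Set.Ioc 0 Real.pi, I₁ k u
        = 2 * Real.pi ^ (1 / 2 : ℝ) * ∑ k ∈ Finset.Ico n N, b k ^ q * (k : ℝ) ^ (q - 2) := by
    rw [Finset.mul_sum]
    refine Finset.sum_congr rfl fun k hk => ?_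
    have hk0 := hkpos k hk
    rw [(i₁ k hk).2, show (-(1 / 2) : ℝ) + 1 = 1 / 2 by norm_num, Real.div_rpow hpi.le hk0.le,
      show q - 3 / 2 = (q - 2) + 1 / 2 by ring, Real.rpow_add hk0]
    have := (Real.rpow_pos_of_pos hk0 (1 / 2)).ne'
    field_simp
  have s₂ : (n * b n) ^ q * (∫ u in Set.Ioc 0 Real.pi, I₂ u)
      = Real.pi * (b n ^ q * (n : ℝ) ^ (q - 1)) := by
    rw [i₂.2, Real.mul_rpow hn'.le hbn, zero_add, Real.rpow_one, Real.rpow_sub_one hn'.ne']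
    ring
  have s₃ : (b n * Real.pi) ^ q * (∫ u in Set.Ioc 0 Real.pi, I₃ u)
      ≤ Real.pi / (q - 1) * (b n ^ q * (n : ℝ) ^ (q - 1)) := by
    have : 0 ≤ (b n * Real.pi) ^ q := by positivity
    refine (mul_le_mul_of_nonneg_left i₃.2 this).trans (le_of_eq ?_)
    rw [Real.mul_rpow hbn hpi.le, Real.div_rpow hpi.le hn'.le, show 1 - q = -(q - 1) by ring,
      Real.rpow_neg hpi.le, Real.rpow_neg hn'.le, Real.rpow_sub_one hpi.ne' q]
    have h1 := (Real.rpow_pos_of_pos hpi q).ne'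
    have h2 := (Real.rpow_pos_of_pos hn' (q - 1)).ne'
    field_simp
  rw [hFval, s₁, mul_assoc (2 ^ q : ℝ) ((n * b n) ^ q), s₂]
  have t₁ : 0 ≤ ∑ k ∈ Finset.Ico n N, b k ^ q * (k : ℝ) ^ (q - 2) := Finset.sum_nonneg fun k hk =>
    mul_nonneg (Real.rpow_nonneg (hbk k hk) _) (by positivity)
  have t₂ : 0 ≤ b n ^ q * (n : ℝ) ^ (q - 1) := by positivity
  set A := ∑ k ∈ Finset.Ico n N, b k ^ q * (k : ℝ) ^ (q - 2)
  set B := b n ^ q * (n : ℝ) ^ (q - 1)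
  set P := Real.pi ^ (1 / 2 : ℝ)
  have hP : 0 < P := by positivity
  have u₁ : 0 ≤ 2 * C₁ * P * B := by positivity
  have u₂ : 0 ≤ (2 ^ q * Real.pi + Real.pi / (q - 1)) * A := by positivity
  calc _ ≤ C₁ * (2 * P * A) + (2 ^ q * (Real.pi * B) + Real.pi / (q - 1) * B) := by gcongr
    _ ≤ _ := by linarith

/-- The Hardy–Littlewood bound for the `L_q` norm of a trigonometric sum with decreasing
coefficients. -/
lemma exists_integral_abs_sum_rpow_le {q : ℝ} (hq : 1 < q) :
    ∃ C : ℝ, 0 < C ∧ ∀ (b : ℕ → ℝ) (n N : ℕ) (θ : ℝ), 1 ≤ n → n < N →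
      (∀ k, n ≤ k → k < N → 0 ≤ b k) → (∀ i j, n ≤ i → i ≤ j → j < N → b j ≤ b i) →
      ∫ u in (0 : ℝ)..(2 * Real.pi), |∑ k ∈ Finset.Ico n N, b k * Real.cos (k * u - θ)| ^ q
        ≤ C * (∑ k ∈ Finset.Ico n N, b k ^ q * (k : ℝ) ^ (q - 2)
          + b n ^ q * (n : ℝ) ^ (q - 1)) := by
  have hpi := Real.pi_pos
  obtain ⟨C, hC, h⟩ := exists_integral_Ioc_abs_sum_rpow_le hq
  refine ⟨2 * C, by positivity, fun b n N θ hn hnN hb hanti => ?_⟩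
  have h1 := h b n N θ hn hnN hb hanti
  have h2 := h b n N (-θ) hn hnN hb hanti
  set G : ℝ → ℝ → ℝ := fun θ u => |∑ k ∈ Finset.Ico n N, b k * Real.cos (k * u - θ)| ^ q with hG
  have hcont : ∀ θ, Continuous (G θ) := fun θ =>
    Continuous.rpow_const (by fun_prop) fun _ => Or.inr (by linarith)
  have hper : Function.Periodic (G θ) (2 * Real.pi) := by
    intro u
    simp only [hG, mul_add, add_sub_right_comm, Real.cos_add_nat_mul_two_pi]
  -- Reflection of the half period [-π, 0] changes only the sign of the phase; the half-period bound
  -- is uniform in the phase, hence the factor 2.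
  have hneg : ∀ u, G θ u = G (-θ) (-u) := by
    intro u
    simp only [hG]
    congr 2
    refine Finset.sum_congr rfl fun k _ => ?_
    rw [← Real.cos_neg]; congr 2; ring
  have e1 : ∫ u in (0 : ℝ)..(2 * Real.pi), G θ u
      = (∫ u in (-Real.pi)..0, G θ u) + ∫ u in (0 : ℝ)..Real.pi, G θ u := by
    rw [intervalIntegral.integral_add_adjacent_intervals ((hcont θ).intervalIntegrable _ _)
      ((hcont θ).intervalIntegrable _ _)]
    have := hper.intervalIntegral_add_eq 0 (-Real.pi)
    rw [zero_add, show -Real.pi + 2 * Real.pi = Real.pi by ring] at this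
    exact this
  have e2 : ∫ u in (-Real.pi)..0, G θ u = ∫ u in (0 : ℝ)..Real.pi, G (-θ) u := by
    simp_rw [hneg]
    rw [intervalIntegral.integral_comp_neg (fun u => G (-θ) u)]
    simp
  change ∫ u in (0 : ℝ)..(2 * Real.pi), G θ u ≤ _
  rw [e1, e2, intervalIntegral.integral_of_le hpi.le, intervalIntegral.integral_of_le hpi.le]
  linarith

/-! ### Upper bounds -/

lemma integral_abs_rpow_le_one {p : ℝ} (hp : 1 ≤ p) {φ : ℝ → ℝ} (hφ : φ ∈ unitBall p) :
    ∫ t in Set.Ioc 0 (2 * Real.pi), |φ t| ^ p ≤ 1 := by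
  obtain ⟨-, hmem, hle⟩ := hφ
  have hp0 : 0 < p := by linarith
  rw [hmem.eLpNorm_eq_integral_rpow_norm (by simpa using hp0) ENNReal.ofReal_ne_top,
    ENNReal.ofReal_le_one, ENNReal.toReal_ofReal hp0.le] at hle
  simp_rw [Real.norm_eq_abs] at hle
  by_contra h
  push Not at h
  exact absurd hle (not_le.2 (Real.one_lt_rpow h (inv_pos.2 hp0)))

lemma intervalIntegrable_of_mem_unitBall {p : ℝ} (hp : 1 ≤ p) {φ : ℝ → ℝ} (hφ : φ ∈ unitBall p) :
    IntervalIntegrable φ MeasureTheory.volume 0 (2 * Real.pi) := by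
  rw [intervalIntegrable_iff_integrableOn_Ioc_of_le (by positivity)]
  exact hφ.2.1.integrable (by simpa using hp)

lemma abs_integral_mul_le_rpow {p q : ℝ} (hpq : p.HolderConjugate q) {φ G : ℝ → ℝ}
    (hφ : φ ∈ unitBall p) (hG : Continuous G) (hper : Function.Periodic G (2 * Real.pi)) (x : ℝ) :
    |∫ t in (0 : ℝ)..(2 * Real.pi), φ t * G (x - t)|
      ≤ (∫ u in (0 : ℝ)..(2 * Real.pi), |G u| ^ q) ^ (1 / q) := by
  have hpi := Real.pi_pos
  have hq0 : 0 < q := hpq.symm.pos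
  have hGc : Continuous fun t => |G (x - t)| := by fun_prop
  obtain ⟨B, hB⟩ := (isCompact_Icc (a := (0 : ℝ)) (b := 2 * Real.pi)).exists_bound_of_continuousOn
    hGc.continuousOn
  have hGmem : MeasureTheory.MemLp (fun t => |G (x - t)|) (ENNReal.ofReal q)
      (MeasureTheory.volume.restrict (Set.Ioc 0 (2 * Real.pi))) := by
    refine MeasureTheory.MemLp.of_bound hGc.aestronglyMeasurable B ?_
    filter_upwards [MeasureTheory.ae_restrict_mem measurableSet_Ioc] with t ht
    exact hB t ⟨ht.1.le, ht.2⟩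
  have hH := MeasureTheory.integral_mul_le_Lp_mul_Lq_of_nonneg hpq
    (μ := MeasureTheory.volume.restrict (Set.Ioc 0 (2 * Real.pi)))
    (f := fun t => |φ t|) (g := fun t => |G (x - t)|)
    (Filter.Eventually.of_forall fun _ => abs_nonneg _)
    (Filter.Eventually.of_forall fun _ => abs_nonneg _) hφ.2.1.norm hGmem
  have hφ1 := integral_abs_rpow_le_one hpq.lt.le hφ
  have hperG : Function.Periodic (fun u => |G u| ^ q) (2 * Real.pi) := fun u => by
    simp only [hper u]
  have hshift : ∫ t in Set.Ioc 0 (2 * Real.pi), |G (x - t)| ^ q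
      = ∫ u in (0 : ℝ)..(2 * Real.pi), |G u| ^ q := by
    rw [← intervalIntegral.integral_of_le (by positivity),
      intervalIntegral.integral_comp_sub_left (fun u => |G u| ^ q) x]
    have := hperG.intervalIntegral_add_eq (x - 2 * Real.pi) 0
    rw [sub_add_cancel, zero_add] at this
    rw [sub_zero]
    exact this
  rw [hshift] at hH
  have hA : 0 ≤ ∫ u in (0 : ℝ)..(2 * Real.pi), |G u| ^ q :=
    intervalIntegral.integral_nonneg (by positivity) fun u _ => by positivity
  rw [intervalIntegral.integral_of_le (by positivity)]
  calc |∫ t in Set.Ioc 0 (2 * Real.pi), φ t * G (x - t)|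
      ≤ ∫ t in Set.Ioc 0 (2 * Real.pi), |φ t * G (x - t)| :=
        MeasureTheory.abs_integral_le_integral_abs
    _ = ∫ t in Set.Ioc 0 (2 * Real.pi), |φ t| * |G (x - t)| := by simp_rw [abs_mul]
    _ ≤ _ := hH
    _ ≤ 1 * (∫ u in (0 : ℝ)..(2 * Real.pi), |G u| ^ q) ^ (1 / q) := by
      gcongr
      exact Real.rpow_le_one (MeasureTheory.integral_nonneg fun t => by positivity) hφ1
        (by have := hpq.pos; positivity)
    _ = _ := one_mul _

lemma abs_integral_mul_le_of_abs_le {φ G : ℝ → ℝ} (hφ : φ ∈ unitBall 1) {B : ℝ}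
    (hG : ∀ u, |G u| ≤ B) (x : ℝ) :
    |∫ t in (0 : ℝ)..(2 * Real.pi), φ t * G (x - t)| ≤ B := by
  have hint := (intervalIntegrable_of_mem_unitBall le_rfl hφ).1
  have hφ1 := integral_abs_rpow_le_one le_rfl hφ
  simp_rw [Real.rpow_one] at hφ1
  have hB : 0 ≤ B := (abs_nonneg _).trans (hG 0)
  rw [intervalIntegral.integral_of_le (by positivity)]
  calc |∫ t in Set.Ioc 0 (2 * Real.pi), φ t * G (x - t)|
      ≤ ∫ t in Set.Ioc 0 (2 * Real.pi), |φ t| * B := by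
        rw [← Real.norm_eq_abs]
        refine MeasureTheory.norm_integral_le_of_norm_le (hint.abs.mul_const B) ?_
        refine Filter.Eventually.of_forall fun t => ?_
        rw [Real.norm_eq_abs, abs_mul]
        exact mul_le_mul_of_nonneg_left (hG _) (abs_nonneg _)
    _ = (∫ t in Set.Ioc 0 (2 * Real.pi), |φ t|) * B := MeasureTheory.integral_mul_const _ _
    _ ≤ 1 * B := by gcongr
    _ = B := one_mul B

/-- The harmonic of order `k` of `φ`, rotated by the phase `θ`. -/
def harmonic (φ : ℝ → ℝ) (θ : ℝ) (k : ℕ) (x : ℝ) : ℝ :=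
  (1 / Real.pi) * ∫ t in (0 : ℝ)..(2 * Real.pi), φ t * Real.cos (k * (x - t) - θ)

lemma sum_mul_harmonic {φ : ℝ → ℝ}
    (hφ : IntervalIntegrable φ MeasureTheory.volume 0 (2 * Real.pi)) (s : Finset ℕ) (c : ℕ → ℝ)
    (θ x : ℝ) :
    ∑ k ∈ s, c k * harmonic φ θ k x
      = (1 / Real.pi) * ∫ t in (0 : ℝ)..(2 * Real.pi),
          φ t * (fun u => ∑ k ∈ s, c k * Real.cos (k * u - θ)) (x - t) := by
  have h : ∀ t : ℝ, φ t * ∑ k ∈ s, c k * Real.cos (k * (x - t) - θ)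
      = ∑ k ∈ s, c k * (φ t * Real.cos (k * (x - t) - θ)) := by
    intro t
    rw [Finset.mul_sum]
    exact Finset.sum_congr rfl fun k _ => by ring
  simp_rw [h]
  rw [intervalIntegral.integral_finsetSum fun k _ =>
    (hφ.mul_continuousOn (by fun_prop)).const_mul _, Finset.mul_sum]
  refine Finset.sum_congr rfl fun k _ => ?_
  rw [intervalIntegral.integral_const_mul, harmonic]
  ring

/-- Passing to the derivative replaces kx by kx + βπ/2 and divides by ψ(k); the phase in `harmonic`
turns the argument back. -/
lemma IsPsiBetaDeriv.harmonic_eq {ψ f φ : ℝ → ℝ} {β : ℝ} (h : IsPsiBetaDeriv ψ β f φ)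
    (hφ : IntervalIntegrable φ MeasureTheory.volume 0 (2 * Real.pi)) {k : ℕ} (hk : 1 ≤ k)
    (hψ : ψ k ≠ 0) (x : ℝ) :
    fourierA f k * Real.cos (k * x) + fourierB f k * Real.sin (k * x)
      = ψ k * harmonic φ (β * Real.pi / 2) k x := by
  rw [harmonic, integral_mul_cos_sub hφ, (h.2 k hk).1, (h.2 k hk).2]
  have h1 := Real.sin_sq_add_cos_sq (β * Real.pi / 2)
  field_simp
  linear_combination (-(fourierA f k * Real.cos (k * x) + fourierB f k * Real.sin (k * x))) * h1

/-- The Fourier series of f need not be known to converge at x. The Fejér means do converge, their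
part below n tends to the partial sum, and a bound for the part above n that is uniform in N passes
to the limit. -/
lemma abs_sub_trigSum_le {f : ℝ → ℝ} (hf : Continuous f)
    (hper : Function.Periodic f (2 * Real.pi)) {n : ℕ} (hn : 1 ≤ n) {B x : ℝ}
    (h : ∀ N, n < N → |∑ k ∈ Finset.Ico n N, (1 - k / N : ℝ) *
      (fourierA f k * Real.cos (k * x) + fourierB f k * Real.sin (k * x))| ≤ B) :
    |f x - trigSum (fourierA f) (fourierB f) n x| ≤ B := by
  have hlow : Filter.Tendsto (fun N : ℕ => fourierA f 0 / 2 + ∑ k ∈ Finset.Ico 1 n,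
      (1 - k / N : ℝ) * (fourierA f k * Real.cos (k * x) + fourierB f k * Real.sin (k * x)))
      Filter.atTop (nhds (trigSum (fourierA f) (fourierB f) n x)) := by
    refine Filter.Tendsto.const_add _ (tendsto_finsetSum _ fun k _ => ?_)
    have h1 : Filter.Tendsto (fun N : ℕ => (1 - k / N : ℝ)) Filter.atTop (nhds 1) := by
      simpa using (tendsto_const_div_atTop_nhds_zero_nat (k : ℝ)).const_sub 1
    simpa using h1.mul_const _
  have hlim := ((tendsto_fejerMean hf hper x).sub hlow).abs
  refine le_of_tendsto hlim ?_
  filter_upwards [Filter.eventually_gt_atTop n] with N hN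
  refine le_trans (le_of_eq ?_) (h N hN)
  rw [fejerMean, trigSum, ← Finset.sum_Ico_consecutive _ hn hN.le]
  simp only [Nat.cast_zero, zero_div, sub_zero, one_mul]
  congr 1
  rw [add_sub_add_left_eq_sub, add_sub_right_comm, ← Finset.sum_sub_distrib,
    Finset.sum_eq_zero (fun k _ => by ring), zero_add]
  exact Finset.sum_congr rfl fun k _ => by ring

lemma zygmundSum_eq (s : ℝ) (n : ℕ) (f : ℝ → ℝ) (x : ℝ) :
    zygmundSum s n f x = trigSum (fourierA f) (fourierB f) n x
      - ∑ k ∈ Finset.Ico 1 n, ((k : ℝ) / n) ^ s *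
        (fourierA f k * Real.cos (k * x) + fourierB f k * Real.sin (k * x)) := by
  rw [zygmundSum, trigSum, add_sub_assoc, ← Finset.sum_sub_distrib]
  congr 1
  exact Finset.sum_congr rfl fun k _ => by ring

/-- The properties of the weights `ψ(k)` used in the estimates: `ψ(k) k^{1/p}` decreases, slowly,
and `ψ(k) k^{s + 1/p - ε}` almost increases. -/
structure RegularWeight (w : ℕ → ℝ) (p s : ℝ) : Prop where
  pos : ∀ k, 1 ≤ k → 0 < w k
  anti : ∀ i j, 1 ≤ i → i ≤ j → w j * (j : ℝ) ^ (1 / p) ≤ w i * (i : ℝ) ^ (1 / p)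
  doubling : ∃ D : ℝ, 0 < D ∧ ∀ n : ℕ, 1 ≤ n →
    w n * (n : ℝ) ^ (1 / p) ≤ D * (w (2 * n) * ((2 * n : ℕ) : ℝ) ^ (1 / p))
  slow : ∃ D : ℝ, 0 < D ∧ ∀ k : ℕ, 1 ≤ k → w k - w (k + 1) ≤ D * w k / k
  growth : ∃ ε : ℝ, 0 < ε ∧ ∃ K : ℝ, 0 < K ∧ ∀ i j : ℕ, 1 ≤ i → i ≤ j →
    w i * (i : ℝ) ^ (s + 1 / p) * (i : ℝ) ^ (-ε) ≤ K * (w j * (j : ℝ) ^ (s + 1 / p) * (j : ℝ) ^ (-ε))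

lemma RegularWeight.antitone {w : ℕ → ℝ} {p s : ℝ} (hw : RegularWeight w p s) (hp : 1 ≤ p)
    {i j : ℕ} (hi : 1 ≤ i) (hij : i ≤ j) : w j ≤ w i := by
  have hi0 : (0 : ℝ) < i := by exact_mod_cast hi
  have hij' : (i : ℝ) ≤ j := by exact_mod_cast hij
  have h1 := hw.anti i j hi hij
  have h2 : (i : ℝ) ^ (1 / p) ≤ (j : ℝ) ^ (1 / p) :=
    Real.rpow_le_rpow hi0.le hij' (by positivity)
  have h3 := (hw.pos j (hi.trans hij)).le
  have h4 : w j * (i : ℝ) ^ (1 / p) ≤ w i * (i : ℝ) ^ (1 / p) :=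
    (mul_le_mul_of_nonneg_left h2 h3).trans h1
  exact le_of_mul_le_mul_right h4 (Real.rpow_pos_of_pos hi0 _)

/-- Combine (1 + x)^s ≤ e^{sx} with e^y - 1 ≤ y e^y, the latter being e^{-y} ≥ 1 - y. -/
lemma one_add_rpow_sub_one_le {s x : ℝ} (hs : 0 < s) (hx : 0 ≤ x) (hx1 : x ≤ 1) :
    (1 + x) ^ s - 1 ≤ s * Real.exp s * x := by
  have h1 : (1 + x) ^ s ≤ Real.exp (s * x) := by
    rw [mul_comm, Real.exp_mul]
    refine Real.rpow_le_rpow (by linarith) ?_ hs.le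
    linarith [Real.add_one_le_exp x]
  have h2 := Real.add_one_le_exp (-(s * x))
  have h3 : Real.exp (s * x) * Real.exp (-(s * x)) = 1 := by rw [← Real.exp_add]; simp
  have h4 : Real.exp (s * x) ≤ Real.exp s := by
    apply Real.exp_le_exp.2; nlinarith
  have h5 := Real.exp_pos (s * x)
  have h6 : Real.exp (s * x) - 1 ≤ s * x * Real.exp (s * x) := by nlinarith
  have h7 : s * x * Real.exp (s * x) ≤ s * x * Real.exp s := by gcongr
  linarith

/-- The part of the deviation that comes from the multipliers `(k / n)^s`. -/
lemma RegularWeight.exists_low_le {w : ℕ → ℝ} {p s : ℝ} (hw : RegularWeight w p s) (hp : 1 ≤ p)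
    (hs : 0 < s) :
    ∃ C : ℝ, 0 < C ∧ ∀ (h : ℕ → ℝ) (C₀ : ℝ),
      (∀ j : ℕ, |∑ k ∈ Finset.Ico 1 (j + 1), h k| ≤ C₀ * (j : ℝ) ^ (1 / p)) →
      ∀ n : ℕ, 1 ≤ n → |∑ k ∈ Finset.Ico 1 n, ((k : ℝ) / n) ^ s * w k * h k|
        ≤ C * C₀ * (w n * (n : ℝ) ^ (1 / p)) := by
  obtain ⟨D, hD, hslow⟩ := hw.slow
  obtain ⟨ε, hε, K, hK, hgrowth⟩ := hw.growth
  have hp0 : 0 < p := by linarith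
  set E : ℝ := s * Real.exp s + D with hE
  have hEpos : 0 < E := by positivity
  set M : ℝ := max 1 (1 / ε)
  have hM : 0 < M := by positivity
  refine ⟨1 + E * K * M, by positivity, fun h C₀ hh n hn => ?_⟩
  have hC₀ : 0 ≤ C₀ := by
    have := (abs_nonneg _).trans (hh 1)
    simpa using this
  have hn0 : (0 : ℝ) < n := by exact_mod_cast hn
  set c : ℕ → ℝ := fun k => ((k : ℝ) / n) ^ s * w k with hc
  have hcn : c n = w n := by simp only [hc]; rw [div_self hn0.ne', Real.one_rpow, one_mul]
  -- From k to k + 1 the power grows by a relative amount O(1/k), and the decreasing weight loses at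
  -- most D/k of its value.
  have hdiff : ∀ k : ℕ, 1 ≤ k → |c (k + 1) - c k| ≤ E * c k / k := by
    intro k hk
    have hk0 : (0 : ℝ) < k := by exact_mod_cast hk
    have hwk := hw.pos k hk
    have hP : 0 < ((k : ℝ) / n) ^ s := by positivity
    have hmono : ((k : ℝ) / n) ^ s ≤ (((k + 1 : ℕ) : ℝ) / n) ^ s := by
      apply Real.rpow_le_rpow (by positivity) _ hs.le
      gcongr; simp
    have hsplit : (((k + 1 : ℕ) : ℝ) / n) ^ s = ((k : ℝ) / n) ^ s * (1 + (k : ℝ)⁻¹) ^ s := by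
      rw [← Real.mul_rpow (by positivity) (by positivity)]
      congr 1; push_cast; field_simp
    have hup := one_add_rpow_sub_one_le hs (x := (k : ℝ)⁻¹) (by positivity)
      (inv_le_one_of_one_le₀ (by exact_mod_cast hk))
    have hwm := hw.antitone hp hk (Nat.le_succ k)
    have hsl := hslow k hk
    have hw1 := hw.pos (k + 1) (by omega)
    rw [abs_le]
    constructor
    · have h1 : ((k : ℝ) / n) ^ s * w k - (((k + 1 : ℕ) : ℝ) / n) ^ s * w (k + 1)
          ≤ ((k : ℝ) / n) ^ s * (D * w k / k) := by
        calc _ ≤ ((k : ℝ) / n) ^ s * w k - ((k : ℝ) / n) ^ s * w (k + 1) := by gcongr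
          _ = ((k : ℝ) / n) ^ s * (w k - w (k + 1)) := by ring
          _ ≤ _ := by gcongr
      have h2 : ((k : ℝ) / n) ^ s * (D * w k / k) ≤ E * (((k : ℝ) / n) ^ s * w k) / k := by
        rw [mul_div_assoc', mul_left_comm]
        gcongr
        rw [hE]; have := Real.exp_pos s; nlinarith [mul_pos hs this]
      simp only [hc]; linarith
    · have h1 : (((k + 1 : ℕ) : ℝ) / n) ^ s * w (k + 1) - ((k : ℝ) / n) ^ s * w k
          ≤ ((k : ℝ) / n) ^ s * w k * (s * Real.exp s * (k : ℝ)⁻¹) := by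
        calc _ ≤ (((k + 1 : ℕ) : ℝ) / n) ^ s * w k - ((k : ℝ) / n) ^ s * w k := by gcongr
          _ = ((k : ℝ) / n) ^ s * w k * ((1 + (k : ℝ)⁻¹) ^ s - 1) := by rw [hsplit]; ring
          _ ≤ _ := by gcongr
      have h2 : ((k : ℝ) / n) ^ s * w k * (s * Real.exp s * (k : ℝ)⁻¹)
          ≤ E * (((k : ℝ) / n) ^ s * w k) / k := by
        calc _ = s * Real.exp s * (((k : ℝ) / n) ^ s * w k) / k := by field_simp
          _ ≤ _ := by gcongr; rw [hE]; linarith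
      simp only [hc]; linarith
  -- This is the growth condition with the gain (k/n)^ε. After Abel summation the gain leaves n^{-ε}
  -- ∑ k^{ε-1}, which is bounded; without it a logarithm could appear.
  have hck : ∀ k : ℕ, 1 ≤ k → k ≤ n →
      c k * (k : ℝ) ^ (1 / p) ≤ K * (w n * (n : ℝ) ^ (1 / p)) * ((n : ℝ) ^ (-ε) * (k : ℝ) ^ ε) := by
    intro k hk hkn
    have hk0 : (0 : ℝ) < k := by exact_mod_cast hk
    have h1 := hgrowth k n hk hkn
    rw [Real.rpow_add hk0, Real.rpow_add hn0] at h1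
    have h2 : c k * (k : ℝ) ^ (1 / p) = (w k * ((k : ℝ) ^ s * (k : ℝ) ^ (1 / p)) * (k : ℝ) ^ (-ε))
        * ((k : ℝ) ^ ε / (n : ℝ) ^ s) := by
      simp only [hc]
      rw [Real.div_rpow hk0.le hn0.le, Real.rpow_neg hk0.le]
      field_simp
    rw [h2]
    refine (mul_le_mul_of_nonneg_right h1 (by positivity)).trans (le_of_eq ?_)
    have := (Real.rpow_pos_of_pos hn0 s).ne'
    field_simp
  have habel := sum_mul_eq_sub_sum_diff c h hn
  have hwn : 0 ≤ w n * (n : ℝ) ^ (1 / p) := mul_nonneg (hw.pos n hn).le (by positivity)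
  have hfirst : |c n * ∑ k ∈ Finset.Ico 1 n, h k| ≤ C₀ * (w n * (n : ℝ) ^ (1 / p)) := by
    have h1 := hh (n - 1)
    rw [Nat.sub_add_cancel hn] at h1
    have h2 : ((n - 1 : ℕ) : ℝ) ^ (1 / p) ≤ (n : ℝ) ^ (1 / p) := by
      refine Real.rpow_le_rpow (by positivity) (by exact_mod_cast Nat.sub_le n 1) (by positivity)
    rw [hcn, abs_mul, abs_of_pos (hw.pos n hn)]
    calc w n * |∑ k ∈ Finset.Ico 1 n, h k| ≤ w n * (C₀ * (n : ℝ) ^ (1 / p)) := by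
          have := (hw.pos n hn).le
          gcongr
          exact h1.trans (by gcongr)
      _ = _ := by ring
  have hsecond : |∑ j ∈ Finset.Ico 1 n, (c (j + 1) - c j) * ∑ k ∈ Finset.Ico 1 (j + 1), h k|
      ≤ E * K * M * C₀ * (w n * (n : ℝ) ^ (1 / p)) := by
    calc |∑ j ∈ Finset.Ico 1 n, (c (j + 1) - c j) * ∑ k ∈ Finset.Ico 1 (j + 1), h k|
        ≤ ∑ j ∈ Finset.Ico 1 n, |(c (j + 1) - c j) * ∑ k ∈ Finset.Ico 1 (j + 1), h k| :=
          Finset.abs_sum_le_sum_abs _ _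
      _ ≤ ∑ j ∈ Finset.Ico 1 n, E * K * C₀ * (w n * (n : ℝ) ^ (1 / p)) * (n : ℝ) ^ (-ε)
            * (j : ℝ) ^ (ε - 1) := by
        refine Finset.sum_le_sum fun j hj => ?_
        rw [Finset.mem_Ico] at hj
        have hj0 : (0 : ℝ) < j := by exact_mod_cast hj.1
        have h0 : 0 ≤ E * c j / j := (abs_nonneg _).trans (hdiff j hj.1)
        rw [abs_mul]
        calc _ ≤ E * c j / j * (C₀ * (j : ℝ) ^ (1 / p)) :=
              mul_le_mul (hdiff j hj.1) (hh j) (abs_nonneg _) h0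
          _ = E * C₀ / j * (c j * (j : ℝ) ^ (1 / p)) := by ring
          _ ≤ E * C₀ / j * (K * (w n * (n : ℝ) ^ (1 / p)) * ((n : ℝ) ^ (-ε) * (j : ℝ) ^ ε)) := by
            have := hck j hj.1 hj.2.le
            gcongr
          _ = _ := by rw [Real.rpow_sub_one hj0.ne']; ring
      _ = E * K * C₀ * (w n * (n : ℝ) ^ (1 / p)) * (n : ℝ) ^ (-ε)
            * ∑ j ∈ Finset.Ico 1 n, (j : ℝ) ^ (ε - 1) := by rw [Finset.mul_sum]
      _ ≤ E * K * C₀ * (w n * (n : ℝ) ^ (1 / p)) * (n : ℝ) ^ (-ε) * (M * (n : ℝ) ^ ε) := by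
        gcongr
        refine le_trans (Finset.sum_le_sum_of_subset_of_nonneg
          (Finset.Ico_subset_Ico_right (Nat.le_succ n)) fun k _ _ => by positivity)
          (sum_rpow_sub_one_le hε n)
      _ = _ := by
        rw [Real.rpow_neg hn0.le]
        have := (Real.rpow_pos_of_pos hn0 ε).ne'
        field_simp
  rw [habel]
  refine (abs_sub _ _).trans ?_
  linarith

/-- Reduction of the upper bound for the deviation of Zygmund sums to bounds for the convolutions of
the unit ball with trigonometric sums. -/
lemma exists_zygmundError_le {ψ : ℝ → ℝ} {β p s : ℝ}
    (hw : RegularWeight (fun k : ℕ => ψ k) p s) (hp : 1 ≤ p) (hs : 0 < s) {C₀ : ℝ} {B : ℕ → ℝ}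
    (hlow : ∀ φ ∈ unitBall p, ∀ x, ∀ j : ℕ,
      |∑ k ∈ Finset.Ico 1 (j + 1), harmonic φ (β * Real.pi / 2) k x| ≤ C₀ * (j : ℝ) ^ (1 / p))
    (hhigh : ∀ φ ∈ unitBall p, ∀ x, ∀ n N : ℕ, 1 ≤ n → n < N →
      |∑ k ∈ Finset.Ico n N, (1 - k / N : ℝ) * ψ k * harmonic φ (β * Real.pi / 2) k x| ≤ B n) :
    ∃ C : ℝ, 0 < C ∧ ∀ n : ℕ, 1 ≤ n → zygmundError ψ β p s n
      ≤ ENNReal.ofReal (B n + C * C₀ * (ψ n * (n : ℝ) ^ (1 / p))) := by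
  obtain ⟨C, hC, hCl⟩ := hw.exists_low_le hp hs
  refine ⟨C, hC, fun n hn => ?_⟩
  refine iSup₂_le fun f hf => iSup_le fun x => ENNReal.ofReal_le_ofReal ?_
  obtain ⟨hcont, hper, φ, hφ, hd⟩ := hf
  have hint := intervalIntegrable_of_mem_unitBall hp hφ
  have hterm : ∀ k : ℕ, 1 ≤ k → fourierA f k * Real.cos (k * x) + fourierB f k * Real.sin (k * x)
      = ψ k * harmonic φ (β * Real.pi / 2) k x := fun k hk =>
    hd.harmonic_eq hint hk (hw.pos k hk).ne' x
  have h1 : |f x - trigSum (fourierA f) (fourierB f) n x| ≤ B n := by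
    refine abs_sub_trigSum_le hcont hper hn fun N hN => ?_
    refine le_trans (le_of_eq ?_) (hhigh φ hφ x n N hn hN)
    congr 1
    refine Finset.sum_congr rfl fun k hk => ?_
    rw [Finset.mem_Ico] at hk
    rw [hterm k (by omega)]; ring
  have h2 := hCl (fun k => harmonic φ (β * Real.pi / 2) k x) C₀ (hlow φ hφ x) n hn
  have h3 : ∑ k ∈ Finset.Ico 1 n, ((k : ℝ) / n) ^ s *
        (fourierA f k * Real.cos (k * x) + fourierB f k * Real.sin (k * x))
      = ∑ k ∈ Finset.Ico 1 n, ((k : ℝ) / n) ^ s * ψ k * harmonic φ (β * Real.pi / 2) k x := by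
    refine Finset.sum_congr rfl fun k hk => ?_
    rw [Finset.mem_Ico] at hk
    rw [hterm k hk.1]; ring
  change |f x - zygmundSum s n f x| ≤ _
  rw [zygmundSum_eq, h3, ← sub_add]
  exact (abs_add_le _ _).trans (add_le_add h1 h2)

lemma sum_Ico_le_tsum {h : ℕ → ℝ} (hpos : ∀ k, 1 ≤ k → 0 ≤ h k)
    (hsum : Summable fun k => h (k + 1)) {n : ℕ} (hn : 1 ≤ n) (N : ℕ) :
    ∑ k ∈ Finset.Ico n N, h k ≤ ∑' j, h (n + j) := by
  have hsum' : Summable fun j => h (n + j) := by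
    have h1 : (fun j => h (n + j)) = fun j => h (j + (n - 1) + 1) :=
      funext fun j => by congr 1; omega
    rw [h1]
    exact (summable_nat_add_iff (n - 1)).2 hsum
  rw [Finset.sum_Ico_eq_sum_range]
  exact hsum'.sum_le_tsum _ fun j _ => hpos _ (by omega)

/-- The tapered weights `(1 - k / N) ψ(k)` inherit monotonicity. -/
lemma taper_antitone {w : ℕ → ℝ} {n N : ℕ} (hpos : ∀ k, n ≤ k → 0 ≤ w k)
    (hanti : ∀ i j, n ≤ i → i ≤ j → w j ≤ w i) (i j : ℕ) (hi : n ≤ i) (hij : i ≤ j) (hj : j < N) :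
    (1 - j / N : ℝ) * w j ≤ (1 - i / N : ℝ) * w i := by
  have hN : (0 : ℝ) < N := by exact_mod_cast (by omega : 0 < N)
  have h1 : (i : ℝ) / N ≤ j / N := by gcongr
  have h2 : (i : ℝ) / N ≤ 1 := by
    rw [div_le_one hN]; exact_mod_cast (by omega : i ≤ N)
  exact mul_le_mul (by linarith) (hanti i j hi hij) (hpos j (by omega)) (by linarith)

lemma taper_nonneg_le {w : ℕ → ℝ} {k N : ℕ} (hpos : 0 ≤ w k) (hk : k < N) :
    0 ≤ (1 - k / N : ℝ) * w k ∧ (1 - k / N : ℝ) * w k ≤ w k := by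
  have hN : (0 : ℝ) < N := by exact_mod_cast (by omega : 0 < N)
  have h1 : (0 : ℝ) ≤ k / N := by positivity
  have h2 : (k : ℝ) / N ≤ 1 := by
    rw [div_le_one hN]; exact_mod_cast hk.le
  exact ⟨mul_nonneg (by linarith) hpos, mul_le_of_le_one_left hpos (by linarith)⟩

/-! ### Lower bounds -/

lemma sum_Ico_cos_sub_eq_trigSum (μ : ℕ → ℝ) {m N : ℕ} (hm : 1 ≤ m) (θ x : ℝ) :
    ∑ k ∈ Finset.Ico m N, μ k * Real.cos (k * x - θ)
      = trigSum (fun k => if m ≤ k then μ k * Real.cos θ else 0)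
          (fun k => if m ≤ k then μ k * Real.sin θ else 0) N x := by
  rw [trigSum, if_neg (by omega), zero_div, zero_add]
  have hsub : Finset.Ico m N ⊆ Finset.Ico 1 N := Finset.Ico_subset_Ico_left hm
  rw [← Finset.sum_subset hsub]
  · refine Finset.sum_congr rfl fun k hk => ?_
    rw [Finset.mem_Ico] at hk
    rw [if_pos hk.1, if_pos hk.1, Real.cos_sub]; ring
  · intro k hk hk2
    rw [Finset.mem_Ico] at hk hk2
    rw [if_neg (by omega), if_neg (by omega)]; simp

lemma mem_unitBall_of_continuous {p : ℝ} (hp : 1 ≤ p) {φ : ℝ → ℝ} (hcont : Continuous φ)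
    (hper : Function.Periodic φ (2 * Real.pi))
    (hint : ∫ t in (0 : ℝ)..(2 * Real.pi), |φ t| ^ p ≤ 1) : φ ∈ unitBall p := by
  have hp0 : 0 < p := by linarith
  obtain ⟨B, hB⟩ := (isCompact_Icc (a := (0 : ℝ)) (b := 2 * Real.pi)).exists_bound_of_continuousOn
    hcont.continuousOn
  have hmem : MeasureTheory.MemLp φ (ENNReal.ofReal p)
      (MeasureTheory.volume.restrict (Set.Ioc 0 (2 * Real.pi))) := by
    refine MeasureTheory.MemLp.of_bound hcont.aestronglyMeasurable B ?_
    filter_upwards [MeasureTheory.ae_restrict_mem measurableSet_Ioc] with t ht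
    exact hB t ⟨ht.1.le, ht.2⟩
  refine ⟨hper, hmem, ?_⟩
  rw [hmem.eLpNorm_eq_integral_rpow_norm (by simpa using hp0) ENNReal.ofReal_ne_top,
    ENNReal.ofReal_le_one, ENNReal.toReal_ofReal hp0.le]
  rw [intervalIntegral.integral_of_le (by positivity)] at hint
  exact Real.rpow_le_one (MeasureTheory.integral_nonneg fun t => by positivity) hint
    (by positivity)

/-- Test functions are prescribed through their derivative: the coefficients acquire the factor ψ(k)
and the phase βπ/2. -/
lemma sum_cos_mem_classC {ψ : ℝ → ℝ} {β p : ℝ} (hp : 1 ≤ p) (hψ : ∀ k : ℕ, 1 ≤ k → 0 < ψ k)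
    {μ : ℕ → ℝ} {m N : ℕ} (hm : 1 ≤ m) (hN : 1 ≤ N) {θ : ℝ}
    (hφ : ∫ t in (0 : ℝ)..(2 * Real.pi), |∑ k ∈ Finset.Ico m N, μ k * Real.cos (k * t - θ)| ^ p
      ≤ 1) :
    (fun t => ∑ k ∈ Finset.Ico m N, ψ k * μ k * Real.cos (k * t - (θ + β * Real.pi / 2)))
      ∈ classC ψ β p := by
  have hφtrig : (fun t => ∑ k ∈ Finset.Ico m N, μ k * Real.cos (k * t - θ))
      = trigSum (fun k => if m ≤ k then μ k * Real.cos θ else 0)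
        (fun k => if m ≤ k then μ k * Real.sin θ else 0) N :=
    funext fun t => sum_Ico_cos_sub_eq_trigSum μ hm θ t
  simp_rw [fun t => congrFun hφtrig t] at hφ
  simp_rw [fun t => sum_Ico_cos_sub_eq_trigSum (N := N) (fun k => ψ k * μ k) hm
    (θ + β * Real.pi / 2) t]
  refine ⟨continuous_trigSum _ _ _, periodic_trigSum _ _ _, _,
    mem_unitBall_of_continuous hp (continuous_trigSum _ _ _) (periodic_trigSum _ _ _) hφ, ?_, ?_⟩
  · rw [fourierA_trigSum _ _ hN, if_pos (by omega), if_neg (by omega)]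
  · intro k hk
    have hψk := (hψ k hk).ne'
    have h1 := Real.sin_sq_add_cos_sq (β * Real.pi / 2)
    rw [fourierA_trigSum _ _ hN, fourierA_trigSum _ _ hN, fourierB_trigSum _ _ hk,
      fourierB_trigSum _ _ hk]
    generalize β * Real.pi / 2 = γ at *
    by_cases hkN : k < N
    · by_cases hmk : m ≤ k
      · simp only [if_pos hkN, if_pos hmk, Real.cos_add, Real.sin_add]
        constructor
        · field_simp
          linear_combination (-(μ k * Real.cos θ)) * h1
        · field_simp
          linear_combination (-(μ k * Real.sin θ)) * h1
      · simp [hmk]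
    · simp [hkN]

lemma le_bestApprox_of_trigSum_mem {ψ : ℝ → ℝ} {β p : ℝ} {a b : ℕ → ℝ} {n N : ℕ} (hn : 1 ≤ n)
    (hN : 1 ≤ N) (ha : ∀ k, k < 2 * n → a k = 0) (hb : ∀ k, k < 2 * n → b k = 0)
    (hmem : trigSum a b N ∈ classC ψ β p) (x : ℝ) :
    ENNReal.ofReal (|trigSum a b N x| / 4) ≤ bestApprox ψ β p n := by
  refine le_iSup₂_of_le (trigSum a b N) hmem ?_
  refine le_iInf₂ fun T hT => ?_
  obtain ⟨c, d, hT⟩ := hT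
  obtain rfl : T = trigSum c d n := funext hT
  -- The infinite case is set aside because `ENNReal.toReal` would turn it into 0.
  by_cases htop : (uniformNorm fun x => trigSum a b N x - trigSum c d n x) = ⊤
  · rw [htop]; exact le_top
  have hle : ∀ t, |trigSum a b N t - trigSum c d n t|
      ≤ (uniformNorm fun x => trigSum a b N x - trigSum c d n x).toReal := by
    intro t
    rw [← ENNReal.ofReal_le_iff_le_toReal htop]
    exact le_iSup (fun x => ENNReal.ofReal |trigSum a b N x - trigSum c d n x|) t
  have hfx := abs_trigSum_le_of_abs_sub_le hn hN ha hb hle x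
  refine ENNReal.ofReal_le_of_le_toReal ?_
  linarith

/-- A lower bound for the best approximation of the class by means of one function. -/
lemma le_bestApprox {ψ : ℝ → ℝ} {β p : ℝ} (hp : 1 ≤ p) (hψ : ∀ k : ℕ, 1 ≤ k → 0 < ψ k)
    {μ : ℕ → ℝ} {n m N : ℕ} (hn : 1 ≤ n) (hm : 2 * n ≤ m) (hN : 1 ≤ N) {θ R : ℝ} (hR : 0 < R)
    (hφ : ∫ t in (0 : ℝ)..(2 * Real.pi), |∑ k ∈ Finset.Ico m N, μ k * Real.cos (k * t - θ)| ^ p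
      ≤ R ^ p) (x : ℝ) :
    ENNReal.ofReal
      (|∑ k ∈ Finset.Ico m N, ψ k * μ k * Real.cos (k * x - (θ + β * Real.pi / 2))| / (4 * R))
      ≤ bestApprox ψ β p n := by
  have hm1 : 1 ≤ m := by omega
  have hφ1 : ∫ t in (0 : ℝ)..(2 * Real.pi),
      |∑ k ∈ Finset.Ico m N, μ k / R * Real.cos (k * t - θ)| ^ p ≤ 1 := by
    have h1 : ∀ t : ℝ, |∑ k ∈ Finset.Ico m N, μ k / R * Real.cos (k * t - θ)| ^ p = (R ^ p)⁻¹
        * |∑ k ∈ Finset.Ico m N, μ k * Real.cos (k * t - θ)| ^ p := by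
      intro t
      have : ∑ k ∈ Finset.Ico m N, μ k / R * Real.cos (k * t - θ)
          = R⁻¹ * ∑ k ∈ Finset.Ico m N, μ k * Real.cos (k * t - θ) := by
        rw [Finset.mul_sum]
        exact Finset.sum_congr rfl fun k _ => by ring
      rw [this, abs_mul, abs_of_pos (inv_pos.2 hR),
        Real.mul_rpow (by positivity) (abs_nonneg _), Real.inv_rpow hR.le]
    simp_rw [h1]
    rw [intervalIntegral.integral_const_mul]
    have hRp : 0 < R ^ p := Real.rpow_pos_of_pos hR p
    rw [inv_mul_le_iff₀ hRp, mul_one]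
    exact hφ
  have hmem := sum_cos_mem_classC (β := β) hp hψ hm1 hN hφ1
  simp_rw [fun t => sum_Ico_cos_sub_eq_trigSum (N := N) (fun k => ψ k * (μ k / R)) hm1
    (θ + β * Real.pi / 2) t] at hmem
  have h := le_bestApprox_of_trigSum_mem hn hN (fun k hk => if_neg (by omega))
    (fun k hk => if_neg (by omega)) hmem x
  rw [← sum_Ico_cos_sub_eq_trigSum (fun k => ψ k * (μ k / R)) hm1] at h
  have hval : ∑ k ∈ Finset.Ico m N, ψ k * (μ k / R) * Real.cos (k * x - (θ + β * Real.pi / 2))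
      = R⁻¹ * ∑ k ∈ Finset.Ico m N, ψ k * μ k * Real.cos (k * x - (θ + β * Real.pi / 2)) := by
    rw [Finset.mul_sum]
    exact Finset.sum_congr rfl fun k _ => by ring
  rw [hval, abs_mul, abs_of_pos (inv_pos.2 hR)] at h
  rwa [inv_mul_eq_div, div_div, mul_comm R 4] at h

lemma bestApprox_le_zygmundError (ψ : ℝ → ℝ) (β p s : ℝ) (n : ℕ) :
    bestApprox ψ β p n ≤ zygmundError ψ β p s n := by
  refine iSup₂_mono fun f _ => iInf₂_le (zygmundSum s n f) ?_
  refine ⟨fun k => if k = 0 then fourierA f 0 else (1 - ((k : ℝ) / n) ^ s) * fourierA f k,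
    fun k => (1 - ((k : ℝ) / n) ^ s) * fourierB f k, fun x => ?_⟩
  simp only [zygmundSum, ↓reduceIte]
  congr 1
  refine Finset.sum_congr rfl fun k hk => ?_
  rw [Finset.mem_Ico] at hk
  rw [if_neg (by omega)]; ring

/-- Truncation moves into the coefficients, so kernels of different orders can be combined over one
range of frequencies. -/
lemma fejerKernel_eq_sum_max {M L : ℕ} (hM : 1 ≤ M) (hML : M ≤ L) (t : ℝ) :
    fejerKernel M t
      = 1 / 2 + ∑ k ∈ Finset.Ico 1 L, max (1 - k / M : ℝ) 0 * Real.cos (k * t) := by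
  have hM0 : (0 : ℝ) < M := by exact_mod_cast hM
  rw [fejerKernel, trigSum, ← Finset.sum_subset (Finset.Ico_subset_Ico_right hML)]
  · congr 1
    · simp
    · refine Finset.sum_congr rfl fun k hk => ?_
      rw [Finset.mem_Ico] at hk
      have : (k : ℝ) / M ≤ 1 := by
        rw [div_le_one hM0]; exact_mod_cast hk.2.le
      rw [max_eq_left (by linarith)]; simp
  · intro k hk hk2
    rw [Finset.mem_Ico] at hk hk2
    have : (1 : ℝ) ≤ k / M := by
      rw [le_div_iff₀ hM0, one_mul]; exact_mod_cast (by omega : M ≤ k)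
    rw [max_eq_right (by linarith), zero_mul]

/-- Differences of de la Vallée Poussin kernels: even polynomials without low frequencies, with
nonnegative coefficients, many of which are `1`, and with bounded `L_1` norm. -/
lemma exists_kernel {m N : ℕ} (hm : 1 ≤ m) (hmN : m ≤ N) :
    ∃ μ : ℕ → ℝ, (∀ k, 0 ≤ μ k) ∧ (∀ k, 2 * m ≤ k → k ≤ N → μ k = 1) ∧
      ∫ t in (0 : ℝ)..(2 * Real.pi), |∑ k ∈ Finset.Ico m (2 * N), μ k * Real.cos (k * t)|
        ≤ 6 * Real.pi := by
  have hm0 : (0 : ℝ) < m := by exact_mod_cast hm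
  have hN0 : (0 : ℝ) < N := by exact_mod_cast hm.trans hmN
  have hmN' : (m : ℝ) ≤ N := by exact_mod_cast hmN
  set τ : ℕ → ℕ → ℝ := fun M k => max (1 - k / M : ℝ) 0 with hτ
  have hτ1 : ∀ {M k : ℕ}, (0 : ℝ) < M → (k : ℝ) ≤ M → τ M k = 1 - k / M := by
    intro M k hM h
    have : (k : ℝ) / M ≤ 1 := by rwa [div_le_one hM]
    exact max_eq_left (by linarith)
  have hτ0 : ∀ {M k : ℕ}, (0 : ℝ) < M → (M : ℝ) ≤ k → τ M k = 0 := by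
    intro M k hM h
    have : (1 : ℝ) ≤ k / M := by rwa [le_div_iff₀ hM, one_mul]
    exact max_eq_right (by linarith)
  have h2m : (0 : ℝ) < (2 * m : ℕ) := by push_cast; linarith
  have h2N : (0 : ℝ) < (2 * N : ℕ) := by push_cast; linarith
  have hV1 : ∀ {M k : ℕ}, (0 : ℝ) < M → (k : ℝ) ≤ M → 2 * τ (2 * M) k - τ M k = 1 := by
    intro M k hM h
    rw [hτ1 hM h, hτ1 (by push_cast; linarith) (by push_cast; linarith)]
    push_cast; field_simp; ring
  have hV2 : ∀ {M k : ℕ}, (0 : ℝ) < M → (M : ℝ) ≤ k → (k : ℝ) ≤ 2 * M →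
      2 * τ (2 * M) k - τ M k = 2 - k / M := by
    intro M k hM h h'
    rw [hτ0 hM h, hτ1 (by push_cast; linarith) (by push_cast; linarith)]
    push_cast; field_simp; ring
  have hV3 : ∀ {M k : ℕ}, (0 : ℝ) < M → (2 * M : ℝ) ≤ k → 2 * τ (2 * M) k - τ M k = 0 := by
    intro M k hM h
    rw [hτ0 hM (by linarith), hτ0 (by push_cast; linarith) (by push_cast; linarith)]
    ring
  -- Each bracket is a trapezoid: 1 up to M, then 2 - k/M, then 0 from 2M on. The trapezoid of `m`
  -- lies below that of `N`, whence nonnegativity.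
  set μ : ℕ → ℝ := fun k => (2 * τ (2 * N) k - τ N k) - (2 * τ (2 * m) k - τ m k) with hμ
  have hμlow : ∀ k : ℕ, k ≤ m → μ k = 0 := by
    intro k hk
    have hk' : (k : ℝ) ≤ m := by exact_mod_cast hk
    simp only [hμ]
    rw [hV1 hm0 hk', hV1 hN0 (hk'.trans hmN')]; ring
  refine ⟨μ, ?_, ?_, ?_⟩
  · intro k
    rcases le_total k m with h1 | h1
    · exact (hμlow k h1).ge
    have h1' : (m : ℝ) ≤ k := by exact_mod_cast h1
    have hkm : (1 : ℝ) ≤ k / m := by rwa [le_div_iff₀ hm0, one_mul]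
    have hkmN : (k : ℝ) / N ≤ k / m := by gcongr
    simp only [hμ]
    rcases le_total (k : ℝ) (2 * m) with h2 | h2
    · rw [hV2 hm0 h1' h2]
      rcases le_total (k : ℝ) N with h3 | h3
      · rw [hV1 hN0 h3]; linarith
      · rw [hV2 hN0 h3 (by linarith)]; linarith
    · rw [hV3 hm0 h2]
      rcases le_total (k : ℝ) N with h3 | h3
      · rw [hV1 hN0 h3]; norm_num
      · rcases le_total (k : ℝ) (2 * N) with h4 | h4
        · have : (k : ℝ) / N ≤ 2 := by rwa [div_le_iff₀ hN0]
          rw [hV2 hN0 h3 h4]; linarith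
        · rw [hV3 hN0 h4]; norm_num
  · intro k h1 h2
    simp only [hμ]
    rw [hV1 hN0 (by exact_mod_cast h2), hV3 hm0 (by exact_mod_cast h1)]; norm_num
  -- The constant terms of the four kernels cancel. Each Fejér kernel is nonnegative with integral
  -- π, so the L_1 norm is at most (2 + 1 + 2 + 1)π.
  · have hker : ∀ t : ℝ, ∑ k ∈ Finset.Ico m (2 * N), μ k * Real.cos (k * t)
        = 2 * fejerKernel (2 * N) t - fejerKernel N t
          - (2 * fejerKernel (2 * m) t - fejerKernel m t) := by
      intro t
      rw [fejerKernel_eq_sum_max (L := 2 * N) (by omega) le_rfl,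
        fejerKernel_eq_sum_max (L := 2 * N) (by omega) (by omega),
        fejerKernel_eq_sum_max (L := 2 * N) (by omega) (by omega),
        fejerKernel_eq_sum_max (L := 2 * N) (by omega) (by omega)]
      have h0 : ∑ k ∈ Finset.Ico m (2 * N), μ k * Real.cos (k * t)
          = ∑ k ∈ Finset.Ico 1 (2 * N), μ k * Real.cos (k * t) := by
        refine Finset.sum_subset (Finset.Ico_subset_Ico_left hm) fun k hk hk2 => ?_
        rw [Finset.mem_Ico] at hk hk2
        rw [hμlow k (by omega), zero_mul]
      have h1 : ∑ k ∈ Finset.Ico 1 (2 * N), μ k * Real.cos (k * t)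
          = 2 * ∑ k ∈ Finset.Ico 1 (2 * N), τ (2 * N) k * Real.cos (k * t)
            - ∑ k ∈ Finset.Ico 1 (2 * N), τ N k * Real.cos (k * t)
            - (2 * ∑ k ∈ Finset.Ico 1 (2 * N), τ (2 * m) k * Real.cos (k * t)
            - ∑ k ∈ Finset.Ico 1 (2 * N), τ m k * Real.cos (k * t)) := by
        rw [Finset.mul_sum, Finset.mul_sum, ← Finset.sum_sub_distrib, ← Finset.sum_sub_distrib,
          ← Finset.sum_sub_distrib]
        exact Finset.sum_congr rfl fun k _ => by simp only [hμ]; ring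
      rw [h0, h1]
      ring
    have hc : ∀ M, Continuous (fejerKernel M) := fun M => continuous_trigSum _ _ _
    have hi : ∀ M, IntervalIntegrable (fejerKernel M) MeasureTheory.volume 0 (2 * Real.pi) :=
      fun M => (hc M).intervalIntegrable _ _
    calc ∫ t in (0 : ℝ)..(2 * Real.pi), |∑ k ∈ Finset.Ico m (2 * N), μ k * Real.cos (k * t)|
        ≤ ∫ t in (0 : ℝ)..(2 * Real.pi), ((2 * fejerKernel (2 * N) t + fejerKernel N t)
          + (2 * fejerKernel (2 * m) t + fejerKernel m t)) := by
          refine intervalIntegral.integral_mono_on (by positivity)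
            (Continuous.intervalIntegrable (by fun_prop) _ _)
            (Continuous.intervalIntegrable (by have := hc; fun_prop) _ _) fun t _ => ?_
          have p1 := fejerKernel_nonneg (N := 2 * N) (by omega) t
          have p2 := fejerKernel_nonneg (N := N) (by omega) t
          have p3 := fejerKernel_nonneg (N := 2 * m) (by omega) t
          have p4 := fejerKernel_nonneg (N := m) (by omega) t
          rw [hker, abs_le]
          constructor <;> linarith
      _ = 6 * Real.pi := by
        rw [intervalIntegral.integral_add (((hi _).const_mul _).add (hi _))
          (((hi _).const_mul _).add (hi _)),
          intervalIntegral.integral_add ((hi _).const_mul _) (hi _),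
          intervalIntegral.integral_add ((hi _).const_mul _) (hi _),
          intervalIntegral.integral_const_mul, intervalIntegral.integral_const_mul,
          integral_fejerKernel (by omega), integral_fejerKernel (by omega),
          integral_fejerKernel (by omega), integral_fejerKernel (by omega)]
        ring

/-! ### Regularity of the weights -/

/-- After an increase from x to y, the limit 0 forces a later decrease, and slopes of a convex
function cannot go from positive to negative. -/
lemma IsM.antitone {g : ℝ → ℝ} (hg : IsM g) {x y : ℝ} (hx : 1 ≤ x) (hxy : x ≤ y) : g y ≤ g x := by
  by_contra h
  push Not at h
  have hlt : x < y := lt_of_le_of_ne hxy fun he => by rw [he] at h; exact lt_irrefl _ h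
  have hev := (hg.tendsto.eventually_lt_const (hg.pos y (hx.trans hxy))).and
    (Filter.eventually_gt_atTop y)
  obtain ⟨z, hz1, hz2⟩ := hev.exists
  have hs := hg.convexOn.slope_mono_adjacent (x := x) (y := y) (z := z) hx
    (Set.mem_Ici.2 (by linarith)) hlt hz2
  have h1 : 0 < (g y - g x) / (y - x) := div_pos (by linarith) (by linarith)
  have h2 : (g z - g y) / (z - y) < 0 := div_neg_of_neg_of_pos (by linarith) (by linarith)
  linarith

/-- The graph lies above its right tangent at t, whose slope is at most g(t)/(Kt) in absolute value
by the bound on α. -/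
lemma IsM.sub_le {g : ℝ → ℝ} (hg : IsM g) {K t y : ℝ} (hK : 0 < K) (ht : 1 ≤ t)
    (hα : K ≤ alpha g t) (hty : t < y) : g t - g y ≤ g t * (y - t) / (K * t) := by
  have ht0 : 0 < t := by linarith
  set d := derivWithin g (Set.Ioi t) t with hd
  -- If the right derivative failed to exist, `derivWithin` would be 0 and α would be 0 too, against
  -- α ≥ K > 0. So existence follows from the hypothesis on α.
  have hd0 : d ≠ 0 := by
    intro h
    rw [alpha, ← hd, h] at hα
    simp at hα
    linarith
  have hdiff : DifferentiableWithinAt ℝ g (Set.Ioi t) t := by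
    by_contra h
    exact hd0 (derivWithin_zero_of_not_differentiableWithinAt h)
  have hslope := hg.convexOn.rightDeriv_le_slope (x := t) (y := y) ht
    (Set.mem_Ici.2 (by linarith)) hty hdiff
  rw [slope_def_field, le_div_iff₀ (by linarith)] at hslope
  have habs : |d| ≤ g t / (K * t) := by
    rw [alpha, ← hd, le_div_iff₀ (by positivity)] at hα
    rw [le_div_iff₀ (by positivity)]
    linarith
  have h1 : -|d| ≤ d := neg_abs_le d
  have h2 : -|d| * (y - t) ≤ d * (y - t) := mul_le_mul_of_nonneg_right h1 (by linarith)
  have h3 : |d| * (y - t) ≤ g t / (K * t) * (y - t) :=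
    mul_le_mul_of_nonneg_right habs (by linarith)
  rw [div_mul_eq_mul_div] at h3
  linarith

/-- Dilating t by 1 + K/2 costs at most half of g(t), by the tangent bound; finitely many such
dilations, in number depending only on K, exceed the factor 2. -/
lemma IsM0.exists_doubling {g : ℝ → ℝ} (hg : IsM0 g) :
    ∃ D : ℝ, 0 < D ∧ ∀ t, 1 ≤ t → g t ≤ D * g (2 * t) := by
  obtain ⟨hM, K, hK, hα⟩ := hg
  have hstep : ∀ t, 1 ≤ t → g t ≤ 2 * g (t * (1 + K / 2)) := by
    intro t ht
    have ht0 : 0 < t := by linarith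
    have h := hM.sub_le hK ht (hα t ht) (y := t * (1 + K / 2)) (by nlinarith)
    have : g t * (t * (1 + K / 2) - t) / (K * t) = g t / 2 := by field_simp; ring
    linarith
  have hiter : ∀ j : ℕ, ∀ t, 1 ≤ t → g t ≤ 2 ^ j * g (t * (1 + K / 2) ^ j) := by
    intro j
    induction j with
    | zero => intro t _; simp
    | succ j ih =>
      intro t ht
      have h1 : 1 ≤ t * (1 + K / 2) ^ j := by
        have : 1 ≤ (1 + K / 2) ^ j := one_le_pow₀ (by linarith)
        nlinarith
      calc g t ≤ 2 ^ j * g (t * (1 + K / 2) ^ j) := ih t ht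
        _ ≤ 2 ^ j * (2 * g (t * (1 + K / 2) ^ j * (1 + K / 2))) := by
          gcongr; exact hstep _ h1
        _ = _ := by rw [pow_succ, pow_succ]; ring_nf
  obtain ⟨j, hj⟩ := pow_unbounded_of_one_lt (2 : ℝ) (show 1 < 1 + K / 2 by linarith)
  refine ⟨2 ^ j, by positivity, fun t ht => (hiter j t ht).trans ?_⟩
  gcongr
  exact hM.antitone (by linarith) (by nlinarith)

lemma regularWeight_of_isM0 {ψ : ℝ → ℝ} {p s : ℝ} (hp : 1 ≤ p) (hM : IsM0 (gFun ψ (1 / p)))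
    (hGA : IsGAPlus fun k : ℕ => gFun ψ (s + 1 / p) (k : ℝ)) :
    RegularWeight (fun k : ℕ => ψ k) p s := by
  have hpos : ∀ k : ℕ, 1 ≤ k → 0 < ψ k := by
    intro k hk
    have h := hM.1.pos k (by exact_mod_cast hk)
    have hk0 : (0 : ℝ) < k := by exact_mod_cast hk
    exact (mul_pos_iff_of_pos_right (by positivity)).1 h
  refine ⟨hpos, ?_, ?_, ?_, ?_⟩
  · intro i j hi hij
    exact hM.1.antitone (by exact_mod_cast hi) (by exact_mod_cast hij)
  · obtain ⟨D, hD, h⟩ := hM.exists_doubling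
    refine ⟨D, hD, fun n hn => ?_⟩
    have := h n (by exact_mod_cast hn)
    simpa [gFun] using this
  · obtain ⟨K, hK, hα⟩ := hM.2
    refine ⟨1 / K + 1, by positivity, fun k hk => ?_⟩
    have hk0 : (0 : ℝ) < k := by exact_mod_cast hk
    have hk1 : (1 : ℝ) ≤ k := by exact_mod_cast hk
    have h1 := hM.1.sub_le hK hk1 (hα k hk1) (y := ((k + 1 : ℕ) : ℝ)) (by push_cast; linarith)
    have h2 := hM.1.antitone hk1 (y := ((k + 1 : ℕ) : ℝ)) (by push_cast; linarith)
    have hP : 0 < (k : ℝ) ^ (1 / p) := by positivity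
    have hw1 := hpos (k + 1) (by omega)
    have hg1 := hM.1.pos ((k + 1 : ℕ) : ℝ) (by push_cast; linarith)
    -- The tangent bound controls ψ(k) k^{1/p}, not ψ(k). Replacing (k + 1)^{1/p} by k^{1/p} costs a
    -- factor at least k/(k + 1) ≥ 1 - 1/k, as 1/p ≤ 1; this produces the + 1 in the constant.
    have hratio : gFun ψ (1 / p) ((k + 1 : ℕ) : ℝ) * (1 - 1 / k)
        ≤ ψ ((k + 1 : ℕ) : ℝ) * (k : ℝ) ^ (1 / p) := by
      have hk1pos : (0 : ℝ) < ((k + 1 : ℕ) : ℝ) := by positivity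
      have hle : (k : ℝ) / ((k + 1 : ℕ) : ℝ) ≤ ((k : ℝ) / ((k + 1 : ℕ) : ℝ)) ^ (1 / p) := by
        have := Real.rpow_le_rpow_of_exponent_ge (x := (k : ℝ) / ((k + 1 : ℕ) : ℝ)) (by positivity)
          (by rw [div_le_one hk1pos]; push_cast; linarith) (z := 1 / p) (y := 1)
          (by rw [div_le_one (by linarith)]; exact hp)
        rwa [Real.rpow_one] at this
      have hle2 : (1 : ℝ) - 1 / k ≤ (k : ℝ) / ((k + 1 : ℕ) : ℝ) := by
        push_cast
        rw [le_div_iff₀ (by positivity)]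
        have : 1 / (k : ℝ) * k = 1 := by field_simp
        have : 0 < 1 / (k : ℝ) := by positivity
        nlinarith
      calc _ ≤ gFun ψ (1 / p) ((k + 1 : ℕ) : ℝ) * ((k : ℝ) / ((k + 1 : ℕ) : ℝ)) ^ (1 / p) := by
            gcongr
            exact hle2.trans hle
        _ = _ := by
            rw [gFun, Real.div_rpow hk0.le hk1pos.le]
            have := (Real.rpow_pos_of_pos hk1pos (1 / p)).ne'
            field_simp
    have h3 : (ψ k - ψ ((k + 1 : ℕ) : ℝ)) * (k : ℝ) ^ (1 / p)
        ≤ (1 / K + 1) * ψ k / k * (k : ℝ) ^ (1 / p) := by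
      have e1 : gFun ψ (1 / p) k * (((k + 1 : ℕ) : ℝ) - k) / (K * k)
          = gFun ψ (1 / p) k * (1 / K) / k := by push_cast; field_simp; ring
      have e2 : (1 / K + 1) * ψ k / k * (k : ℝ) ^ (1 / p)
          = gFun ψ (1 / p) k * (1 / K) / k + gFun ψ (1 / p) k * (1 / k) := by
        rw [gFun]; field_simp
      have e3 : gFun ψ (1 / p) ((k + 1 : ℕ) : ℝ) * (1 / k) ≤ gFun ψ (1 / p) k * (1 / k) := by
        gcongr
      have e4 : gFun ψ (1 / p) k = ψ k * (k : ℝ) ^ (1 / p) := rfl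
      rw [e1] at h1
      rw [e2, sub_mul, ← e4]
      linarith
    exact le_of_mul_le_mul_right h3 hP
  · obtain ⟨ε, hε, hnonneg, K, h⟩ := hGA
    refine ⟨ε, hε, max K 1, by positivity, fun i j hi hij => ?_⟩
    refine (h i j hi hij).trans ?_
    exact mul_le_mul_of_nonneg_right (le_max_left _ _) (hnonneg j (hi.trans hij))

/-! ### Orders of the deviations -/

lemma abs_one_div_pi_mul_le (I : ℝ) : |1 / Real.pi * I| ≤ |I| := by
  rw [abs_mul, abs_of_pos (by positivity)]
  refine mul_le_of_le_one_left (abs_nonneg _) ?_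
  rw [div_le_one Real.pi_pos]
  linarith [Real.two_le_pi]

lemma abs_sum_mul_harmonic_le_rpow {p q : ℝ} (hpq : p.HolderConjugate q) {φ : ℝ → ℝ}
    (hφ : φ ∈ unitBall p) (s : Finset ℕ) (c : ℕ → ℝ) (θ x : ℝ) :
    |∑ k ∈ s, c k * harmonic φ θ k x|
      ≤ (∫ u in (0 : ℝ)..(2 * Real.pi), |∑ k ∈ s, c k * Real.cos (k * u - θ)| ^ q) ^ (1 / q) := by
  rw [sum_mul_harmonic (intervalIntegrable_of_mem_unitBall hpq.lt.le hφ)]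
  refine (abs_one_div_pi_mul_le _).trans ?_
  refine abs_integral_mul_le_rpow hpq hφ (G := fun u => ∑ k ∈ s, c k * Real.cos (k * u - θ))
    (by fun_prop) (fun u => ?_) x
  simp only [mul_add, add_sub_right_comm, Real.cos_add_nat_mul_two_pi]

lemma abs_sum_mul_harmonic_le_of_abs_le {φ : ℝ → ℝ} (hφ : φ ∈ unitBall 1) {s : Finset ℕ}
    {c : ℕ → ℝ} {θ B : ℝ} (hB : ∀ u : ℝ, |∑ k ∈ s, c k * Real.cos (k * u - θ)| ≤ B) (x : ℝ) :
    |∑ k ∈ s, c k * harmonic φ θ k x| ≤ B := by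
  rw [sum_mul_harmonic (intervalIntegrable_of_mem_unitBall le_rfl hφ)]
  exact (abs_one_div_pi_mul_le _).trans (abs_integral_mul_le_of_abs_le hφ hB x)

/-- The kernel is a rotated Dirichlet kernel. Hardy–Littlewood with all coefficients 1 gives its L_q
norm as O(j^{(q-1)/q}), and (q - 1)/q = 1/p. -/
lemma exists_abs_sum_harmonic_le {p q : ℝ} (hpq : p.HolderConjugate q) :
    ∃ C : ℝ, 0 < C ∧ ∀ φ ∈ unitBall p, ∀ θ x, ∀ j : ℕ,
      |∑ k ∈ Finset.Ico 1 (j + 1), harmonic φ θ k x| ≤ C * (j : ℝ) ^ (1 / p) := by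
  have hq : 1 < q := hpq.symm.lt
  have hp0 := hpq.pos
  have hq0 := hpq.symm.pos
  obtain ⟨C, hC, h⟩ := exists_integral_abs_sum_rpow_le hq
  set M : ℝ := max 1 (1 / (q - 1))
  have hM : 0 < M := by positivity
  refine ⟨(C * (M + 1)) ^ (1 / q), by positivity, fun φ hφ θ x j => ?_⟩
  rcases Nat.eq_zero_or_pos j with rfl | hj
  · simp; positivity
  have hj0 : (0 : ℝ) < j := by exact_mod_cast hj
  have h1 := abs_sum_mul_harmonic_le_rpow hpq hφ (Finset.Ico 1 (j + 1)) (fun _ => 1) θ x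
  have h2 := h (fun _ => 1) 1 (j + 1) θ le_rfl (by omega) (fun _ _ _ => zero_le_one)
    (fun _ _ _ _ _ => le_rfl)
  have h3 := sum_rpow_sub_one_le (η := q - 1) (by linarith) j
  simp only [one_mul, Real.one_rpow, Nat.cast_one, mul_one] at h1 h2
  have h4 : (1 : ℝ) ≤ (j : ℝ) ^ (q - 1) :=
    Real.one_le_rpow (by exact_mod_cast hj) (by linarith)
  simp only [show q - 1 - 1 = q - 2 by ring] at h3
  refine h1.trans ?_
  have h5 : 0 ≤ ∫ u in (0 : ℝ)..(2 * Real.pi),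
      |∑ k ∈ Finset.Ico 1 (j + 1), Real.cos (k * u - θ)| ^ q :=
    intervalIntegral.integral_nonneg (by positivity) fun u _ => by positivity
  calc _ ≤ (C * (M + 1) * (j : ℝ) ^ (q - 1)) ^ (1 / q) := by
        refine Real.rpow_le_rpow h5 (h2.trans ?_) (by positivity)
        rw [mul_assoc]
        gcongr
        linarith
    _ = _ := by
        rw [Real.mul_rpow (by positivity) (by positivity), ← Real.rpow_mul hj0.le]
        congr 2
        have := hpq.inv_add_inv_eq_one
        field_simp at this ⊢
        linarith

/-! ### Tails of series with decreasing, doubling terms -/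

lemma tail_pos {h : ℕ → ℝ} (hpos : ∀ k, 1 ≤ k → 0 < h k)
    (hsum : Summable fun k => h (k + 1)) {n : ℕ} (hn : 1 ≤ n) : 0 < ∑' j, h (n + j) := by
  have := sum_Ico_le_tsum (fun k hk => (hpos k hk).le) hsum hn (n + 1)
  simp at this
  exact (hpos n hn).trans_le this

lemma mul_le_tail {h : ℕ → ℝ} {D : ℝ} (hpos : ∀ k, 1 ≤ k → 0 < h k)
    (hanti : ∀ i j, 1 ≤ i → i ≤ j → h j ≤ h i) (hD : 0 ≤ D)
    (hdoub : ∀ n, 1 ≤ n → h n ≤ D * h (2 * n)) (hsum : Summable fun k => h (k + 1)) {n : ℕ}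
    (hn : 1 ≤ n) : n * h n ≤ D * ∑' j, h (n + j) :=
  (mul_le_sum_Ico_of_doubling hanti hD hdoub hn).trans
    (mul_le_mul_of_nonneg_left (sum_Ico_le_tsum (fun k hk => (hpos k hk).le) hsum hn _) hD)

/-- Test polynomials see only finitely many frequencies, all well above n. A finite sum captures
more than half of the tail, hence the factor 2, and doubling carries the blocks [n, 2n) and [2n, 4n)
to [4n, 8n), hence the powers of `D`. -/
lemma exists_tail_le {h : ℕ → ℝ} {D : ℝ} (hpos : ∀ k, 1 ≤ k → 0 < h k)
    (hanti : ∀ i j, 1 ≤ i → i ≤ j → h j ≤ h i) (hD : 0 < D)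
    (hdoub : ∀ n, 1 ≤ n → h n ≤ D * h (2 * n)) (hsum : Summable fun k => h (k + 1)) :
    ∃ E : ℝ, 0 < E ∧ ∀ n : ℕ, 1 ≤ n → ∃ N : ℕ, 8 * n ≤ N ∧
      ∑' j, h (n + j) ≤ E * ∑ k ∈ Finset.Ico (4 * n) N, h k := by
  refine ⟨2 * (1 + D ^ 2 + D ^ 3), by positivity, fun n hn => ?_⟩
  have hsum' : Summable fun j => h (n + j) := by
    have h1 : (fun j => h (n + j)) = fun j => h (j + (n - 1) + 1) :=
      funext fun j => by congr 1; omega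
    rw [h1]
    exact (summable_nat_add_iff (n - 1)).2 hsum
  have hS := tail_pos hpos hsum hn
  have hev := (hsum'.hasSum.tendsto_sum_nat.eventually_const_lt (half_lt_self hS)).and
    (Filter.eventually_ge_atTop (7 * n))
  obtain ⟨M, hM1, hM2⟩ := hev.exists
  have hIco : ∑ k ∈ Finset.Ico n (n + M), h k = ∑ j ∈ Finset.range M, h (n + j) := by
    rw [Finset.sum_Ico_eq_sum_range, Nat.add_sub_cancel_left]
  refine ⟨n + M, by omega, ?_⟩
  have hsplit : ∑ k ∈ Finset.Ico n (n + M), h k = ∑ k ∈ Finset.Ico n (2 * n), h k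
      + ∑ k ∈ Finset.Ico (2 * n) (2 * (2 * n)), h k + ∑ k ∈ Finset.Ico (4 * n) (n + M), h k := by
    rw [show 2 * (2 * n) = 4 * n by ring, Finset.sum_Ico_consecutive _ (by omega) (by omega),
      Finset.sum_Ico_consecutive _ (by omega) (by omega)]
  have b1 := sum_Ico_le_mul_of_antitone hanti hn
  have b2 := sum_Ico_le_mul_of_antitone hanti (n := 2 * n) (by omega)
  have b3 := mul_le_sum_Ico_of_doubling hanti hD.le hdoub (n := 4 * n) (by omega)
  have b4 : ∑ k ∈ Finset.Ico (4 * n) (2 * (4 * n)), h k ≤ ∑ k ∈ Finset.Ico (4 * n) (n + M), h k :=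
    Finset.sum_le_sum_of_subset_of_nonneg (Finset.Ico_subset_Ico_right (by omega))
      fun k hk _ => by rw [Finset.mem_Ico] at hk; exact (hpos k (by omega)).le
  set A := ∑ k ∈ Finset.Ico (4 * n) (n + M), h k
  have d1 := hdoub n hn
  have d2 := hdoub (2 * n) (by omega)
  rw [show 2 * (2 * n) = 4 * n by ring] at d2
  have hn0 : (0 : ℝ) < n := by exact_mod_cast hn
  have h4 := hpos (4 * n) (by omega)
  push_cast at b2 b3
  have c0 : n * h (4 * n) ≤ D * A := by
    have : D * ∑ k ∈ Finset.Ico (4 * n) (2 * (4 * n)), h k ≤ D * A := by gcongr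
    have : 0 ≤ n * h (4 * n) := by positivity
    linarith
  have c2 : n * h (2 * n) ≤ D * (D * A) := by
    calc (n : ℝ) * h (2 * n) ≤ n * (D * h (4 * n)) := by gcongr
      _ = D * (n * h (4 * n)) := by ring
      _ ≤ _ := by gcongr
  have c1 : n * h n ≤ D * (D * (D * A)) := by
    calc (n : ℝ) * h n ≤ n * (D * h (2 * n)) := by gcongr
      _ = D * (n * h (2 * n)) := by ring
      _ ≤ _ := by gcongr
  have hA4 : 2 * (n : ℝ) * h (2 * n) ≤ (D ^ 2 + D ^ 2) * A := by linarith
  have b3' : 0 ≤ A := by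
    have : 0 ≤ D * A := le_trans (by positivity) c0
    exact nonneg_of_mul_nonneg_right this hD
  rw [← hIco, hsplit] at hM1
  nlinarith [mul_nonneg (pow_nonneg hD.le 3) b3', mul_nonneg (pow_nonneg hD.le 2) b3']

/-- The sequence `ψ(k)^q k^{q-2}`. -/
lemma RegularWeight.rpow_mul_rpow_eq {w : ℕ → ℝ} {p q s : ℝ} (hw : RegularWeight w p s)
    (hpq : p.HolderConjugate q) {k : ℕ} (hk : 1 ≤ k) :
    w k ^ q * (k : ℝ) ^ (q - 2) = (w k * (k : ℝ) ^ (1 / p)) ^ q / k := by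
  have hk0 : (0 : ℝ) < k := by exact_mod_cast hk
  have hqp : 1 / p * q = q - 1 := by
    have h1 := hpq.inv_add_inv_eq_one
    have := hpq.pos; have := hpq.symm.pos
    field_simp at h1 ⊢
    linarith
  rw [Real.mul_rpow (hw.pos k hk).le (by positivity), ← Real.rpow_mul hk0.le, hqp, mul_div_assoc,
    ← Real.rpow_sub_one hk0.ne']
  ring_nf

/-- Written as (ψ(k) k^{1/p})^q / k, the term is visibly decreasing, whatever the sign of q - 2. -/
lemma RegularWeight.tail_antitone {w : ℕ → ℝ} {p q s : ℝ} (hw : RegularWeight w p s)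
    (hpq : p.HolderConjugate q) (i j : ℕ) (hi : 1 ≤ i) (hij : i ≤ j) :
    w j ^ q * (j : ℝ) ^ (q - 2) ≤ w i ^ q * (i : ℝ) ^ (q - 2) := by
  have hi0 : (0 : ℝ) < i := by exact_mod_cast hi
  rw [hw.rpow_mul_rpow_eq hpq hi, hw.rpow_mul_rpow_eq hpq (hi.trans hij)]
  have h1 := hw.pos j (hi.trans hij)
  have h2 := hw.pos i hi
  have h3 := hpq.symm.pos
  exact div_le_div₀ (by positivity)
    (Real.rpow_le_rpow (by positivity) (hw.anti i j hi hij) h3.le) hi0 (by exact_mod_cast hij)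

lemma RegularWeight.tail_doubling {w : ℕ → ℝ} {p q s : ℝ} (hw : RegularWeight w p s)
    (hpq : p.HolderConjugate q) :
    ∃ D : ℝ, 0 < D ∧ ∀ n : ℕ, 1 ≤ n → w n ^ q * (n : ℝ) ^ (q - 2)
      ≤ D * (w (2 * n) ^ q * ((2 * n : ℕ) : ℝ) ^ (q - 2)) := by
  obtain ⟨D, hD, h⟩ := hw.doubling
  refine ⟨2 * D ^ q, by positivity, fun n hn => ?_⟩
  have hn0 : (0 : ℝ) < n := by exact_mod_cast hn
  rw [hw.rpow_mul_rpow_eq hpq hn, hw.rpow_mul_rpow_eq hpq (by omega)]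
  have h1 := hw.pos n hn
  have h2 := hw.pos (2 * n) (by omega)
  have h3 := hpq.symm.pos
  have h4 := Real.rpow_le_rpow (by positivity) (h n hn) h3.le
  rw [Real.mul_rpow hD.le (by positivity)] at h4
  rw [div_le_iff₀ hn0]
  refine h4.trans (le_of_eq ?_)
  push_cast
  field_simp

lemma OrderLE.trans {A B C : ℕ → ℝ≥0∞} (h₁ : OrderLE A B) (h₂ : OrderLE B C) : OrderLE A C := by
  obtain ⟨K, hK, h₁⟩ := h₁
  obtain ⟨L, hL, h₂⟩ := h₂
  refine ⟨K * L, by positivity, fun n hn => (h₁ n hn).trans ?_⟩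
  rw [ENNReal.ofReal_mul hK.le, mul_assoc]
  gcongr
  exact h₂ n hn

lemma orderLE_of_le_ofReal_mul {A : ℕ → ℝ≥0∞} {x : ℕ → ℝ} {C : ℝ} (hC : 0 < C)
    (h : ∀ n, 1 ≤ n → A n ≤ ENNReal.ofReal (C * x n)) :
    OrderLE A fun n => ENNReal.ofReal (x n) :=
  ⟨C, hC, fun n hn => (h n hn).trans (ENNReal.ofReal_mul hC.le).le⟩

lemma orderLE_of_ofReal_div_le {A : ℕ → ℝ≥0∞} {x : ℕ → ℝ} {C : ℝ} (hC : 0 < C)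
    (h : ∀ n, 1 ≤ n → ENNReal.ofReal (x n / C) ≤ A n) :
    OrderLE (fun n => ENNReal.ofReal (x n)) A := by
  refine ⟨C, hC, fun n hn => ?_⟩
  calc ENNReal.ofReal (x n) = ENNReal.ofReal (C * (x n / C)) := by
        rw [mul_div_cancel₀ _ hC.ne']
    _ = ENNReal.ofReal C * ENNReal.ofReal (x n / C) := ENNReal.ofReal_mul hC.le
    _ ≤ _ := by gcongr; exact h n hn

/-- A Zygmund sum is an admissible polynomial, so the cycle closes with an upper bound for the
deviation and a lower bound for the best approximation. -/
lemma orderEq_of_orderLE {ψ : ℝ → ℝ} {β p s : ℝ} {T : ℕ → ℝ≥0∞}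
    (hU : OrderLE (zygmundError ψ β p s) T) (hL : OrderLE T (bestApprox ψ β p)) :
    OrderEq (bestApprox ψ β p) (zygmundError ψ β p s) ∧ OrderEq (zygmundError ψ β p s) T := by
  have hZ : OrderLE (bestApprox ψ β p) (zygmundError ψ β p s) :=
    ⟨1, one_pos, fun n _ => by
      rw [ENNReal.ofReal_one, one_mul]; exact bestApprox_le_zygmundError ψ β p s n⟩
  exact ⟨⟨hZ, hU.trans hL⟩, hU, hL.trans hZ⟩

/-! ### The case `p > 1` -/

lemma zygmundError_orderLE_tail {ψ : ℝ → ℝ} {β p q s : ℝ}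
    (hw : RegularWeight (fun k : ℕ => ψ k) p s) (hpq : p.HolderConjugate q) (hs : 0 < s)
    (hsum : Summable fun k : ℕ => ψ ((k + 1 : ℕ) : ℝ) ^ q * ((k + 1 : ℕ) : ℝ) ^ (q - 2)) :
    OrderLE (zygmundError ψ β p s) fun n => ENNReal.ofReal
      ((∑' j : ℕ, ψ ((n + j : ℕ) : ℝ) ^ q * ((n + j : ℕ) : ℝ) ^ (q - 2)) ^ (1 / q)) := by
  have hp := hpq.lt.le
  have hq := hpq.symm.lt
  have hq0 := hpq.symm.pos
  obtain ⟨D, hD, hdoub⟩ := hw.tail_doubling hpq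
  have hanti := hw.tail_antitone hpq
  set h : ℕ → ℝ := fun k => ψ k ^ q * (k : ℝ) ^ (q - 2) with hh
  have hpos : ∀ k : ℕ, 1 ≤ k → 0 < h k := by
    intro k hk
    have hk0 : (0 : ℝ) < k := by exact_mod_cast hk
    have := hw.pos k hk
    exact mul_pos (Real.rpow_pos_of_pos this q) (by positivity)
  set S : ℕ → ℝ := fun n => ∑' j, h (n + j) with hS
  have hSpos : ∀ n, 1 ≤ n → 0 < S n := fun n hn => tail_pos hpos hsum hn
  have hnh : ∀ n : ℕ, 1 ≤ n → n * h n ≤ D * S n := fun n hn =>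
    mul_le_tail hpos hanti hD.le hdoub hsum hn
  have hnh' : ∀ n : ℕ, 1 ≤ n → ψ n ^ q * (n : ℝ) ^ (q - 1) = n * h n := by
    intro n hn
    have hn0 : (0 : ℝ) < n := by exact_mod_cast hn
    have : (n : ℝ) ^ (q - 1) = (n : ℝ) ^ (q - 2) * n := by
      rw [← Real.rpow_add_one hn0.ne']; congr 1; ring
    rw [this, hh]; ring
  obtain ⟨C₁, hC₁, hHL⟩ := exists_integral_abs_sum_rpow_le hq
  obtain ⟨C₀, hC₀, hlow⟩ := exists_abs_sum_harmonic_le hpq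
  set c : ℝ := (C₁ * (1 + D)) ^ (1 / q) with hc
  have hcpos : 0 < c := by positivity
  have hhigh : ∀ φ ∈ unitBall p, ∀ x, ∀ n N : ℕ, 1 ≤ n → n < N →
      |∑ k ∈ Finset.Ico n N, (1 - k / N : ℝ) * ψ k * harmonic φ (β * Real.pi / 2) k x|
        ≤ c * S n ^ (1 / q) := by
    intro φ hφ x n N hn hnN
    have hn0 : (0 : ℝ) < n := by exact_mod_cast hn
    refine (abs_sum_mul_harmonic_le_rpow hpq hφ _ _ _ x).trans ?_
    have hψ0 : ∀ k : ℕ, n ≤ k → 0 ≤ ψ k := fun k hk => (hw.pos k (by omega)).le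
    have htap : ∀ k : ℕ, n ≤ k → k < N → 0 ≤ (1 - k / N : ℝ) * ψ k ∧ (1 - k / N : ℝ) * ψ k ≤ ψ k :=
      fun k h1 h2 => taper_nonneg_le (w := fun k : ℕ => ψ k) (hψ0 k h1) h2
    -- Tapering preserves monotonicity and only lowers the weights, so the bound is uniform in N;
    -- the boundary term is at most n h(n), absorbed by the tail.
    have h1 := hHL (fun k : ℕ => (1 - k / N : ℝ) * ψ k) n N (β * Real.pi / 2) hn hnN
      (fun k h1 h2 => (htap k h1 h2).1)
      (taper_antitone (w := fun k : ℕ => ψ k) hψ0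
        fun i j hi hij => hw.antitone hp (hn.trans hi) hij)
    have h2 : ∑ k ∈ Finset.Ico n N, ((1 - k / N : ℝ) * ψ k) ^ q * (k : ℝ) ^ (q - 2) ≤ S n := by
      refine le_trans (Finset.sum_le_sum fun k hk => ?_)
        (sum_Ico_le_tsum (fun k hk => (hpos k hk).le) hsum hn N)
      rw [Finset.mem_Ico] at hk
      obtain ⟨t1, t2⟩ := htap k hk.1 hk.2
      simp only [hh]
      gcongr
    have h3 : ((1 - n / N : ℝ) * ψ n) ^ q * (n : ℝ) ^ (q - 1) ≤ D * S n := by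
      obtain ⟨t1, t2⟩ := htap n le_rfl hnN
      refine le_trans ?_ (hnh n hn)
      rw [← hnh' n hn]
      gcongr
    have h4 : 0 ≤ ∫ u in (0 : ℝ)..(2 * Real.pi),
        |∑ k ∈ Finset.Ico n N, (1 - k / N : ℝ) * ψ k * Real.cos (k * u - β * Real.pi / 2)| ^ q :=
      intervalIntegral.integral_nonneg (by positivity) fun u _ => by positivity
    rw [hc, ← Real.mul_rpow (by positivity) (hSpos n hn).le]
    refine Real.rpow_le_rpow h4 (h1.trans ?_) (by positivity)
    rw [mul_assoc]
    gcongr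
    linarith
  obtain ⟨C, hC, hZ⟩ := exists_zygmundError_le (β := β) hw hp hs
    (fun φ hφ x j => hlow φ hφ (β * Real.pi / 2) x j) hhigh
  refine orderLE_of_le_ofReal_mul (C := c + C * C₀ * D ^ (1 / q)) (by positivity) fun n hn =>
    (hZ n hn).trans (ENNReal.ofReal_le_ofReal ?_)
  have hn0 : (0 : ℝ) < n := by exact_mod_cast hn
  have hψn : ψ n * (n : ℝ) ^ (1 / p) ≤ D ^ (1 / q) * S n ^ (1 / q) := by
    have hpsi := hw.pos n hn
    rw [← Real.mul_rpow hD.le (hSpos n hn).le]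
    have h1 := hnh n hn
    have h2 := hw.rpow_mul_rpow_eq hpq hn
    have h3 : (ψ n * (n : ℝ) ^ (1 / p)) ^ q ≤ D * S n := by
      refine le_trans (le_of_eq ?_) h1
      simp only [hh]
      rw [h2]; field_simp
    calc ψ n * (n : ℝ) ^ (1 / p) = ((ψ n * (n : ℝ) ^ (1 / p)) ^ q) ^ (1 / q) := by
          rw [← Real.rpow_mul (by positivity), mul_one_div_cancel hq0.ne', Real.rpow_one]
      _ ≤ _ := Real.rpow_le_rpow (by positivity) h3 (by positivity)
  change _ ≤ (c + C * C₀ * D ^ (1 / q)) * S n ^ (1 / q)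
  calc c * S n ^ (1 / q) + C * C₀ * (ψ n * (n : ℝ) ^ (1 / p))
      ≤ c * S n ^ (1 / q) + C * C₀ * (D ^ (1 / q) * S n ^ (1 / q)) := by gcongr
    _ = _ := by ring

lemma tail_orderLE_bestApprox {ψ : ℝ → ℝ} {β p q s : ℝ}
    (hw : RegularWeight (fun k : ℕ => ψ k) p s) (hpq : p.HolderConjugate q)
    (hsum : Summable fun k : ℕ => ψ ((k + 1 : ℕ) : ℝ) ^ q * ((k + 1 : ℕ) : ℝ) ^ (q - 2)) :
    OrderLE (fun n => ENNReal.ofReal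
      ((∑' j : ℕ, ψ ((n + j : ℕ) : ℝ) ^ q * ((n + j : ℕ) : ℝ) ^ (q - 2)) ^ (1 / q)))
      (bestApprox ψ β p) := by
  have hp := hpq.lt.le
  have hp0 := hpq.pos
  have hq := hpq.symm.lt
  have hq0 := hpq.symm.pos
  obtain ⟨D, hD, hdoub⟩ := hw.tail_doubling hpq
  have hanti := hw.tail_antitone hpq
  set h : ℕ → ℝ := fun k => ψ k ^ q * (k : ℝ) ^ (q - 2) with hh
  have hpos : ∀ k : ℕ, 1 ≤ k → 0 < h k := by
    intro k hk
    have hk0 : (0 : ℝ) < k := by exact_mod_cast hk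
    have := hw.pos k hk
    exact mul_pos (Real.rpow_pos_of_pos this q) (by positivity)
  obtain ⟨E, hE, htail⟩ := exists_tail_le hpos hanti hD hdoub hsum
  obtain ⟨C₁, hC₁, hHL⟩ := exists_integral_abs_sum_rpow_le hpq.lt
  set c : ℝ := (C₁ * (1 + D)) ^ (1 / p) with hc
  have hcpos : 0 < c := by positivity
  have hqp : (q - 1) * p = q := hpq.symm.sub_one_mul_conj
  refine orderLE_of_ofReal_div_le (C := E ^ (1 / q) * (4 * c)) (by positivity) fun n hn => ?_
  obtain ⟨N, hN, hle⟩ := htail n hn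
  set A := ∑ k ∈ Finset.Ico (4 * n) N, h k with hA
  -- Both ψ(k) b_k and b_k^p k^{p-2} equal h(k). So the test function takes the value `A` at 0,
  -- while Hardy–Littlewood bounds the norm of its derivative by c A^{1/p}; the quotient has order
  -- A^{1/q}.
  set b : ℕ → ℝ := fun k => ψ k ^ (q - 1) * (k : ℝ) ^ (q - 2) with hb
  have hS := tail_pos hpos hsum hn
  have hApos : 0 < A := by
    by_contra hneg
    push Not at hneg
    have : E * A ≤ 0 := mul_nonpos_of_nonneg_of_nonpos hE.le hneg
    linarith
  -- A product of two decreasing factors, since k^{q-2} alone may increase.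
  have hbeq : ∀ k : ℕ, 1 ≤ k →
      b k = (ψ k * (k : ℝ) ^ (1 / p)) ^ (q - 1) * (k : ℝ) ^ (-(1 / q)) := by
    intro k hk
    have hk0 : (0 : ℝ) < k := by exact_mod_cast hk
    simp only [hb]
    rw [Real.mul_rpow (hw.pos k hk).le (by positivity), ← Real.rpow_mul hk0.le, mul_assoc,
      ← Real.rpow_add hk0]
    congr 2
    have h1 := hpq.inv_add_inv_eq_one
    field_simp at h1 ⊢
    linear_combination (1 - q) * h1
  have hbanti : ∀ i j : ℕ, 4 * n ≤ i → i ≤ j → j < N → b j ≤ b i := by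
    intro i j hi hij _
    have hi0 : (0 : ℝ) < i := by exact_mod_cast (by omega : 0 < i)
    have hij' : (i : ℝ) ≤ j := by exact_mod_cast hij
    have h1 := hw.pos i (by omega)
    have h2 := hw.pos j (by omega)
    rw [hbeq i (by omega), hbeq j (by omega)]
    refine mul_le_mul (Real.rpow_le_rpow (by positivity) (hw.anti i j (by omega) hij) (by linarith))
      (Real.rpow_le_rpow_of_nonpos hi0 hij' (by simp; exact hq0.le)) (by positivity) (by positivity)
  have hbp : ∀ k : ℕ, 1 ≤ k → b k ^ p * (k : ℝ) ^ (p - 2) = h k := by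
    intro k hk
    have hk0 : (0 : ℝ) < k := by exact_mod_cast hk
    have h1 := hw.pos k hk
    simp only [hb, hh]
    rw [Real.mul_rpow (by positivity) (by positivity), ← Real.rpow_mul h1.le,
      ← Real.rpow_mul hk0.le, mul_assoc, ← Real.rpow_add hk0, hqp]
    congr 2
    linear_combination hqp
  have hbp1 : b (4 * n) ^ p * ((4 * n : ℕ) : ℝ) ^ (p - 1) = (4 * n : ℕ) * h (4 * n) := by
    have h0 : (0 : ℝ) < ((4 * n : ℕ) : ℝ) := by exact_mod_cast (by omega : 0 < 4 * n)
    rw [← hbp (4 * n) (by omega), show p - 1 = (p - 2) + 1 by ring, Real.rpow_add_one h0.ne']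
    ring
  have hnorm := hHL b (4 * n) N (-(β * Real.pi / 2)) (by omega) (by omega)
    (fun k h1 h2 => by have := hw.pos k (by omega); positivity) hbanti
  have hsumA : ∑ k ∈ Finset.Ico (4 * n) N, b k ^ p * (k : ℝ) ^ (p - 2) = A :=
    Finset.sum_congr rfl fun k hk => by rw [Finset.mem_Ico] at hk; exact hbp k (by omega)
  rw [hsumA, hbp1] at hnorm
  have hblock : (4 * n : ℕ) * h (4 * n) ≤ D * A := by
    refine (mul_le_sum_Ico_of_doubling hanti hD.le hdoub (by omega)).trans ?_
    refine mul_le_mul_of_nonneg_left ?_ hD.le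
    exact Finset.sum_le_sum_of_subset_of_nonneg (Finset.Ico_subset_Ico_right (by omega))
      fun k hk _ => by rw [Finset.mem_Ico] at hk; exact (hpos k (by omega)).le
  have hR : 0 < c * A ^ (1 / p) := by positivity
  have hRp : (c * A ^ (1 / p)) ^ p = C₁ * (1 + D) * A := by
    rw [hc, ← Real.mul_rpow (by positivity) hApos.le, ← Real.rpow_mul (by positivity),
      one_div_mul_cancel hp0.ne', Real.rpow_one]
  have hmain := le_bestApprox (β := β) hp hw.pos (μ := b) hn (m := 4 * n) (N := N) (by omega)
    (by omega) (θ := -(β * Real.pi / 2)) hR (by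
      rw [hRp]
      refine hnorm.trans ?_
      rw [mul_assoc]
      gcongr
      linarith) 0
  refine le_trans (ENNReal.ofReal_le_ofReal ?_) hmain
  -- The phase of the derivative was chosen to cancel βπ/2, so every cosine is 1 at 0.
  have hval : ∑ k ∈ Finset.Ico (4 * n) N, ψ k * b k
      * Real.cos (k * 0 - (-(β * Real.pi / 2) + β * Real.pi / 2)) = A := by
    refine Finset.sum_congr rfl fun k hk => ?_
    rw [Finset.mem_Ico] at hk
    have h1 := hw.pos k (by omega)
    simp only [hb, hh]
    rw [neg_add_cancel, mul_zero, sub_zero, Real.cos_zero, mul_one, ← mul_assoc,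
      Real.rpow_sub_one h1.ne']
    field_simp
  rw [hval, abs_of_pos hApos]
  change (∑' j, h (n + j)) ^ (1 / q) / _ ≤ _
  have hroot : (∑' j, h (n + j)) ^ (1 / q) ≤ E ^ (1 / q) * A ^ (1 / q) := by
    rw [← Real.mul_rpow hE.le hApos.le]
    exact Real.rpow_le_rpow hS.le hle (by positivity)
  have hAA : A = A ^ (1 / p) * A ^ (1 / q) := by
    rw [← Real.rpow_add hApos, one_div, one_div, hpq.inv_add_inv_eq_one, Real.rpow_one]
  rw [div_le_div_iff₀ (by positivity) (by positivity)]
  calc (∑' j, h (n + j)) ^ (1 / q) * (4 * (c * A ^ (1 / p)))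
      ≤ E ^ (1 / q) * A ^ (1 / q) * (4 * (c * A ^ (1 / p))) := by gcongr
    _ = (A ^ (1 / p) * A ^ (1 / q)) * (E ^ (1 / q) * (4 * c)) := by ring
    _ = _ := by rw [← hAA]

/-! ### The case `p = 1` -/

lemma RegularWeight.doubling_one {w : ℕ → ℝ} {s : ℝ} (hw : RegularWeight w 1 s) :
    ∃ D : ℝ, 0 < D ∧ ∀ n : ℕ, 1 ≤ n → w n ≤ D * w (2 * n) := by
  obtain ⟨D, hD, h⟩ := hw.doubling
  refine ⟨2 * D, by positivity, fun n hn => ?_⟩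
  have hn0 : (0 : ℝ) < n := by exact_mod_cast hn
  have := h n hn
  simp only [div_one, Real.rpow_one] at this
  push_cast at this
  refine le_of_mul_le_mul_right ?_ hn0
  linarith

lemma abs_harmonic_le_one {φ : ℝ → ℝ} (hφ : φ ∈ unitBall 1) (θ : ℝ) (k : ℕ) (x : ℝ) :
    |harmonic φ θ k x| ≤ 1 := by
  have := abs_sum_mul_harmonic_le_of_abs_le hφ (s := {k}) (c := fun _ => 1) (θ := θ) (B := 1)
    (fun u => by simpa using Real.abs_cos_le_one (k * u - θ)) x
  simpa using this

lemma abs_sum_harmonic_le {φ : ℝ → ℝ} (hφ : φ ∈ unitBall 1) (θ x : ℝ) (j : ℕ) :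
    |∑ k ∈ Finset.Ico 1 (j + 1), harmonic φ θ k x| ≤ 1 * (j : ℝ) ^ (1 / 1 : ℝ) := by
  refine (Finset.abs_sum_le_sum_abs _ _).trans ?_
  refine (Finset.sum_le_card_nsmul _ _ 1 fun k _ => abs_harmonic_le_one hφ θ k x).trans ?_
  simp

lemma zygmundError_one_orderLE_tail {ψ : ℝ → ℝ} {β s : ℝ}
    (hw : RegularWeight (fun k : ℕ => ψ k) 1 s) (hs : 0 < s)
    (hsum : Summable fun k : ℕ => ψ ((k + 1 : ℕ) : ℝ)) :
    OrderLE (zygmundError ψ β 1 s) fun n => ENNReal.ofReal (∑' j : ℕ, ψ ((n + j : ℕ) : ℝ)) := by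
  obtain ⟨D, hD, hdoub⟩ := hw.doubling_one
  have hpos : ∀ k : ℕ, 1 ≤ k → 0 < ψ k := hw.pos
  have hanti : ∀ i j : ℕ, 1 ≤ i → i ≤ j → ψ j ≤ ψ i := fun i j => hw.antitone le_rfl
  set S : ℕ → ℝ := fun n => ∑' j : ℕ, ψ ((n + j : ℕ) : ℝ) with hS
  have hhigh : ∀ φ ∈ unitBall 1, ∀ x, ∀ n N : ℕ, 1 ≤ n → n < N →
      |∑ k ∈ Finset.Ico n N, (1 - k / N : ℝ) * ψ k * harmonic φ (β * Real.pi / 2) k x| ≤ S n := by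
    intro φ hφ x n N hn hnN
    refine (Finset.abs_sum_le_sum_abs _ _).trans (le_trans (Finset.sum_le_sum fun k hk => ?_)
      (sum_Ico_le_tsum (h := fun k : ℕ => ψ k) (fun k hk => (hpos k hk).le) hsum hn N))
    rw [Finset.mem_Ico] at hk
    obtain ⟨t1, t2⟩ := taper_nonneg_le (w := fun k : ℕ => ψ k) (hpos k (by omega)).le hk.2
    rw [abs_mul, abs_of_nonneg t1]
    exact (mul_le_of_le_one_right t1 (abs_harmonic_le_one hφ _ k x)).trans t2
  obtain ⟨C, hC, hZ⟩ := exists_zygmundError_le (β := β) hw le_rfl hs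
    (fun φ hφ x j => abs_sum_harmonic_le hφ (β * Real.pi / 2) x j) hhigh
  refine orderLE_of_le_ofReal_mul (C := 1 + C * D) (by positivity) fun n hn =>
    (hZ n hn).trans (ENNReal.ofReal_le_ofReal ?_)
  have h1 := mul_le_tail (h := fun k : ℕ => ψ k) hpos hanti hD.le hdoub hsum hn
  have h2 : C * (n * ψ n) ≤ C * (D * S n) := by gcongr
  rw [div_one, Real.rpow_one]
  change _ ≤ (1 + C * D) * S n
  linarith

/-- When cos(βπ/2) = 0 the kernel is, up to sign, a sine sum whose coefficients satisfy the
condition that k b_k decreases, so it is bounded by its first block. -/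
lemma zygmundError_one_orderLE_mul {ψ : ℝ → ℝ} {β s : ℝ}
    (hw : RegularWeight (fun k : ℕ => ψ k) 1 s) (hs : 0 < s)
    (hβ : Real.cos (β * Real.pi / 2) = 0) :
    OrderLE (zygmundError ψ β 1 s) fun n => ENNReal.ofReal (ψ n * n) := by
  have hpi := Real.pi_pos
  have hpos : ∀ k : ℕ, 1 ≤ k → 0 < ψ k := hw.pos
  have hkw : ∀ n k : ℕ, 1 ≤ n → n ≤ k → k * ψ k ≤ n * ψ n := by
    intro n k hn hk
    have := hw.anti n k hn hk
    simp only [div_one, Real.rpow_one] at this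
    linarith
  have hsin : |Real.sin (β * Real.pi / 2)| = 1 := by
    have := Real.sin_sq_add_cos_sq (β * Real.pi / 2)
    rw [hβ] at this
    rw [← sq_eq_sq₀ (abs_nonneg _) zero_le_one, sq_abs]
    linarith
  have hhigh : ∀ φ ∈ unitBall 1, ∀ x, ∀ n N : ℕ, 1 ≤ n → n < N →
      |∑ k ∈ Finset.Ico n N, (1 - k / N : ℝ) * ψ k * harmonic φ (β * Real.pi / 2) k x|
        ≤ (Real.pi + 1) * (n * ψ n) := by
    intro φ hφ x n N hn hnN
    refine abs_sum_mul_harmonic_le_of_abs_le hφ (c := fun k : ℕ => (1 - k / N : ℝ) * ψ k)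
      (fun u => ?_) x
    have hψ0 : ∀ k : ℕ, n ≤ k → 0 ≤ ψ k := fun k hk => (hpos k (by omega)).le
    have h1 : ∑ k ∈ Finset.Ico n N, (1 - k / N : ℝ) * ψ k * Real.cos (k * u - β * Real.pi / 2)
        = Real.sin (β * Real.pi / 2)
          * ∑ k ∈ Finset.Ico n N, (1 - k / N : ℝ) * ψ k * Real.sin (k * u) := by
      rw [Finset.mul_sum]
      refine Finset.sum_congr rfl fun k _ => ?_
      rw [Real.cos_sub, hβ]; ring
    rw [h1, abs_mul, hsin, one_mul]
    have hkψ : ∀ i j, n ≤ i → i ≤ j → (fun k : ℕ => (k : ℝ) * ψ k) j ≤ (fun k : ℕ => (k : ℝ) * ψ k) i :=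
      fun i j hi hij => hkw i j (by omega) hij
    refine (abs_sum_mul_sin_le hn hnN
      (fun k h1 h2 => (taper_nonneg_le (w := fun k : ℕ => ψ k) (hψ0 k h1) h2).1)
      (taper_antitone (w := fun k : ℕ => ψ k) hψ0
        fun i j hi hij => hw.antitone le_rfl (hn.trans hi) hij) (fun k h1 h2 => ?_) u).trans ?_
    · have := taper_antitone (w := fun k : ℕ => (k : ℝ) * ψ k) (N := N)
        (fun k hk => mul_nonneg (Nat.cast_nonneg _) (hψ0 k hk)) hkψ n k le_rfl h1 h2
      linarith
    · have := (taper_nonneg_le (w := fun k : ℕ => ψ k) (hψ0 n le_rfl) hnN).2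
      gcongr
  obtain ⟨C, hC, hZ⟩ := exists_zygmundError_le (β := β) hw le_rfl hs
    (fun φ hφ x j => abs_sum_harmonic_le hφ (β * Real.pi / 2) x j) hhigh
  refine orderLE_of_le_ofReal_mul (C := Real.pi + 1 + C) (by positivity) fun n hn =>
    (hZ n hn).trans (ENNReal.ofReal_le_ofReal ?_)
  rw [div_one, Real.rpow_one]
  linarith

lemma tail_one_orderLE_bestApprox {ψ : ℝ → ℝ} {β s : ℝ}
    (hw : RegularWeight (fun k : ℕ => ψ k) 1 s)
    (hsum : Summable fun k : ℕ => ψ ((k + 1 : ℕ) : ℝ)) (hβ : Real.cos (β * Real.pi / 2) ≠ 0) :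
    OrderLE (fun n => ENNReal.ofReal (∑' j : ℕ, ψ ((n + j : ℕ) : ℝ))) (bestApprox ψ β 1) := by
  have hpi := Real.pi_pos
  obtain ⟨D, hD, hdoub⟩ := hw.doubling_one
  have hpos : ∀ k : ℕ, 1 ≤ k → 0 < ψ k := hw.pos
  have hanti : ∀ i j : ℕ, 1 ≤ i → i ≤ j → ψ j ≤ ψ i := fun i j => hw.antitone le_rfl
  obtain ⟨E, hE, htail⟩ := exists_tail_le (h := fun k : ℕ => ψ k) hpos hanti hD hdoub hsum
  have hcos : 0 < |Real.cos (β * Real.pi / 2)| := abs_pos.2 hβ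
  refine orderLE_of_ofReal_div_le
    (C := E * (4 * (6 * Real.pi)) / |Real.cos (β * Real.pi / 2)|) (by positivity) fun n hn => ?_
  obtain ⟨N, hN, hle⟩ := htail n hn
  -- The kernel starts at 2n, as the de la Vallée Poussin argument requires, and its coefficients
  -- are 1 on [4n, N], where the tail estimate lives.
  obtain ⟨μ, hμ0, hμ1, hμ⟩ := exists_kernel (m := 2 * n) (N := N) (by omega) (by omega)
  have hmain := le_bestApprox (β := β) le_rfl hpos (μ := μ) hn (m := 2 * n) (N := 2 * N) le_rfl
    (by omega) (θ := 0) (R := 6 * Real.pi) (by positivity) (by simpa using hμ) 0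
  refine le_trans (ENNReal.ofReal_le_ofReal ?_) hmain
  have hval : ∑ k ∈ Finset.Ico (2 * n) (2 * N), ψ k * μ k
      * Real.cos (k * 0 - (0 + β * Real.pi / 2))
      = (∑ k ∈ Finset.Ico (2 * n) (2 * N), ψ k * μ k) * Real.cos (β * Real.pi / 2) := by
    rw [Finset.sum_mul]
    refine Finset.sum_congr rfl fun k _ => ?_
    rw [mul_zero, zero_add, zero_sub, Real.cos_neg]
  have hsub : ∑ k ∈ Finset.Ico (4 * n) N, ψ k ≤ ∑ k ∈ Finset.Ico (2 * n) (2 * N), ψ k * μ k := by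
    calc ∑ k ∈ Finset.Ico (4 * n) N, ψ k = ∑ k ∈ Finset.Ico (4 * n) N, ψ k * μ k := by
          refine Finset.sum_congr rfl fun k hk => ?_
          rw [Finset.mem_Ico] at hk
          rw [hμ1 k (by omega) hk.2.le, mul_one]
      _ ≤ _ := Finset.sum_le_sum_of_subset_of_nonneg
          (Finset.Ico_subset_Ico (by omega) (by omega)) fun k hk _ => by
            rw [Finset.mem_Ico] at hk
            exact mul_nonneg (hpos k (by omega)).le (hμ0 k)
  have h0 : 0 ≤ ∑ k ∈ Finset.Ico (4 * n) N, ψ k := Finset.sum_nonneg fun k hk => by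
    rw [Finset.mem_Ico] at hk; exact (hpos k (by omega)).le
  rw [hval, abs_mul, abs_of_nonneg (h0.trans hsub), div_div_eq_mul_div, div_le_div_iff₀
    (by positivity) (by positivity)]
  calc (∑' j : ℕ, ψ ((n + j : ℕ) : ℝ)) * |Real.cos (β * Real.pi / 2)| * (4 * (6 * Real.pi))
      ≤ (E * ∑ k ∈ Finset.Ico (2 * n) (2 * N), ψ k * μ k) * |Real.cos (β * Real.pi / 2)|
        * (4 * (6 * Real.pi)) := by
        gcongr
        exact hle.trans (by gcongr)
    _ = _ := by ring

lemma mul_orderLE_bestApprox {ψ : ℝ → ℝ} {β s : ℝ}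
    (hw : RegularWeight (fun k : ℕ => ψ k) 1 s) (hβ : Real.cos (β * Real.pi / 2) = 0) :
    OrderLE (fun n => ENNReal.ofReal (ψ n * n)) (bestApprox ψ β 1) := by
  have hpi := Real.pi_pos
  obtain ⟨D, hD, hdoub⟩ := hw.doubling_one
  have hpos : ∀ k : ℕ, 1 ≤ k → 0 < ψ k := hw.pos
  have hanti : ∀ i j : ℕ, 1 ≤ i → i ≤ j → ψ j ≤ ψ i := fun i j => hw.antitone le_rfl
  have hsin : |Real.sin (β * Real.pi / 2)| = 1 := by
    have := Real.sin_sq_add_cos_sq (β * Real.pi / 2)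
    rw [hβ] at this
    rw [← sq_eq_sq₀ (abs_nonneg _) zero_le_one, sq_abs]
    linarith
  refine orderLE_of_ofReal_div_le (C := D ^ 3 * (2 * (4 * (6 * Real.pi)))) (by positivity)
    fun n hn => ?_
  have hn0 : (0 : ℝ) < n := by exact_mod_cast hn
  obtain ⟨μ, hμ0, hμ1, hμ⟩ := exists_kernel (m := 2 * n) (N := 8 * n) (by omega) (by omega)
  -- For 4n ≤ k ≤ 8n the angle kx lies in [π/4, π/2], where sin ≥ 1/2; for all k < 16n it stays in
  -- [0, π], so the remaining terms are nonnegative.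
  set x : ℝ := Real.pi / (16 * n) with hx
  have hxpos : 0 < x := by positivity
  have hnx : n * x = Real.pi / 16 := by rw [hx]; field_simp
  have hmain := le_bestApprox (β := β) le_rfl hpos (μ := μ) hn (m := 2 * n) (N := 2 * (8 * n))
    le_rfl (by omega) (θ := 0) (R := 6 * Real.pi) (by positivity) (by simpa using hμ) x
  refine le_trans (ENNReal.ofReal_le_ofReal ?_) hmain
  have hval : ∑ k ∈ Finset.Ico (2 * n) (2 * (8 * n)), ψ k * μ k
      * Real.cos (k * x - (0 + β * Real.pi / 2))
      = (∑ k ∈ Finset.Ico (2 * n) (2 * (8 * n)), ψ k * μ k * Real.sin (k * x))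
        * Real.sin (β * Real.pi / 2) := by
    rw [Finset.sum_mul]
    refine Finset.sum_congr rfl fun k _ => ?_
    rw [zero_add, Real.cos_sub, hβ]; ring
  have hsub : ∑ k ∈ Finset.Ico (4 * n) (2 * (4 * n)), ψ k / 2
      ≤ ∑ k ∈ Finset.Ico (2 * n) (2 * (8 * n)), ψ k * μ k * Real.sin (k * x) := by
    calc ∑ k ∈ Finset.Ico (4 * n) (2 * (4 * n)), ψ k / 2
        ≤ ∑ k ∈ Finset.Ico (4 * n) (2 * (4 * n)), ψ k * μ k * Real.sin (k * x) := by
          refine Finset.sum_le_sum fun k hk => ?_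
          rw [Finset.mem_Ico] at hk
          have h1 : (4 * n : ℝ) ≤ k := by exact_mod_cast hk.1
          have h2 : (k : ℝ) ≤ 8 * n := by exact_mod_cast (by omega : k ≤ 8 * n)
          have h3 : 4 * n * x ≤ k * x := by gcongr
          have h4 : k * x ≤ 8 * n * x := by gcongr
          have h5 := Real.mul_le_sin (x := k * x) (by positivity) (by linarith)
          have h6 : (1 : ℝ) / 2 ≤ 2 / Real.pi * (k * x) := by
            have : 2 / Real.pi * (Real.pi / 4) = 1 / 2 := by field_simp; norm_num
            rw [← this]
            gcongr
            linarith
          have h7 := hpos k (by omega)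
          rw [hμ1 k (by omega) (by omega), mul_one, div_eq_mul_one_div]
          gcongr
          exact h6.trans h5
      _ ≤ _ := Finset.sum_le_sum_of_subset_of_nonneg
          (Finset.Ico_subset_Ico (by omega) (by omega)) fun k hk _ => by
            rw [Finset.mem_Ico] at hk
            have h2 : (k : ℝ) ≤ 16 * n := by exact_mod_cast (by omega : k ≤ 16 * n)
            have h4 : k * x ≤ 16 * n * x := by gcongr
            exact mul_nonneg (mul_nonneg (hpos k (by omega)).le (hμ0 k))
              (Real.sin_nonneg_of_nonneg_of_le_pi (by positivity) (by linarith))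
  rw [← Finset.sum_div] at hsub
  have hblock := mul_le_sum_Ico_of_doubling (h := fun k : ℕ => ψ k) hanti hD.le hdoub (n := 4 * n)
    (by omega)
  have d1 := hdoub n hn
  have d2 := hdoub (2 * n) (by omega)
  rw [show 2 * (2 * n) = 4 * n by ring] at d2
  have h4 := hpos (4 * n) (by omega)
  set A := ∑ k ∈ Finset.Ico (4 * n) (2 * (4 * n)), ψ k
  set B := ∑ k ∈ Finset.Ico (2 * n) (2 * (8 * n)), ψ k * μ k * Real.sin (k * x)
  have hA : n * ψ ((4 * n : ℕ) : ℝ) ≤ D * A := by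
    rw [Nat.cast_mul] at hblock
    have : 0 ≤ n * ψ ((4 * n : ℕ) : ℝ) := by positivity
    push_cast at this hblock ⊢
    linarith
  have hfin : ψ n * n ≤ D ^ 3 * A := by
    calc ψ n * n ≤ D * (D * ψ ((4 * n : ℕ) : ℝ)) * n := by
          gcongr
          exact d1.trans (by gcongr)
      _ = D ^ 2 * (n * ψ ((4 * n : ℕ) : ℝ)) := by ring
      _ ≤ D ^ 2 * (D * A) := by gcongr
      _ = _ := by ring
  rw [hval, abs_mul, hsin, mul_one, div_le_div_iff₀ (by positivity) (by positivity)]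
  have hB : A / 2 ≤ |B| := hsub.trans (le_abs_self B)
  calc ψ n * n * (4 * (6 * Real.pi)) ≤ D ^ 3 * (2 * |B|) * (4 * (6 * Real.pi)) := by
        refine mul_le_mul_of_nonneg_right (hfin.trans ?_) (by positivity)
        gcongr
        linarith
    _ = _ := by ring

end ZygmundApprox

end

theorem theorem1 (s p β : ℝ) (ψ : ℝ → ℝ) (hs : 0 < s) (hp : 1 ≤ p)
    (hM : IsM0 (gFun ψ (1 / p)))
    (hGM : IsGMPlus fun k : ℕ => gFun ψ (s + 1 / p) (k : ℝ))
    (hGA : IsGAPlus fun k : ℕ => gFun ψ (s + 1 / p) (k : ℝ)) :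
    (1 < p → ∀ p' : ℝ, 1 / p + 1 / p' = 1 →
      (Summable fun k : ℕ => ψ ((k + 1 : ℕ) : ℝ) ^ p' * ((k + 1 : ℕ) : ℝ) ^ (p' - 2)) →
      p' / 2 < infAlpha (gFun ψ (1 / p)) →
        OrderEq (bestApprox ψ β p) (zygmundError ψ β p s) ∧
        OrderEq (zygmundError ψ β p s) (fun n => ENNReal.ofReal
          ((∑' j : ℕ, ψ ((n + j : ℕ) : ℝ) ^ p' * ((n + j : ℕ) : ℝ) ^ (p' - 2)) ^ (1 / p')))) ∧
    (p = 1 →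
      (Summable fun k : ℕ => ψ ((k + 1 : ℕ) : ℝ)) →
      1 < infAlpha (gFun ψ 1) →
        OrderEq (bestApprox ψ β p) (zygmundError ψ β p s) ∧
        (Real.cos (β * Real.pi / 2) ≠ 0 →
          OrderEq (zygmundError ψ β p s)
            (fun n => ENNReal.ofReal (∑' j : ℕ, ψ ((n + j : ℕ) : ℝ)))) ∧
        (Real.cos (β * Real.pi / 2) = 0 →
          OrderEq (zygmundError ψ β p s) (fun n => ENNReal.ofReal (ψ n * n)))) := by
  have hw := regularWeight_of_isM0 hp hM hGA
  refine ⟨fun hp1 q hpq hsum _ => ?_, ?_⟩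
  · have hconj : p.HolderConjugate q := by
      rw [Real.holderConjugate_iff]
      exact ⟨hp1, by simpa using hpq⟩
    exact orderEq_of_orderLE (zygmundError_orderLE_tail hw hconj hs hsum)
      (tail_orderLE_bestApprox hw hconj hsum)
  · rintro rfl hsum _
    by_cases hβ : Real.cos (β * Real.pi / 2) = 0
    · have h := orderEq_of_orderLE (zygmundError_one_orderLE_mul hw hs hβ)
        (mul_orderLE_bestApprox hw hβ)
      exact ⟨h.1, fun h0 => absurd hβ h0, fun _ => h.2⟩
    · have h := orderEq_of_orderLE (zygmundError_one_orderLE_tail hw hs hsum)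
        (tail_one_orderLE_bestApprox hw hsum hβ)
      exact ⟨h.1, fun _ => h.2, fun h0 => absurd h0 hβ⟩
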